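/- Let $d>0$, $\Omega:=\mathbb{R}\times(0,d)$, and let $\alpha\in W^{1,\infty}(\mathbb{R})$ be real-valued with $\alpha(x)>0$ for all $x\in\mathbb{R}$. On the complex Hilbert space $L^2(\Omega)$, whose inner product $(\cdot,\cdot)$ is antilinear in the first argument, consider the following. 1. The Robin Laplacian $H_\alpha\psi:=-\Delta\psi$ with domain $$D(H_\alpha):=\{\psi\in W^{2,2}(\Omega)\;:\;-\partial_y\psi(x,0)+\alpha(x)\psi(x,0)=0\ \text{ and }\ \partial_y\psi(x,d)+\alpha(x)\psi(x,d)=0\ \text{ for a.e. } x\in\mathbb{R}\},$$ where $\Delta\psi=\partial_x^2\psi+\partial_y^2\psi$ is taken in the weak sense and the boundary values are traces in $L^2(\mathbb{R})$. 2. The sesquilinear form with domain $D(h_\alpha):=W^{1,2}(\Omega)$, $$h_\alpha(\phi,\psi):=\int_\Omega\overline{\nabla\phi}\cdot\nabla\psi\,\mathrm{d}x\,\mathrm{d}y+\int_{\mathbb{R}}\alpha(x)\big(\overline{\phi(x,0)}\,\psi(x,0)+\overline{\phi(x,d)}\,\psi(x,d)\big)\,\mathrm{d}x,$$ with boundary values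 again in the sense of traces. Then $h_\alpha$ is densely defined, symmetric, nonnegative and closed. The associated operator $\tilde H_\alpha$, with domain $$D(\tilde H_\alpha)=\{\psi\in W^{1,2}(\Omega)\;:\;\exists\,F\in L^2(\Omega)\ \forall\,\phi\in W^{1,2}(\Omega),\ h_\alpha(\phi,\psi)=(\phi,F)\},\qquad \tilde H_\alpha\psi:=F,$$ is well defined and self-adjoint, and $$\tilde H_\alpha=H_\alpha$$ (equality of domains and of actions). In particular, $H_\alpha$ is self-adjoint. -/

import Mathlib

open MeasureTheory Filter Topology
open scoped ContDiff ComplexConjugate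

noncomputable section

namespace RobinStrip

/-- The strip `Ω = ℝ × (0, d)`. -/
def strip (d : ℝ) : Set (ℝ × ℝ) := Set.univ ×ˢ Set.Ioo 0 d

/-- The Hilbert space `L²(Ω)` of complex-valued functions. -/
abbrev L2Strip (d : ℝ) : Type := Lp ℂ 2 ((volume : Measure (ℝ × ℝ)).restrict (strip d))

/-- The Hilbert space `L²(ℝ)`, which holds the boundary values on each of the two lines. -/
abbrev L2Line : Type := Lp ℂ 2 (volume : Measure ℝ)

/-- Test functions on the strip: smooth with compact support contained in the open strip. -/
def IsTest (d : ℝ) (φ : ℝ × ℝ → ℂ) : Prop :=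
  ContDiff ℝ ∞ φ ∧ HasCompactSupport φ ∧ tsupport φ ⊆ strip d

/-- `g ∈ L²(Ω)` is the weak derivative of `u ∈ L²(Ω)` in the direction `v`. -/
def HasWeakDeriv (d : ℝ) (v : ℝ × ℝ) (u g : L2Strip d) : Prop :=
  ∀ φ : ℝ × ℝ → ℂ, IsTest d φ →
    ∫ p in strip d, u p * fderiv ℝ φ p v = -∫ p in strip d, g p * φ p

/-- The unit vector in the direction of the variable `x`. -/
def ex : ℝ × ℝ := (1, 0)

/-- The unit vector in the direction of the variable `y`. -/
def ey : ℝ × ℝ := (0, 1)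

open Classical in
/-- The weak derivative in the direction `v` (it is unique if it exists, see
`HasWeakDeriv.weakDeriv_eq`); the value is `0` if there is no weak derivative in `L²(Ω)`. -/
def weakDeriv (d : ℝ) (v : ℝ × ℝ) (u : L2Strip d) : L2Strip d :=
  if h : ∃ g, HasWeakDeriv d v u g then h.choose else 0

theorem isOpen_strip (d : ℝ) : IsOpen (strip d) := isOpen_univ.prod isOpen_Ioo

theorem IsTest.memLp {d : ℝ} {φ : ℝ × ℝ → ℂ} (h : IsTest d φ) :
    MemLp φ 2 ((volume : Measure (ℝ × ℝ)).restrict (strip d)) :=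
  h.1.continuous.memLp_of_hasCompactSupport h.2.1

theorem IsTest.memLp_fderiv {d : ℝ} {φ : ℝ × ℝ → ℂ} (h : IsTest d φ) (v : ℝ × ℝ) :
    MemLp (fun p => fderiv ℝ φ p v) 2 ((volume : Measure (ℝ × ℝ)).restrict (strip d)) := by
  have h1 : Continuous fun p => fderiv ℝ φ p v :=
    (h.1.continuous_fderiv (by simp)).clm_apply continuous_const
  exact h1.memLp_of_hasCompactSupport (h.2.1.fderiv_apply ℝ v)

theorem integrable_mul {d : ℝ} (u : L2Strip d) {f : ℝ × ℝ → ℂ}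
    (hf : MemLp f 2 ((volume : Measure (ℝ × ℝ)).restrict (strip d))) :
    Integrable (fun p => u p * f p) ((volume : Measure (ℝ × ℝ)).restrict (strip d)) :=
  (Lp.memLp u).integrable_mul hf

theorem integral_add_mul {d : ℝ} (u w : L2Strip d) {f : ℝ × ℝ → ℂ}
    (hf : MemLp f 2 ((volume : Measure (ℝ × ℝ)).restrict (strip d))) :
    ∫ p in strip d, (u + w : L2Strip d) p * f p =
      (∫ p in strip d, u p * f p) + ∫ p in strip d, w p * f p := by
  rw [← integral_add (integrable_mul u hf) (integrable_mul w hf)]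
  refine integral_congr_ae ?_
  filter_upwards [Lp.coeFn_add u w] with p hp
  rw [hp, Pi.add_apply, add_mul]

theorem integral_smul_mul {d : ℝ} (c : ℂ) (u : L2Strip d) (f : ℝ × ℝ → ℂ) :
    ∫ p in strip d, (c • u : L2Strip d) p * f p = c * ∫ p in strip d, u p * f p := by
  rw [← integral_const_mul]
  refine integral_congr_ae ?_
  filter_upwards [Lp.coeFn_smul c u] with p hp
  rw [hp, Pi.smul_apply, smul_eq_mul, mul_assoc]

theorem HasWeakDeriv.add {d : ℝ} {v : ℝ × ℝ} {u g u' g' : L2Strip d}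
    (h : HasWeakDeriv d v u g) (h' : HasWeakDeriv d v u' g') :
    HasWeakDeriv d v (u + u') (g + g') := by
  intro φ hφ
  rw [integral_add_mul _ _ (hφ.memLp_fderiv v), integral_add_mul _ _ hφ.memLp, h φ hφ, h' φ hφ,
    neg_add]

theorem HasWeakDeriv.smul {d : ℝ} {v : ℝ × ℝ} {u g : L2Strip d} (c : ℂ)
    (h : HasWeakDeriv d v u g) : HasWeakDeriv d v (c • u) (c • g) := by
  intro φ hφ
  rw [integral_smul_mul, integral_smul_mul, h φ hφ, mul_neg]

theorem HasWeakDeriv.zero (d : ℝ) (v : ℝ × ℝ) : HasWeakDeriv d v 0 0 := by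
  intro φ _
  have h0 : ∀ f : ℝ × ℝ → ℂ, ∫ p in strip d, (0 : L2Strip d) p * f p = 0 := fun f => by
    simpa using integral_smul_mul 0 (0 : L2Strip d) f
  rw [h0, h0, neg_zero]

theorem HasWeakDeriv.unique {d : ℝ} {v : ℝ × ℝ} {u g g' : L2Strip d}
    (h : HasWeakDeriv d v u g) (h' : HasWeakDeriv d v u g') : g = g' := by
  have hloc : LocallyIntegrableOn (fun p => g p - g' p) (strip d)
      (volume : Measure (ℝ × ℝ)) := by
    have h1 : MemLp (fun p => g p - g' p) 2 ((volume : Measure (ℝ × ℝ)).restrict (strip d)) :=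
      (Lp.memLp g).sub (Lp.memLp g')
    exact locallyIntegrableOn_of_locallyIntegrable_restrict (h1.locallyIntegrable (by norm_num))
  have key := (isOpen_strip d).ae_eq_zero_of_integral_contDiff_smul_eq_zero hloc (by
    intro f hf hfc hfs
    have hT : IsTest d (fun p => (f p : ℂ)) :=
      ⟨Complex.ofRealCLM.contDiff.comp hf, hfc.comp_left Complex.ofReal_zero,
        (closure_mono (Function.support_comp_subset Complex.ofReal_zero f)).trans hfs⟩
    have e : ∫ p in strip d, g p * (f p : ℂ) = ∫ p in strip d, g' p * (f p : ℂ) :=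
      neg_injective ((h _ hT).symm.trans (h' _ hT))
    rw [← setIntegral_eq_integral_of_forall_compl_eq_zero (s := strip d) (fun p hp => by
      have : f p = 0 := by
        by_contra hne
        exact hp (hfs (subset_tsupport f hne))
      simp [this])]
    have e2 : ∀ p, f p • (g p - g' p) = g p * (f p : ℂ) - g' p * (f p : ℂ) := fun p => by
      rw [Complex.real_smul]; ring
    simp_rw [e2]
    rw [integral_sub (integrable_mul g hT.memLp) (integrable_mul g' hT.memLp), e, sub_self])
  refine Lp.ext ?_
  rw [Filter.EventuallyEq, ae_restrict_iff' (isOpen_strip d).measurableSet]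
  filter_upwards [key] with p hp hps
  exact sub_eq_zero.1 (hp hps)

theorem HasWeakDeriv.weakDeriv_eq {d : ℝ} {v : ℝ × ℝ} {u g : L2Strip d}
    (h : HasWeakDeriv d v u g) : weakDeriv d v u = g := by
  have hex : ∃ g, HasWeakDeriv d v u g := ⟨g, h⟩
  rw [weakDeriv, dif_pos hex]
  exact hex.choose_spec.unique h

/-- The Sobolev space `W^{1,2}(Ω)`. -/
def W12 (d : ℝ) : Submodule ℂ (L2Strip d) where
  carrier := {u | (∃ g, HasWeakDeriv d ex u g) ∧ ∃ g, HasWeakDeriv d ey u g}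
  zero_mem' := ⟨⟨0, .zero d ex⟩, ⟨0, .zero d ey⟩⟩
  add_mem' := by
    rintro u w ⟨⟨a, ha⟩, ⟨b, hb⟩⟩ ⟨⟨a', ha'⟩, ⟨b', hb'⟩⟩
    exact ⟨⟨_, ha.add ha'⟩, ⟨_, hb.add hb'⟩⟩
  smul_mem' := by
    rintro c u ⟨⟨a, ha⟩, ⟨b, hb⟩⟩
    exact ⟨⟨_, ha.smul c⟩, ⟨_, hb.smul c⟩⟩

theorem W12.hasWeakDeriv_ex {d : ℝ} {u : L2Strip d} (h : u ∈ W12 d) :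
    HasWeakDeriv d ex u (weakDeriv d ex u) := by
  obtain ⟨g, hg⟩ := h.1
  rwa [hg.weakDeriv_eq]

theorem W12.hasWeakDeriv_ey {d : ℝ} {u : L2Strip d} (h : u ∈ W12 d) :
    HasWeakDeriv d ey u (weakDeriv d ey u) := by
  obtain ⟨g, hg⟩ := h.2
  rwa [hg.weakDeriv_eq]

theorem W12.weakDeriv_ex_add {d : ℝ} {u w : L2Strip d} (hu : u ∈ W12 d) (hw : w ∈ W12 d) :
    weakDeriv d ex (u + w) = weakDeriv d ex u + weakDeriv d ex w :=
  ((hasWeakDeriv_ex hu).add (hasWeakDeriv_ex hw)).weakDeriv_eq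

theorem W12.weakDeriv_ey_add {d : ℝ} {u w : L2Strip d} (hu : u ∈ W12 d) (hw : w ∈ W12 d) :
    weakDeriv d ey (u + w) = weakDeriv d ey u + weakDeriv d ey w :=
  ((hasWeakDeriv_ey hu).add (hasWeakDeriv_ey hw)).weakDeriv_eq

theorem W12.weakDeriv_ex_smul {d : ℝ} (c : ℂ) {u : L2Strip d} (hu : u ∈ W12 d) :
    weakDeriv d ex (c • u) = c • weakDeriv d ex u :=
  ((hasWeakDeriv_ex hu).smul c).weakDeriv_eq

theorem W12.weakDeriv_ey_smul {d : ℝ} (c : ℂ) {u : L2Strip d} (hu : u ∈ W12 d) :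
    weakDeriv d ey (c • u) = c • weakDeriv d ey u :=
  ((hasWeakDeriv_ey hu).smul c).weakDeriv_eq

/-- The Sobolev space `W^{2,2}(Ω)`: all weak derivatives of order at most two are in `L²(Ω)`. -/
def W22 (d : ℝ) : Submodule ℂ (L2Strip d) where
  carrier := {u | u ∈ W12 d ∧ weakDeriv d ex u ∈ W12 d ∧ weakDeriv d ey u ∈ W12 d}
  zero_mem' := by
    refine ⟨zero_mem _, ?_, ?_⟩
    · rw [(HasWeakDeriv.zero d ex).weakDeriv_eq]; exact zero_mem _
    · rw [(HasWeakDeriv.zero d ey).weakDeriv_eq]; exact zero_mem _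
  add_mem' := by
    rintro u w ⟨h, hx, hy⟩ ⟨h', hx', hy'⟩
    refine ⟨add_mem h h', ?_, ?_⟩
    · rw [W12.weakDeriv_ex_add h h']; exact add_mem hx hx'
    · rw [W12.weakDeriv_ey_add h h']; exact add_mem hy hy'
  smul_mem' := by
    rintro c u ⟨h, hx, hy⟩
    refine ⟨Submodule.smul_mem _ c h, ?_, ?_⟩
    · rw [W12.weakDeriv_ex_smul c h]; exact Submodule.smul_mem _ c hx
    · rw [W12.weakDeriv_ey_smul c h]; exact Submodule.smul_mem _ c hy

/-- Convergence in the norm of `W^{1,2}(Ω)` of (the restrictions to `Ω` of) the differentiable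
functions `Φ n` to `u`. -/
def TendstoW12 (d : ℝ) (Φ : ℕ → ℝ × ℝ → ℂ) (u : L2Strip d) : Prop :=
  Tendsto (fun n => eLpNorm (fun p => Φ n p - u p) 2
    ((volume : Measure (ℝ × ℝ)).restrict (strip d))) atTop (𝓝 0) ∧
  Tendsto (fun n => eLpNorm (fun p => fderiv ℝ (Φ n) p ex - weakDeriv d ex u p) 2
    ((volume : Measure (ℝ × ℝ)).restrict (strip d))) atTop (𝓝 0) ∧
  Tendsto (fun n => eLpNorm (fun p => fderiv ℝ (Φ n) p ey - weakDeriv d ey u p) 2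
    ((volume : Measure (ℝ × ℝ)).restrict (strip d))) atTop (𝓝 0)

/-- `g ∈ L²(ℝ)` is the trace of `u ∈ W^{1,2}(Ω)` on the boundary line `y = b` (`b = 0` or `b = d`):
the pair `(u, g)` is a limit, in `W^{1,2}(Ω) × L²(ℝ)`, of pairs `(Φ|_Ω, Φ(·, b))` with
`Φ ∈ C_c^∞(ℝ²)`, so the trace operator is the continuous extension of the restriction to the
boundary line. -/
def IsTrace (d b : ℝ) (u : L2Strip d) (g : L2Line) : Prop :=
  u ∈ W12 d ∧ ∃ Φ : ℕ → ℝ × ℝ → ℂ,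
    (∀ n, ContDiff ℝ ∞ (Φ n) ∧ HasCompactSupport (Φ n)) ∧
    TendstoW12 d Φ u ∧
    Tendsto (fun n => eLpNorm (fun x : ℝ => Φ n (x, b) - g x) 2 volume) atTop (𝓝 0)

open Classical in
/-- The trace of `u` on the line `y = b` (`b = 0` or `b = d`) as an element of `L²(ℝ)`. -/
def trace (d b : ℝ) (u : L2Strip d) : L2Line :=
  if h : ∃ g, IsTrace d b u g then h.choose else 0

/-- The Robin boundary conditions, in the sense of traces:
`-∂_y ψ(x, 0) + α(x) ψ(x, 0) = 0` and `∂_y ψ(x, d) + α(x) ψ(x, d) = 0` for almost every `x`.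
Here `s₀, s₁` are the traces of `ψ` and `t₀, t₁` those of `∂_y ψ`, on `y = 0` and `y = d`. -/
def RobinBC (d : ℝ) (α : ℝ → ℝ) (ψ : L2Strip d) : Prop :=
  ∃ s₀ s₁ t₀ t₁ : L2Line,
    IsTrace d 0 ψ s₀ ∧ IsTrace d d ψ s₁ ∧
    IsTrace d 0 (weakDeriv d ey ψ) t₀ ∧ IsTrace d d (weakDeriv d ey ψ) t₁ ∧
    (∀ᵐ x : ℝ, -t₀ x + (α x : ℂ) * s₀ x = 0) ∧ ∀ᵐ x : ℝ, t₁ x + (α x : ℂ) * s₁ x = 0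

theorem tendsto_eLpNorm_add {X : Type*} [MeasurableSpace X] {μ : Measure X}
    {f f' : ℕ → X → ℂ} (u u' : Lp ℂ 2 μ) (hf : ∀ n, AEStronglyMeasurable (f n) μ)
    (hf' : ∀ n, AEStronglyMeasurable (f' n) μ)
    (h : Tendsto (fun n => eLpNorm (fun p => f n p - u p) 2 μ) atTop (𝓝 0))
    (h' : Tendsto (fun n => eLpNorm (fun p => f' n p - u' p) 2 μ) atTop (𝓝 0)) :
    Tendsto (fun n => eLpNorm (fun p => (f n p + f' n p) - (u + u' : Lp ℂ 2 μ) p) 2 μ) atTop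
      (𝓝 0) := by
  have hs := h.add h'
  rw [add_zero] at hs
  refine tendsto_of_tendsto_of_tendsto_of_le_of_le tendsto_const_nhds hs (fun _ => zero_le)
    fun n => ?_
  have e : eLpNorm (fun p => (f n p + f' n p) - (u + u' : Lp ℂ 2 μ) p) 2 μ =
      eLpNorm ((fun p => f n p - u p) + fun p => f' n p - u' p) 2 μ := by
    refine eLpNorm_congr_ae ?_
    filter_upwards [Lp.coeFn_add u u'] with p hp
    simp only [hp, Pi.add_apply]
    ring
  rw [e]
  exact eLpNorm_add_le ((hf n).sub (Lp.aestronglyMeasurable u))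
    ((hf' n).sub (Lp.aestronglyMeasurable u')) (by norm_num)

theorem tendsto_eLpNorm_smul {X : Type*} [MeasurableSpace X] {μ : Measure X}
    {f : ℕ → X → ℂ} (c : ℂ) (u : Lp ℂ 2 μ)
    (h : Tendsto (fun n => eLpNorm (fun p => f n p - u p) 2 μ) atTop (𝓝 0)) :
    Tendsto (fun n => eLpNorm (fun p => c * f n p - (c • u : Lp ℂ 2 μ) p) 2 μ) atTop
      (𝓝 0) := by
  have hs := ENNReal.Tendsto.const_mul (a := ‖c‖ₑ) h (Or.inr (by simp))
  rw [mul_zero] at hs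
  refine hs.congr fun n => ?_
  rw [← eLpNorm_const_smul]
  refine eLpNorm_congr_ae ?_
  filter_upwards [Lp.coeFn_smul c u] with p hp
  simp only [hp, Pi.smul_apply, smul_eq_mul]
  ring

theorem IsTrace.add {d b : ℝ} {u u' : L2Strip d} {g g' : L2Line}
    (h : IsTrace d b u g) (h' : IsTrace d b u' g') : IsTrace d b (u + u') (g + g') := by
  obtain ⟨hu, Φ, hΦ, ⟨h0, hx, hy⟩, ht⟩ := h
  obtain ⟨hu', Φ', hΦ', ⟨h0', hx', hy'⟩, ht'⟩ := h'
  have hd : ∀ n p v, fderiv ℝ (fun q => Φ n q + Φ' n q) p v =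
      fderiv ℝ (Φ n) p v + fderiv ℝ (Φ' n) p v := fun n p v => by
    rw [fderiv_fun_add ((hΦ n).1.differentiable (by simp) p)
      ((hΦ' n).1.differentiable (by simp) p)]
    rfl
  have hm : ∀ {Ψ : ℝ × ℝ → ℂ}, ContDiff ℝ ∞ Ψ → ∀ v, AEStronglyMeasurable
      (fun p => fderiv ℝ Ψ p v) ((volume : Measure (ℝ × ℝ)).restrict (strip d)) :=
    fun hΨ v => ((hΨ.continuous_fderiv (by simp)).clm_apply
      continuous_const).aestronglyMeasurable
  refine ⟨add_mem hu hu', fun n q => Φ n q + Φ' n q,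
    fun n => ⟨(hΦ n).1.add (hΦ' n).1, (hΦ n).2.add (hΦ' n).2⟩, ⟨?_, ?_, ?_⟩, ?_⟩
  · exact tendsto_eLpNorm_add u u' (fun n => (hΦ n).1.continuous.aestronglyMeasurable)
      (fun n => (hΦ' n).1.continuous.aestronglyMeasurable) h0 h0'
  · simp_rw [hd, W12.weakDeriv_ex_add hu hu']
    exact tendsto_eLpNorm_add _ _ (fun n => hm (hΦ n).1 ex) (fun n => hm (hΦ' n).1 ex) hx hx'
  · simp_rw [hd, W12.weakDeriv_ey_add hu hu']
    exact tendsto_eLpNorm_add _ _ (fun n => hm (hΦ n).1 ey) (fun n => hm (hΦ' n).1 ey) hy hy'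
  · exact tendsto_eLpNorm_add g g'
      (fun n => ((hΦ n).1.continuous.comp (by fun_prop)).aestronglyMeasurable)
      (fun n => ((hΦ' n).1.continuous.comp (by fun_prop)).aestronglyMeasurable) ht ht'

theorem IsTrace.smul {d b : ℝ} {u : L2Strip d} {g : L2Line} (c : ℂ)
    (h : IsTrace d b u g) : IsTrace d b (c • u) (c • g) := by
  obtain ⟨hu, Φ, hΦ, ⟨h0, hx, hy⟩, ht⟩ := h
  have hd : ∀ n p v, fderiv ℝ (fun q => c * Φ n q) p v = c * fderiv ℝ (Φ n) p v :=
    fun n p v => by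
      rw [fderiv_const_mul ((hΦ n).1.differentiable (by simp) p)]
      rfl
  refine ⟨Submodule.smul_mem _ c hu, fun n q => c * Φ n q,
    fun n => ⟨contDiff_const.mul (hΦ n).1, (hΦ n).2.mul_left⟩, ⟨?_, ?_, ?_⟩, ?_⟩
  · exact tendsto_eLpNorm_smul c u h0
  · simp_rw [hd, W12.weakDeriv_ex_smul c hu]
    exact tendsto_eLpNorm_smul c _ hx
  · simp_rw [hd, W12.weakDeriv_ey_smul c hu]
    exact tendsto_eLpNorm_smul c _ hy
  · exact tendsto_eLpNorm_smul c g ht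

theorem IsTrace.zero (d b : ℝ) : IsTrace d b 0 0 := by
  have z : ∀ {X : Type} [MeasurableSpace X] (μ : Measure X),
      Tendsto (fun _ : ℕ => eLpNorm (fun p => (0 : ℂ) - (0 : Lp ℂ 2 μ) p) 2 μ) atTop (𝓝 0) := by
    intro X _ μ
    have : eLpNorm (fun p => (0 : ℂ) - (0 : Lp ℂ 2 μ) p) 2 μ = 0 := by
      rw [← eLpNorm_zero (α := X) (ε := ℂ) (p := 2) (μ := μ)]
      refine eLpNorm_congr_ae ?_
      filter_upwards [Lp.coeFn_zero ℂ 2 μ] with p hp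
      rw [hp, Pi.zero_apply, sub_zero]
    rw [this]
    exact tendsto_const_nhds
  refine ⟨zero_mem _, fun _ _ => 0, fun _ => ⟨contDiff_const, HasCompactSupport.zero⟩,
    ⟨z _, ?_, ?_⟩, z _⟩
  · simpa [(HasWeakDeriv.zero d ex).weakDeriv_eq] using z _
  · simpa [(HasWeakDeriv.zero d ey).weakDeriv_eq] using z _

/-- The domain of the Robin Laplacian: the functions in `W^{2,2}(Ω)` which satisfy the Robin
boundary conditions. -/
def robinDomain (d : ℝ) (α : ℝ → ℝ) : Submodule ℂ (L2Strip d) where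
  carrier := {ψ | ψ ∈ W22 d ∧ RobinBC d α ψ}
  zero_mem' := by
    have h0 := (HasWeakDeriv.zero d ey).weakDeriv_eq
    refine ⟨zero_mem _, 0, 0, 0, 0, .zero d 0, .zero d d, ?_, ?_, ?_, ?_⟩
    · rw [h0]; exact .zero d 0
    · rw [h0]; exact .zero d d
    all_goals
      filter_upwards [Lp.coeFn_zero ℂ 2 (volume : Measure ℝ)] with x hx
      rw [hx]
      simp
  add_mem' := by
    rintro u w ⟨hu, s₀, s₁, t₀, t₁, hs₀, hs₁, ht₀, ht₁, e₀, e₁⟩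
      ⟨hw, s₀', s₁', t₀', t₁', hs₀', hs₁', ht₀', ht₁', e₀', e₁'⟩
    refine ⟨add_mem hu hw, s₀ + s₀', s₁ + s₁', t₀ + t₀', t₁ + t₁', hs₀.add hs₀', hs₁.add hs₁',
      ?_, ?_, ?_, ?_⟩
    · rw [W12.weakDeriv_ey_add hu.1 hw.1]; exact ht₀.add ht₀'
    · rw [W12.weakDeriv_ey_add hu.1 hw.1]; exact ht₁.add ht₁'
    · filter_upwards [Lp.coeFn_add s₀ s₀', Lp.coeFn_add t₀ t₀', e₀, e₀'] with x h1 h2 h3 h4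
      rw [h1, h2, Pi.add_apply, Pi.add_apply]
      linear_combination h3 + h4
    · filter_upwards [Lp.coeFn_add s₁ s₁', Lp.coeFn_add t₁ t₁', e₁, e₁'] with x h1 h2 h3 h4
      rw [h1, h2, Pi.add_apply, Pi.add_apply]
      linear_combination h3 + h4
  smul_mem' := by
    rintro c u ⟨hu, s₀, s₁, t₀, t₁, hs₀, hs₁, ht₀, ht₁, e₀, e₁⟩
    refine ⟨Submodule.smul_mem _ c hu, c • s₀, c • s₁, c • t₀, c • t₁, hs₀.smul c, hs₁.smul c,
      ?_, ?_, ?_, ?_⟩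
    · rw [W12.weakDeriv_ey_smul c hu.1]; exact ht₀.smul c
    · rw [W12.weakDeriv_ey_smul c hu.1]; exact ht₁.smul c
    · filter_upwards [Lp.coeFn_smul c s₀, Lp.coeFn_smul c t₀, e₀] with x h1 h2 h3
      rw [h1, h2, Pi.smul_apply, Pi.smul_apply, smul_eq_mul, smul_eq_mul]
      linear_combination c * h3
    · filter_upwards [Lp.coeFn_smul c s₁, Lp.coeFn_smul c t₁, e₁] with x h1 h2 h3
      rw [h1, h2, Pi.smul_apply, Pi.smul_apply, smul_eq_mul, smul_eq_mul]
      linear_combination c * h3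

/-- The Robin Laplacian `H_α ψ = -Δψ = -(∂_x ∂_x ψ + ∂_y ∂_y ψ)` with domain `robinDomain d α`. -/
def robinLaplacian (d : ℝ) (α : ℝ → ℝ) : L2Strip d →ₗ.[ℂ] L2Strip d where
  domain := robinDomain d α
  toFun :=
    { toFun := fun ψ =>
        -(weakDeriv d ex (weakDeriv d ex ψ) + weakDeriv d ey (weakDeriv d ey ψ))
      map_add' := by
        rintro ⟨u, ⟨h, hx, hy⟩, _⟩ ⟨w, ⟨h', hx', hy'⟩, _⟩
        simp only [Submodule.coe_add]
        rw [W12.weakDeriv_ex_add h h', W12.weakDeriv_ey_add h h', W12.weakDeriv_ex_add hx hx',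
          W12.weakDeriv_ey_add hy hy']
        abel
      map_smul' := by
        rintro c ⟨u, ⟨h, hx, hy⟩, _⟩
        simp only [Submodule.coe_smul, RingHom.id_apply]
        rw [W12.weakDeriv_ex_smul c h, W12.weakDeriv_ey_smul c h, W12.weakDeriv_ex_smul c hx,
          W12.weakDeriv_ey_smul c hy, smul_neg, smul_add] }

/-- The sesquilinear form `h_α` with domain `W^{1,2}(Ω)`. -/
def robinForm (d : ℝ) (α : ℝ → ℝ) (φ ψ : W12 d) : ℂ :=
  (∫ p in strip d,
    (conj (weakDeriv d ex φ p) * weakDeriv d ex ψ p +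
      conj (weakDeriv d ey φ p) * weakDeriv d ey ψ p)) +
  ∫ x : ℝ, (α x : ℂ) *
    (conj (trace d 0 φ x) * trace d 0 ψ x + conj (trace d d φ x) * trace d d ψ x)

section Forms

variable {E : Type*} [NormedAddCommGroup E] [InnerProductSpace ℂ E]

/-- `h` is a densely defined, nonnegative, symmetric, closed sesquilinear form with domain `D`
(antilinear in the first argument, linear in the second). -/
structure IsClosedNonnegForm (D : Submodule ℂ E) (h : D → D → ℂ) : Prop where
  dense : Dense (D : Set E)
  add_right : ∀ φ ψ χ, h φ (ψ + χ) = h φ ψ + h φ χ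
  smul_right : ∀ (c : ℂ) (φ ψ : D), h φ (c • ψ) = c * h φ ψ
  symm : ∀ φ ψ, h φ ψ = conj (h ψ φ)
  nonneg : ∀ ψ, 0 ≤ (h ψ ψ).re
  closed : ∀ (u : ℕ → D) (v : E), Tendsto (fun n => (u n : E)) atTop (𝓝 v) →
    Tendsto (fun m : ℕ × ℕ => h (u m.1 - u m.2) (u m.1 - u m.2)) atTop (𝓝 0) →
    ∃ hv : v ∈ D, Tendsto (fun n => h (u n - ⟨v, hv⟩) (u n - ⟨v, hv⟩)) atTop (𝓝 0)

/-- `T` is the operator associated with the form `h` on `D`: its domain consists of the `ψ ∈ D` for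
which there is `F ∈ E` with `h(φ, ψ) = (φ, F)` for all `φ ∈ D`, and `T ψ = F`. This determines
the graph of `T`, hence `T`. -/
def IsFormOperator (D : Submodule ℂ E) (h : D → D → ℂ) (T : E →ₗ.[ℂ] E) : Prop :=
  ∀ ψ F : E, (ψ, F) ∈ T.graph ↔ ∃ hψ : ψ ∈ D, ∀ φ : D, h φ ⟨ψ, hψ⟩ = inner ℂ (φ : E) F

theorem IsFormOperator.unique {D : Submodule ℂ E} {h : D → D → ℂ} {T S : E →ₗ.[ℂ] E}
    (hT : IsFormOperator D h T) (hS : IsFormOperator D h S) : T = S := by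
  refine LinearPMap.eq_of_eq_graph (Submodule.ext ?_)
  rintro ⟨ψ, F⟩
  rw [hT ψ F, hS ψ F]

open Classical in
/-- The operator associated with the form `h` on `D` (and a junk value if there is none). -/
def formOperator (D : Submodule ℂ E) (h : D → D → ℂ) : E →ₗ.[ℂ] E :=
  if H : ∃ T, IsFormOperator D h T then H.choose else ⊥

end Forms

/-- The operator `H̃_α` associated with the form `h_α` on `W^{1,2}(Ω)`. -/
def robinFormOperator (d : ℝ) (α : ℝ → ℝ) : L2Strip d →ₗ.[ℂ] L2Strip d :=
  formOperator (W12 d) (robinForm d α)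

/-- `α ∈ W^{1,∞}(ℝ)`: `α` is essentially bounded and has an essentially bounded weak derivative. -/
def MemW1Inf (α : ℝ → ℝ) : Prop :=
  MemLp α ⊤ volume ∧ ∃ β : ℝ → ℝ, MemLp β ⊤ volume ∧
    ∀ φ : ℝ → ℝ, ContDiff ℝ ∞ φ → HasCompactSupport φ →
      ∫ x, α x * deriv φ x = -∫ x, β x * φ x

end RobinStrip

end

/-! The form and the Robin Laplacian are tied together through graphs: both `robinFormOperator` and
`robinLaplacian` are shown to satisfy `IsFormOperator`, which leaves room for one operator only.

The abstract half is the representation theorem. For a densely defined, closed, nonnegative form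
`h`, the inner product `h(φ, ψ) + (φ, ψ)` makes the form domain complete, so Riesz representation
solves `(T + 1)ψ = F` for every `F` (`exists_resolvent`). A symmetric operator for which `T + 1` is
onto is self-adjoint.

The concrete half begins with density. Contracting the plane towards the middle of the strip moves
the strip away from its boundary, and mollification then shows that restrictions of functions in
`C_c^∞(ℝ²)` are dense in `W^{1,2}(Ω)`. Hence the trace inequality and Green's formulas extend from
smooth functions by continuity. The form is closed because `α ≥ 0` makes it dominate the gradient,
while traces are continuous in the `W^{1,2}` norm.

For `ψ` in `W^{2,2}(Ω)`, Green's formulas give `h(φ, ψ) = (φ, -Δψ)` plus boundary terms, which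
vanish under the Robin conditions; this is one inclusion. For the other, a weak solution must be
shown to lie in `W^{2,2}(Ω)`. Translations along the strip commute with weak derivatives and traces,
so they change the form only by the commutator of `α` with the translation, which is `O(t)` because
`α` is Lipschitz. Testing with a second difference then bounds the gradient of `ψ(x + t, y) - ψ(x,
y)` by `C t` (`exists_norm_shift_gradient_le`), which puts `∂_x∂_xψ` and `∂_x∂_yψ` in `L²`; the
equation itself supplies `∂_y∂_yψ`. Green's formulas now leave boundary terms that vanish against
every trace, and the traces separate the two boundary lines, so the Robin conditions hold. -/

noncomputable section

namespace RobinStrip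

open scoped ENNReal Convolution
open ContinuousLinearMap (lsmul)

/-! ### Representation theorem for closed nonnegative forms -/

section FormTheory

variable {E : Type*} [NormedAddCommGroup E] [InnerProductSpace ℂ E]

/-- The domain of a form, as a type which is to carry the form norm instead of the norm of `E`. -/
def FormSpace (D : Submodule ℂ E) : Type _ := D

instance (D : Submodule ℂ E) : AddCommGroup (FormSpace D) := inferInstanceAs (AddCommGroup D)

instance (D : Submodule ℂ E) : Module ℂ (FormSpace D) := inferInstanceAs (Module ℂ D)

namespace IsClosedNonnegForm

variable {D : Submodule ℂ E} {h : D → D → ℂ}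

theorem add_left (H : IsClosedNonnegForm D h) (φ ψ χ : D) : h (φ + ψ) χ = h φ χ + h ψ χ := by
  rw [H.symm, H.add_right, map_add, ← H.symm, ← H.symm]

theorem smul_left (H : IsClosedNonnegForm D h) (c : ℂ) (φ ψ : D) :
    h (c • φ) ψ = conj c * h φ ψ := by
  rw [H.symm, H.smul_right, map_mul, ← H.symm]

theorem ofReal_re (H : IsClosedNonnegForm D h) (ψ : D) : ((h ψ ψ).re : ℂ) = h ψ ψ :=
  Complex.conj_eq_iff_re.1 (H.symm ψ ψ).symm

/-- The inner product `h(φ, ψ) + (φ, ψ)` on the form domain. -/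
@[reducible] def core (H : IsClosedNonnegForm D h) : InnerProductSpace.Core ℂ (FormSpace D) where
  inner φ ψ := h φ ψ + inner ℂ (Subtype.val φ : E) (Subtype.val ψ)
  conj_inner_symm φ ψ := (map_add conj _ _).trans
    (congrArg₂ _ (H.symm φ ψ).symm (inner_conj_symm _ _))
  re_inner_nonneg ψ := by
    have h1 := H.nonneg ψ
    have h2 : 0 ≤ (inner ℂ (Subtype.val ψ : E) (Subtype.val ψ)).re :=
      inner_self_nonneg (𝕜 := ℂ)
    exact add_nonneg h1 h2
  add_left φ ψ χ := by
    have h1 := H.add_left φ ψ χ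
    have h2 : inner ℂ (Subtype.val φ + Subtype.val ψ : E) (Subtype.val χ) = _ :=
      inner_add_left (𝕜 := ℂ) _ _ _
    change h _ _ + inner ℂ (Subtype.val φ + Subtype.val ψ : E) (Subtype.val χ) = _
    rw [h2]
    exact (congrArg (· + _) h1).trans (by ring)
  smul_left φ ψ c := by
    have h1 := H.smul_left c φ ψ
    have h2 : inner ℂ (c • Subtype.val φ : E) (Subtype.val ψ) = _ :=
      inner_smul_left (𝕜 := ℂ) _ _ _
    change h _ _ + inner ℂ (c • Subtype.val φ : E) (Subtype.val ψ) = _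
    rw [h2]
    exact (congrArg (· + _) h1).trans (by ring)
  -- The form may have a kernel; definiteness comes from the added term `(ψ, ψ)`.
  definite ψ h0 := by
    have h1 := H.nonneg ψ
    have h2 : (inner ℂ (Subtype.val ψ : E) (Subtype.val ψ)).re = ‖(Subtype.val ψ : E)‖ ^ 2 :=
      (norm_sq_eq_re_inner (𝕜 := ℂ) _).symm
    have h3 := congrArg Complex.re h0
    rw [Complex.add_re, h2, Complex.zero_re] at h3
    have h4 : ‖(Subtype.val ψ : E)‖ = 0 := by nlinarith [norm_nonneg (Subtype.val ψ : E)]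
    exact Subtype.ext (norm_eq_zero.1 h4)

/-- The Lax--Milgram theorem for the form `h + 1`. -/
theorem exists_resolvent [CompleteSpace E] (H : IsClosedNonnegForm D h) (F : E) :
    ∃ ψ : D, ∀ φ : D, h φ ψ + inner ℂ (φ : E) (ψ : E) = inner ℂ (φ : E) F := by
  let : NormedAddCommGroup (FormSpace D) := H.core.toNormedAddCommGroup
  let : InnerProductSpace ℂ (FormSpace D) := InnerProductSpace.ofCore H.core.toCore
  have inner_def : ∀ φ ψ : FormSpace D,
      inner ℂ φ ψ = h φ ψ + inner ℂ (Subtype.val φ : E) (Subtype.val ψ) := fun _ _ => rfl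
  have nsq : ∀ φ : FormSpace D, ‖φ‖ ^ 2 = (h φ φ).re + ‖(Subtype.val φ : E)‖ ^ 2 := fun φ => by
    rw [norm_sq_eq_re_inner (𝕜 := ℂ) φ, inner_def, norm_sq_eq_re_inner (𝕜 := ℂ) (Subtype.val φ : E)]
    rfl
  have nle : ∀ φ : FormSpace D, ‖(Subtype.val φ : E)‖ ≤ ‖φ‖ := fun φ => by
    refine le_of_sq_le_sq ?_ (norm_nonneg _)
    rw [nsq]
    linarith [H.nonneg φ]
  have hnorm : ∀ φ : D, ‖h φ φ‖ = (h φ φ).re := fun φ => by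
    rw [← H.ofReal_re, Complex.norm_real, Complex.ofReal_re, Real.norm_eq_abs,
      abs_of_nonneg (H.nonneg φ)]
  have hle : ∀ φ : FormSpace D, ‖h φ φ‖ ≤ ‖φ‖ ^ 2 := fun φ => (hnorm φ).le.trans (by
    rw [nsq]
    nlinarith [norm_nonneg (Subtype.val φ : E)])
  -- Completeness is closedness of the form in disguise: a Cauchy sequence for the form norm
  -- converges in `E` and is Cauchy for `h`.
  have : CompleteSpace (FormSpace D) := by
    refine Metric.complete_of_cauchySeq_tendsto fun u hu => ?_
    have hc := (cauchySeq_iff_tendsto_dist_atTop_0 (u := u)).1 hu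
    have hE : CauchySeq fun n => (Subtype.val (u n) : E) := by
      rw [cauchySeq_iff_tendsto_dist_atTop_0]
      refine squeeze_zero (fun _ => dist_nonneg) (fun m => ?_) hc
      rw [dist_eq_norm, dist_eq_norm]
      exact nle (u m.1 - u m.2)
    obtain ⟨v, hv⟩ := cauchySeq_tendsto_of_complete hE
    have hh : Tendsto (fun m : ℕ × ℕ => h (u m.1 - u m.2) (u m.1 - u m.2)) atTop (𝓝 0) := by
      refine squeeze_zero_norm (fun m => (hle _).trans ?_) (by simpa using hc.pow 2)
      rw [← dist_eq_norm]
    obtain ⟨hvD, ht⟩ := H.closed u v hv hh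
    let w : FormSpace D := (⟨v, hvD⟩ : D)
    refine ⟨w, tendsto_iff_norm_sub_tendsto_zero.2 ?_⟩
    have h1 : Tendsto (fun n => ‖u n - w‖ ^ 2) atTop (𝓝 0) := by
      have h2 := (Complex.continuous_re.tendsto _).comp ht
      have h3 := ((tendsto_iff_norm_sub_tendsto_zero.1 hv).pow 2)
      have h4 := h2.add h3
      simp only [Complex.zero_re, ne_eq, OfNat.ofNat_ne_zero, not_false_eq_true, zero_pow,
        add_zero] at h4
      refine h4.congr fun n => ?_
      rw [nsq]
      rfl
    have h5 := h1.sqrt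
    rw [Real.sqrt_zero] at h5
    exact h5.congr fun n => Real.sqrt_sq (norm_nonneg _)
  -- The functional `φ ↦ (F, φ)` is bounded by `‖F‖` in the form norm. Riesz puts the representing
  -- vector in the antilinear slot, hence the conjugations at the end.
  let f : FormSpace D →ₗ[ℂ] ℂ := (innerSL ℂ F).toLinearMap ∘ₗ D.subtype
  let g : StrongDual ℂ (FormSpace D) := f.mkContinuous ‖F‖ fun φ =>
    (norm_inner_le_norm F (Subtype.val φ : E)).trans
      (mul_le_mul_of_nonneg_left (nle φ) (norm_nonneg _))
  let ψ := (InnerProductSpace.toDual ℂ (FormSpace D)).symm g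
  refine ⟨ψ, fun φ => ?_⟩
  have e : inner ℂ ψ (φ : FormSpace D) = inner ℂ F (φ : E) :=
    InnerProductSpace.toDual_symm_apply
  have e2 := congrArg conj e
  let φ' : FormSpace D := φ
  exact (inner_conj_symm (𝕜 := ℂ) φ' ψ).symm.trans (e2.trans (inner_conj_symm _ _))

/-- Linearity of `h` in the second slot makes the relation a subspace of `E × E`, and density of `D`
determines `F` from `ψ`; so the relation is the graph of an operator. -/
theorem exists_formOperator [CompleteSpace E] (H : IsClosedNonnegForm D h) :
    ∃ T : E →ₗ.[ℂ] E, IsFormOperator D h T := by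
  have hadd := H.add_right
  have hsmul := H.smul_right
  let G : Submodule ℂ (E × E) :=
    { carrier := {q | ∃ hψ : q.1 ∈ D, ∀ φ : D, h φ ⟨q.1, hψ⟩ = inner ℂ (φ : E) q.2}
      zero_mem' := ⟨zero_mem _, fun φ => by
        have := hsmul 0 φ 0
        rw [zero_smul, zero_mul] at this
        rw [Prod.snd_zero, inner_zero_right]
        exact this⟩
      add_mem' := by
        rintro p q ⟨hp, ep⟩ ⟨hq, eq⟩
        refine ⟨add_mem hp hq, fun φ => ?_⟩
        rw [Prod.snd_add, inner_add_right, ← ep, ← eq, ← hadd]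
        rfl
      smul_mem' := by
        rintro c p ⟨hp, ep⟩
        refine ⟨D.smul_mem c hp, fun φ => ?_⟩
        rw [Prod.smul_snd, inner_smul_right, ← ep, ← hsmul]
        rfl }
  have hG : ∀ x ∈ G, x.1 = 0 → x.2 = 0 := by
    rintro ⟨ψ, F⟩ ⟨hψ, e⟩ (rfl : ψ = 0)
    refine H.dense.eq_zero_of_inner_right (𝕜 := ℂ) fun φ hφ => ?_
    rw [← e ⟨φ, hφ⟩]
    have := hsmul 0 ⟨φ, hφ⟩ 0
    rw [zero_smul, zero_mul] at this
    exact this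
  refine ⟨G.toLinearPMap, fun ψ F => ?_⟩
  rw [Submodule.toLinearPMap_graph_eq _ hG]
  rfl

end IsClosedNonnegForm

/-- Symmetry of `h` gives a symmetric operator, and solvability of `(T + 1)w = F` for all `F` leaves
no room for a larger adjoint. -/
theorem IsFormOperator.isSelfAdjoint [CompleteSpace E] {D : Submodule ℂ E} {h : D → D → ℂ}
    {T : E →ₗ.[ℂ] E} (hT : IsFormOperator D h T) (H : IsClosedNonnegForm D h) :
    IsSelfAdjoint T := by
  have hform : ∀ x : T.domain, ∃ hx : (x : E) ∈ D, ∀ φ : D, h φ ⟨x, hx⟩ = inner ℂ (φ : E) (T x) :=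
    fun x => (hT x (T x)).1 (T.mem_graph x)
  have hsymm : T.IsFormalAdjoint T := by
    intro x y
    obtain ⟨hx, ex⟩ := hform x
    obtain ⟨hy, ey⟩ := hform y
    have e1 := ex ⟨y, hy⟩
    have e2 := ey ⟨x, hx⟩
    rw [H.symm, e2] at e1
    have e3 := congrArg conj e1
    rw [Complex.conj_conj, inner_conj_symm] at e3
    exact e3.symm
  have hsurj : ∀ F : E, ∃ w : T.domain, T w + (w : E) = F := by
    intro F
    obtain ⟨ψ, hψ⟩ := H.exists_resolvent F
    have hg : ((ψ : E), F - ψ) ∈ T.graph := by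
      refine (hT _ _).2 ⟨ψ.2, fun φ => ?_⟩
      rw [inner_sub_right, ← hψ φ]
      ring
    obtain ⟨w, hw1, hw2⟩ := T.mem_graph_iff.1 hg
    refine ⟨w, ?_⟩
    simp only at hw1 hw2
    rw [hw1, hw2, sub_add_cancel]
  -- A vector orthogonal to the domain has the form `T w + w`; pairing it with `w` gives `h(w, w) +
  -- ‖w‖² = 0`, so `w = 0`.
  have hdense : Dense (T.domain : Set E) := by
    rw [Submodule.dense_iff_topologicalClosure_eq_top, Submodule.topologicalClosure_eq_top_iff,
      Submodule.eq_bot_iff]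
    intro f hf
    obtain ⟨w, rfl⟩ := hsurj f
    have h0 : inner ℂ (w : E) (T w + (w : E)) = 0 := hf w w.2
    obtain ⟨hw, ew⟩ := hform w
    rw [inner_add_right, ← ew ⟨w, hw⟩] at h0
    have h1 := congrArg Complex.re h0
    have h2 : (inner ℂ (w : E) (w : E)).re = ‖(w : E)‖ ^ 2 :=
      (norm_sq_eq_re_inner (𝕜 := ℂ) _).symm
    rw [Complex.add_re, h2, Complex.zero_re] at h1
    have h4 : ‖(w : E)‖ = 0 := by nlinarith [norm_nonneg (w : E), H.nonneg ⟨w, hw⟩]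
    have h5 : w = 0 := Subtype.ext (norm_eq_zero.1 h4)
    rw [h5, T.map_zero]
    simp
  rw [LinearPMap.isSelfAdjoint_def]
  refine le_antisymm ?_ (hsymm.le_adjoint hdense)
  have key : ∀ v : (LinearPMap.adjoint T).domain, ∃ w : T.domain, (w : E) = v ∧
      T w = LinearPMap.adjoint T v := by
    intro v
    have hv := LinearPMap.adjoint_isFormalAdjoint hdense v
    obtain ⟨w, hw⟩ := hsurj (LinearPMap.adjoint T v + v)
    -- With `T w + w = T* v + v`, the vector `v - w` is orthogonal to `T x + x` for every `x`;
    -- choose `x` so that this is `v - w` itself.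
    have hz : ((v : E) - w) = 0 := by
      obtain ⟨x, hx⟩ := hsurj ((v : E) - w)
      rw [← inner_self_eq_zero (𝕜 := ℂ)]
      nth_rewrite 2 [← hx]
      have e1 := hv x
      have e2 := hsymm w x
      have e3 := congrArg (fun z => inner ℂ z (x : E)) hw
      simp only [inner_add_left] at e3
      rw [inner_add_right, inner_sub_left, inner_sub_left]
      linear_combination -e1 + e2 - e3
    have hz' := (sub_eq_zero.1 hz).symm
    refine ⟨w, hz', ?_⟩
    rw [hz'] at hw
    exact add_right_cancel hw
  refine ⟨fun v hv => ?_, fun v x hvx => ?_⟩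
  · obtain ⟨w, hw, -⟩ := key ⟨v, hv⟩
    simp only at hw
    rw [← hw]
    exact w.2
  · obtain ⟨w, hw, e⟩ := key v
    have : w = x := Subtype.ext (hw.trans hvx)
    rw [← e, this]

theorem isFormOperator_formOperator {D : Submodule ℂ E} {h : D → D → ℂ}
    (H : ∃ T, IsFormOperator D h T) : IsFormOperator D h (formOperator D h) := by
  rw [formOperator, dif_pos H]
  exact H.choose_spec

end FormTheory

/-! ### Squares of `L²` norms as lower integrals -/

theorem eLpNorm_two_sq {X F : Type*} [MeasurableSpace X] [NormedAddCommGroup F] {μ : Measure X}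
    (f : X → F) : eLpNorm f 2 μ ^ 2 = ∫⁻ x, ‖f x‖ₑ ^ 2 ∂μ := by
  have := eLpNorm_nnreal_pow_eq_lintegral (f := f) (μ := μ) (p := 2) (by norm_num)
  simpa using this

theorem tendsto_eLpNorm_two_iff {X F ι : Type*} [MeasurableSpace X] [NormedAddCommGroup F]
    {μ : Measure X} {l : Filter ι} (f : ι → X → F) :
    Tendsto (fun n => eLpNorm (f n) 2 μ) l (𝓝 0) ↔
      Tendsto (fun n => ∫⁻ x, ‖f n x‖ₑ ^ 2 ∂μ) l (𝓝 0) := by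
  simp_rw [← eLpNorm_two_sq]
  constructor
  · intro h
    have := ((ENNReal.continuous_pow 2).tendsto 0).comp h
    simpa [Function.comp_def] using this
  · intro h
    have := ((ENNReal.continuous_rpow_const (y := 1 / 2)).tendsto 0).comp h
    rw [ENNReal.zero_rpow_of_pos (by norm_num)] at this
    refine this.congr fun n => ?_
    simp only [Function.comp]
    rw [← ENNReal.rpow_natCast, ← ENNReal.rpow_mul]
    norm_num

/-- The Cauchy--Schwarz inequality against the constant function `1`. -/
theorem sq_lintegral_le {X : Type*} [MeasurableSpace X] (ν : Measure X) {g : X → ℝ≥0∞}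
    (hg : AEMeasurable g ν) : (∫⁻ x, g x ∂ν) ^ 2 ≤ ν Set.univ * ∫⁻ x, g x ^ 2 ∂ν := by
  have h := ENNReal.lintegral_mul_le_Lp_mul_Lq ν Real.HolderConjugate.two_two
    (aemeasurable_const (b := (1 : ℝ≥0∞))) hg
  simp only [Pi.mul_apply, one_mul, ENNReal.one_rpow, lintegral_one] at h
  have h2 := pow_le_pow_left₀ zero_le h 2
  refine h2.trans (le_of_eq ?_)
  rw [mul_pow, ← ENNReal.rpow_natCast, ← ENNReal.rpow_natCast, ← ENNReal.rpow_mul,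
    ← ENNReal.rpow_mul]
  norm_num

/-! ### Mollification along a dilation towards the middle of the strip -/

/-- A mollified function has `L²` norm at most that of the function. -/
theorem lintegral_convolution_normed_le (ρ : ContDiffBump (0 : ℝ × ℝ)) {f : ℝ × ℝ → ℂ}
    (hf : Measurable f) :
    ∫⁻ p, ‖(ρ.normed volume ⋆[lsmul ℝ ℝ, volume] f) p‖ₑ ^ 2 ≤ ∫⁻ p, ‖f p‖ₑ ^ 2 := by
  have hc : Continuous (ρ.normed (volume : Measure (ℝ × ℝ))) := ρ.continuous_normed
  have h1 : ∫⁻ t, ENNReal.ofReal (ρ.normed (volume : Measure (ℝ × ℝ)) t) = 1 := by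
    rw [← ofReal_integral_eq_lintegral_ofReal ρ.integrable_normed
      (Eventually.of_forall ρ.nonneg_normed), ρ.integral_normed, ENNReal.ofReal_one]
  have hpt : ∀ p, ‖(ρ.normed volume ⋆[lsmul ℝ ℝ, volume] f) p‖ₑ ^ 2 ≤
      ∫⁻ t, ENNReal.ofReal (ρ.normed (volume : Measure (ℝ × ℝ)) t) * ‖f (p - t)‖ₑ ^ 2 := by
    intro p
    have hm : Measurable fun t => ‖f (p - t)‖ₑ :=
      (hf.comp (measurable_const.sub measurable_id)).enorm
    have hw : Measurable fun t => ENNReal.ofReal (ρ.normed (volume : Measure (ℝ × ℝ)) t) :=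
      hc.measurable.ennreal_ofReal
    -- The normalised bump is a probability density, so Cauchy–Schwarz against it is Jensen's
    -- inequality for the square.
    have h2 := sq_lintegral_le ((volume : Measure (ℝ × ℝ)).withDensity fun t =>
      ENNReal.ofReal (ρ.normed volume t)) hm.aemeasurable
    rw [lintegral_withDensity_eq_lintegral_mul _ hw hm,
      lintegral_withDensity_eq_lintegral_mul _ hw (hm.pow_const 2), withDensity_apply _ .univ,
      setLIntegral_univ, h1, one_mul] at h2
    refine le_trans (pow_le_pow_left₀ zero_le ?_ 2) h2
    refine (enorm_integral_le_lintegral_enorm _).trans (le_of_eq (lintegral_congr fun t => ?_))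
    rw [ContinuousLinearMap.lsmul_apply, enorm_smul, Pi.mul_apply,
      Real.enorm_of_nonneg (ρ.nonneg_normed t)]
  refine (lintegral_mono hpt).trans ?_
  rw [lintegral_lintegral_swap]
  · have : ∀ t, ∫⁻ p, ENNReal.ofReal (ρ.normed (volume : Measure (ℝ × ℝ)) t) * ‖f (p - t)‖ₑ ^ 2 =
        ENNReal.ofReal (ρ.normed (volume : Measure (ℝ × ℝ)) t) * ∫⁻ p, ‖f p‖ₑ ^ 2 := fun t => by
      have hm : Measurable fun p => ‖f (p - t)‖ₑ ^ 2 :=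
        (hf.comp (measurable_id.sub measurable_const)).enorm.pow_const 2
      rw [lintegral_const_mul _ hm,
        lintegral_sub_right_eq_self (fun p => ‖f p‖ₑ ^ 2) t]
    simp_rw [this]
    rw [lintegral_mul_const _ hc.measurable.ennreal_ofReal, h1, one_mul]
  · refine Measurable.aemeasurable ?_
    exact ((hc.measurable.comp measurable_snd).ennreal_ofReal).mul
      ((hf.comp (measurable_fst.sub measurable_snd)).enorm.pow_const 2)

/-- The contraction of the plane by the factor `1 - 1 / (n + 2)` towards `c`. -/
def contraction (c : ℝ × ℝ) (n : ℕ) (p : ℝ × ℝ) : ℝ × ℝ := c + (1 - 1 / ((n : ℝ) + 2)) • (p - c)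

/-- The shift from `n` to `n + 2` keeps the factor at least `1/2` from the start, so every bound
below is uniform in `n`. -/
theorem contraction_factor_mem (n : ℕ) :
    (1 : ℝ) / 2 ≤ 1 - 1 / ((n : ℝ) + 2) ∧ 1 - 1 / ((n : ℝ) + 2) < 1 := by
  have h : (0 : ℝ) < (n : ℝ) + 2 := by positivity
  have h2 : 1 / ((n : ℝ) + 2) ≤ 1 / 2 := one_div_le_one_div_of_le (by norm_num) (by simp)
  have h3 : 0 < 1 / ((n : ℝ) + 2) := by positivity
  constructor <;> linarith

theorem tendsto_contraction_factor :
    Tendsto (fun n : ℕ => 1 - 1 / ((n : ℝ) + 2)) atTop (𝓝 1) := by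
  have h : Tendsto (fun n : ℕ => 1 / ((n : ℝ) + 2)) atTop (𝓝 0) := by
    have := (tendsto_one_div_add_atTop_nhds_zero_nat (𝕜 := ℝ)).comp (tendsto_add_atTop_nat 1)
    refine this.congr fun n => ?_
    simp only [Function.comp]
    push_cast
    ring_nf
  simpa using tendsto_const_nhds.sub h

theorem tendsto_contraction (c p : ℝ × ℝ) :
    Tendsto (fun n => contraction c n p) atTop (𝓝 p) := by
  have := (tendsto_const_nhds (x := c)).add
    (tendsto_contraction_factor.smul (tendsto_const_nhds (x := p - c)))
  simpa [contraction] using this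

theorem contDiff_contraction (c : ℝ × ℝ) (n : ℕ) : ContDiff ℝ ∞ (contraction c n) := by
  unfold contraction
  fun_prop

/-- The change of variables has Jacobian `r⁻²` in the plane, and `r ≥ 1/2` bounds it by `4`. -/
theorem lintegral_comp_contraction_le (c : ℝ × ℝ) (n : ℕ) {F : ℝ × ℝ → ℝ≥0∞} (hF : Measurable F) :
    ∫⁻ p, F (contraction c n p) ≤ 4 * ∫⁻ p, F p := by
  set r : ℝ := 1 - 1 / ((n : ℝ) + 2) with hr
  obtain ⟨h1, h2⟩ := contraction_factor_mem n
  rw [← hr] at h1 h2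
  have hr0 : r ≠ 0 := by linarith
  have e : ∀ p, F (contraction c n p) = (fun q => F (q + (c - r • c))) (r • p) := fun p => by
    simp only [contraction, ← hr]
    congr 1
    rw [smul_sub]
    abel
  simp_rw [e]
  rw [← lintegral_map (f := fun q => F (q + (c - r • c)))
    (hF.comp (measurable_id.add_const _)) (measurable_const_smul r),
    Measure.map_addHaar_smul volume hr0, lintegral_smul_measure, lintegral_add_right_eq_self F]
  refine mul_le_mul_left ?_ _
  have : Module.finrank ℝ (ℝ × ℝ) = 2 := by simp
  rw [this, abs_of_nonneg (by positivity), show (4 : ℝ≥0∞) = ENNReal.ofReal 4 by norm_num]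
  refine ENNReal.ofReal_le_ofReal ?_
  rw [inv_le_comm₀ (by positivity) (by norm_num)]
  nlinarith

/-- The mollifier used at stage `n`, with support in a ball of radius `d / (4 (n + 2))`. -/
def mollifier {d : ℝ} (hd : 0 < d) (n : ℕ) : ContDiffBump (0 : ℝ × ℝ) where
  rIn := d / (8 * ((n : ℝ) + 2))
  rOut := d / (4 * ((n : ℝ) + 2))
  rIn_pos := by positivity
  rIn_lt_rOut := by
    refine div_lt_div_of_pos_left hd (by positivity) ?_
    have : (0 : ℝ) ≤ n := Nat.cast_nonneg n
    linarith

theorem tendsto_mollifier_rOut {d : ℝ} (hd : 0 < d) :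
    Tendsto (fun n => (mollifier hd n).rOut) atTop (𝓝 0) := by
  have h := ((tendsto_const_nhds (x := (1 : ℝ))).sub tendsto_contraction_factor).const_mul (d / 4)
  rw [sub_self, mul_zero] at h
  refine h.congr fun n => ?_
  simp only [mollifier]
  have : (n : ℝ) + 2 ≠ 0 := by positivity
  field_simp
  ring

theorem mollifier_rOut_le {d : ℝ} (hd : 0 < d) (n : ℕ) : (mollifier hd n).rOut ≤ d := by
  simp only [mollifier]
  refine div_le_self hd.le ?_
  have : (0 : ℝ) ≤ n := Nat.cast_nonneg n
  linarith

/-- Mollification of `f`, composed with the contraction towards the middle of the strip. -/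
def smoothing {d : ℝ} (hd : 0 < d) (n : ℕ) (f : ℝ × ℝ → ℂ) (p : ℝ × ℝ) : ℂ :=
  ((mollifier hd n).normed volume ⋆[lsmul ℝ ℝ, volume] f) (contraction (0, d / 2) n p)

/-! ### Uniform bounds and `L²` convergence of the smoothing with cut-off -/

section Smoothing

variable {d : ℝ} (hd : 0 < d)

theorem contDiff_smoothing (n : ℕ) {f : ℝ × ℝ → ℂ}
    (hf : LocallyIntegrable f (volume : Measure (ℝ × ℝ))) : ContDiff ℝ ∞ (smoothing hd n f) :=
  ((mollifier hd n).hasCompactSupport_normed.contDiff_convolution_left (lsmul ℝ ℝ)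
    (mollifier hd n).contDiff_normed hf).comp (contDiff_contraction _ n)

theorem lintegral_smoothing_le (n : ℕ) {f : ℝ × ℝ → ℂ} (hf : Measurable f)
    (hf' : LocallyIntegrable f (volume : Measure (ℝ × ℝ))) :
    ∫⁻ p, ‖smoothing hd n f p‖ₑ ^ 2 ≤ 4 * ∫⁻ p, ‖f p‖ₑ ^ 2 := by
  have hm : Continuous ((mollifier hd n).normed volume ⋆[lsmul ℝ ℝ, volume] f) :=
    ((mollifier hd n).hasCompactSupport_normed.contDiff_convolution_left (lsmul ℝ ℝ) (n := 0)
      (mollifier hd n).contDiff_normed hf').continuous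
  refine (lintegral_comp_contraction_le _ n (hm.measurable.enorm.pow_const 2)).trans ?_
  exact mul_le_mul_right (lintegral_convolution_normed_le _ hf) _

theorem smoothing_sub (n : ℕ) {f g : ℝ × ℝ → ℂ}
    (hf : LocallyIntegrable f (volume : Measure (ℝ × ℝ)))
    (hg : LocallyIntegrable g (volume : Measure (ℝ × ℝ))) (p : ℝ × ℝ) :
    smoothing hd n (f - g) p = smoothing hd n f p - smoothing hd n g p := by
  have hc := (mollifier hd n).hasCompactSupport_normed (μ := (volume : Measure (ℝ × ℝ)))
  have h1 := hc.convolutionExists_left (lsmul ℝ ℝ) (mollifier hd n).continuous_normed hf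
  have h2 := hc.convolutionExists_left (lsmul ℝ ℝ) (mollifier hd n).continuous_normed hg
  simp only [smoothing, convolution]
  rw [← integral_sub (h1 _) (h2 _)]
  refine integral_congr_ae (Eventually.of_forall fun t => ?_)
  simp [smul_sub]

/-- A fixed cut-off function of the plane. -/
def planeBump : ContDiffBump (0 : ℝ × ℝ) := ⟨1, 2, one_pos, one_lt_two⟩

/-- The cut-off function which is one on the ball of radius `n + 1`. -/
def cutoff (n : ℕ) (p : ℝ × ℝ) : ℝ := planeBump ((1 / ((n : ℝ) + 1)) • p)

theorem contDiff_cutoff (n : ℕ) : ContDiff ℝ ∞ (cutoff n) :=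
  planeBump.contDiff.comp (contDiff_const_smul _)

theorem hasCompactSupport_cutoff (n : ℕ) : HasCompactSupport (cutoff n) :=
  planeBump.hasCompactSupport.comp_smul (by positivity)

theorem abs_cutoff_le (n : ℕ) (p : ℝ × ℝ) : ‖cutoff n p‖ ≤ 1 := by
  rw [cutoff, Real.norm_eq_abs, abs_of_nonneg planeBump.nonneg]
  exact planeBump.le_one

theorem tendsto_cutoff (p : ℝ × ℝ) : Tendsto (fun n => cutoff n p) atTop (𝓝 1) := by
  have h : Tendsto (fun n : ℕ => (1 / ((n : ℝ) + 1)) • p) atTop (𝓝 0) := by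
    simpa using (tendsto_one_div_add_atTop_nhds_zero_nat (𝕜 := ℝ)).smul
      (tendsto_const_nhds (x := p))
  have h2 := (planeBump.continuous.tendsto 0).comp h
  rwa [planeBump.one_of_mem_closedBall (by simp [planeBump])] at h2

/-- Rescaling by `1 / (n + 1)` rescales the gradient by the same factor, so the term in which the
derivative falls on the cut-off will disappear in the limit. -/
theorem exists_fderiv_cutoff_le (v : ℝ × ℝ) :
    ∃ C : ℝ, 0 ≤ C ∧ ∀ n p, ‖fderiv ℝ (cutoff n) p v‖ ≤ C * (1 / ((n : ℝ) + 1)) := by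
  have hc : Continuous fun p => fderiv ℝ planeBump p v :=
    ((planeBump.contDiff (n := 1)).continuous_fderiv (by simp)).clm_apply continuous_const
  obtain ⟨C, hC⟩ := hc.bounded_above_of_compact_support
    (planeBump.hasCompactSupport.fderiv_apply ℝ v)
  refine ⟨C, (norm_nonneg _).trans (hC 0), fun n p => ?_⟩
  have e : fderiv ℝ (cutoff n) p v =
      (1 / ((n : ℝ) + 1)) • fderiv ℝ planeBump ((1 / ((n : ℝ) + 1)) • p) v := by
    have h1 : HasFDerivAt (cutoff n) ((fderiv ℝ planeBump ((1 / ((n : ℝ) + 1)) • p)).comp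
        ((1 / ((n : ℝ) + 1)) • ContinuousLinearMap.id ℝ (ℝ × ℝ))) p :=
      (((planeBump.contDiff (n := 1)).differentiable (by simp)) _).hasFDerivAt.comp p
        ((hasFDerivAt_id (𝕜 := ℝ) p).const_smul (1 / ((n : ℝ) + 1)) :
          HasFDerivAt (fun q : ℝ × ℝ => (1 / ((n : ℝ) + 1)) • q) _ p)
    rw [h1.fderiv]
    simp
  rw [e, norm_smul, Real.norm_of_nonneg (by positivity), mul_comm]
  exact mul_le_mul_of_nonneg_right (hC _) (by positivity)

/-- Only a bound uniform in `n` is needed, for dominated convergence. The constant `3` is crude: an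
average of `g` differs by at most `2M` from a value of size at most `M`. -/
theorem norm_smoothing_le (n : ℕ) {g : ℝ × ℝ → ℂ} (hg : Continuous g) {M : ℝ}
    (hM : ∀ p, ‖g p‖ ≤ M) (p : ℝ × ℝ) : ‖smoothing hd n g p‖ ≤ 3 * M := by
  have h := (mollifier hd n).dist_normed_convolution_le (μ := volume) (g := g) (ε := 2 * M)
    (x₀ := contraction (0, d / 2) n p) hg.aestronglyMeasurable (fun x _ => by
      rw [dist_eq_norm]
      linarith [norm_sub_le (g x) (g (contraction (0, d / 2) n p)), hM x,
        hM (contraction (0, d / 2) n p)])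
  rw [dist_eq_norm] at h
  have h2 := norm_sub_norm_le (smoothing hd n g p) (g (contraction (0, d / 2) n p))
  have h3 := hM (contraction (0, d / 2) n p)
  change ‖smoothing hd n g p - _‖ ≤ _ at h
  linarith

/-- The contraction at most halves distances from the centre and the mollifier reaches at most `d`,
so the supports stay in one ball for all `n`. -/
theorem smoothing_eq_zero (n : ℕ) {g : ℝ × ℝ → ℂ} {R : ℝ}
    (hR : ∀ p, R < ‖p - (0, d / 2)‖ → g p = 0) {p : ℝ × ℝ}
    (hp : 2 * (R + d) < ‖p - (0, d / 2)‖) : smoothing hd n g p = 0 := by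
  have hA : R + d < ‖contraction (0, d / 2) n p - (0, d / 2)‖ := by
    have h1 := (contraction_factor_mem n).1
    rw [contraction, add_sub_cancel_left, norm_smul, Real.norm_of_nonneg (by linarith)]
    nlinarith [norm_nonneg (p - (0, d / 2))]
  have h0 : g (contraction (0, d / 2) n p) = 0 := hR _ (by linarith)
  have h := (mollifier hd n).normed_convolution_eq_right (μ := volume) (g := g)
    (x₀ := contraction (0, d / 2) n p) (fun x hx => by
      rw [h0]
      refine hR x ?_
      rw [Metric.mem_ball, dist_eq_norm] at hx
      have h2 := mollifier_rOut_le hd n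
      have h3 := norm_sub_norm_le (contraction (0, d / 2) n p - (0, d / 2)) (x - (0, d / 2))
      have h4 : contraction (0, d / 2) n p - (0, d / 2) - (x - (0, d / 2)) =
        -(x - contraction (0, d / 2) n p) := by abel
      rw [h4, norm_neg] at h3
      linarith)
  exact h.trans h0

theorem tendsto_smoothing_apply {g : ℝ × ℝ → ℂ} (hg : Continuous g) (p : ℝ × ℝ) :
    Tendsto (fun n => smoothing hd n g p) atTop (𝓝 (g p)) :=
  ContDiffBump.convolution_tendsto_right (g := fun _ => g) (tendsto_mollifier_rOut hd)
    (Eventually.of_forall fun _ => hg.aestronglyMeasurable)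
    ((hg.tendsto p).comp tendsto_snd) (tendsto_contraction _ p)

/-- Pointwise convergence plus domination by `(4M)²` on a fixed ball, where `4M` is the bound `3M`
for the smoothing plus `M` for `g`. -/
theorem tendsto_cutoff_smoothing_of_continuous {g : ℝ × ℝ → ℂ} (hg : Continuous g)
    (hgc : HasCompactSupport g) :
    Tendsto (fun n => eLpNorm (fun p => cutoff n p • smoothing hd n g p - g p) 2
      (volume : Measure (ℝ × ℝ))) atTop (𝓝 0) := by
  rw [tendsto_eLpNorm_two_iff]
  obtain ⟨M, hM⟩ := hg.bounded_above_of_compact_support hgc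
  have hM0 : 0 ≤ M := (norm_nonneg _).trans (hM 0)
  obtain ⟨R, hRs⟩ := hgc.isCompact.isBounded.subset_closedBall ((0 : ℝ), d / 2)
  have hR : ∀ p, R < ‖p - (0, d / 2)‖ → g p = 0 := fun p hp => by
    by_contra hne
    have := hRs (subset_tsupport g hne)
    rw [Metric.mem_closedBall, dist_eq_norm] at this
    linarith
  set B := Metric.closedBall ((0 : ℝ), d / 2) (max (2 * (R + d)) R)
  have hs : ∀ n, Measurable fun p => ‖cutoff n p • smoothing hd n g p - g p‖ₑ ^ 2 := fun n =>
    ((((contDiff_cutoff n).continuous.smul (contDiff_smoothing hd n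
      hg.locallyIntegrable).continuous).sub hg).measurable).enorm.pow_const 2
  have := tendsto_lintegral_of_dominated_convergence (μ := (volume : Measure (ℝ × ℝ)))
    (F := fun n p => ‖cutoff n p • smoothing hd n g p - g p‖ₑ ^ 2) (f := fun _ => 0)
    (B.indicator fun _ => ENNReal.ofReal (4 * M) ^ 2) hs (fun n => Eventually.of_forall fun p => by
      simp only
      by_cases hp : p ∈ B
      · rw [Set.indicator_of_mem hp]
        refine pow_le_pow_left₀ zero_le ?_ 2
        rw [← ofReal_norm]
        refine ENNReal.ofReal_le_ofReal ((norm_sub_le _ _).trans ?_)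
        rw [norm_smul]
        have h1 := abs_cutoff_le n p
        have h2 := norm_smoothing_le hd n hg hM p
        nlinarith [hM p, norm_nonneg (smoothing hd n g p), norm_nonneg (cutoff n p)]
      · rw [Set.indicator_of_notMem hp]
        rw [Metric.mem_closedBall, dist_eq_norm, not_le, max_lt_iff] at hp
        rw [smoothing_eq_zero hd n hR hp.1, hR p hp.2]
        simp)
    (by
      rw [lintegral_indicator_const Metric.isClosed_closedBall.measurableSet]
      exact ENNReal.mul_ne_top (by finiteness) (isCompact_closedBall _ _).measure_lt_top.ne)
    (Eventually.of_forall fun p => by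
      have h1 := ((tendsto_cutoff p).smul (tendsto_smoothing_apply hd hg p)).sub
        (tendsto_const_nhds (x := g p))
      rw [one_smul, sub_self] at h1
      have h2 := ((ENNReal.continuous_pow 2).tendsto _).comp h1.enorm
      simpa [Function.comp_def] using h2)
  simpa using this

/-- Smoothing followed by the cut-off has `L²` operator norm at most `2`, uniformly in `n`, so
convergence passes from continuous functions of compact support to their closure. -/
theorem tendsto_cutoff_smoothing {f : ℝ × ℝ → ℂ} (hfm : Measurable f)
    (hf : MemLp f 2 (volume : Measure (ℝ × ℝ))) :
    Tendsto (fun n => eLpNorm (fun p => cutoff n p • smoothing hd n f p - f p) 2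
      (volume : Measure (ℝ × ℝ))) atTop (𝓝 0) := by
  have hfl := hf.locallyIntegrable (by norm_num)
  rw [ENNReal.tendsto_nhds_zero]
  intro ε hε
  by_cases hεt : ε = ⊤
  · exact Eventually.of_forall fun n => hεt ▸ le_top
  obtain ⟨g, hgc, hfg, hg, hgm⟩ := hf.exists_hasCompactSupport_eLpNorm_sub_le (by norm_num)
    (ε := ε / 4) (ENNReal.div_pos hε.ne' (by norm_num)).ne'
  have hgl := hg.locallyIntegrable (μ := (volume : Measure (ℝ × ℝ)))
  have h1 := (ENNReal.tendsto_nhds_zero.1 (tendsto_cutoff_smoothing_of_continuous hd hg hgc))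
    (ε / 4) (ENNReal.div_pos hε.ne' (by norm_num))
  filter_upwards [h1] with n hn
  have hcs : ∀ {u : ℝ × ℝ → ℂ}, LocallyIntegrable u (volume : Measure (ℝ × ℝ)) →
      Continuous fun p => cutoff n p • smoothing hd n u p := fun hu =>
    (contDiff_cutoff n).continuous.smul (contDiff_smoothing hd n hu).continuous
  -- The error splits into the smoothed remainder `f - g`, costing `2 · ε/4`, the error for `g`,
  -- costing `ε/4`, and the remainder itself, costing `ε/4`.
  have e : (fun p => cutoff n p • smoothing hd n f p - f p) =
      (fun p => cutoff n p • smoothing hd n (f - g) p) +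
        ((fun p => cutoff n p • smoothing hd n g p - g p) - (f - g)) := by
    funext p
    simp only [Pi.add_apply, Pi.sub_apply, smoothing_sub hd n hfl hgl, smul_sub]
    ring
  have hb : eLpNorm (fun p => cutoff n p • smoothing hd n (f - g) p) 2
      (volume : Measure (ℝ × ℝ)) ≤ 2 * (ε / 4) := by
    refine le_trans ?_ (mul_le_mul_right hfg 2)
    rw [← ENNReal.pow_le_pow_left_iff (n := 2) (by norm_num), mul_pow, eLpNorm_two_sq,
      eLpNorm_two_sq]
    refine le_trans (lintegral_mono fun p => ?_) ((lintegral_smoothing_le hd n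
      (hfm.sub hg.measurable) (hfl.sub hgl)).trans (le_of_eq (by norm_num)))
    refine pow_le_pow_left₀ zero_le ?_ 2
    rw [enorm_smul]
    refine mul_le_of_le_one_left zero_le ?_
    rw [← ofReal_norm]
    exact ENNReal.ofReal_le_one.2 (abs_cutoff_le n p)
  rw [e]
  refine (eLpNorm_add_le (hcs (hfl.sub hgl)).aestronglyMeasurable
    (((hcs hgl).aestronglyMeasurable.sub hgm.1).sub (hfm.aestronglyMeasurable.sub hgm.1))
    (by norm_num)).trans ?_
  refine (add_le_add hb ((eLpNorm_sub_le ((hcs hgl).aestronglyMeasurable.sub hgm.1)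
    (hfm.aestronglyMeasurable.sub hgm.1) (by norm_num)).trans (add_le_add hn hfg))).trans
    (le_of_eq ?_)
  have h4 : ε = 4 * (ε / 4) := (ENNReal.mul_div_cancel (by norm_num) (by norm_num)).symm
  nth_rewrite 4 [h4]
  ring

end Smoothing

/-! ### Smooth functions of compact support as elements of the Sobolev space -/

/-- Smooth functions with compact support in the plane; they need not vanish on the boundary of the
strip. -/
def IsCc (Φ : ℝ × ℝ → ℂ) : Prop := ContDiff ℝ ∞ Φ ∧ HasCompactSupport Φ

theorem IsTest.isCc {d : ℝ} {φ : ℝ × ℝ → ℂ} (h : IsTest d φ) : IsCc φ := ⟨h.1, h.2.1⟩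

namespace IsCc

variable {Φ Ψ : ℝ × ℝ → ℂ}

theorem memLp (h : IsCc Φ) (d : ℝ) :
    MemLp Φ 2 ((volume : Measure (ℝ × ℝ)).restrict (strip d)) :=
  h.1.continuous.memLp_of_hasCompactSupport h.2

theorem fderiv_apply (h : IsCc Φ) (v : ℝ × ℝ) : IsCc fun p => fderiv ℝ Φ p v :=
  ⟨(h.1.fderiv_right (m := ∞) (by simp)).clm_apply contDiff_const, h.2.fderiv_apply ℝ v⟩

theorem star (h : IsCc Φ) : IsCc fun p => conj (Φ p) :=
  ⟨Complex.conjCLE.contDiff.comp h.1, h.2.comp_left (map_zero _)⟩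

theorem fderiv_star (h : IsCc Φ) (p v : ℝ × ℝ) :
    fderiv ℝ (fun p => conj (Φ p)) p v = conj (fderiv ℝ Φ p v) := by
  have h1 := (Complex.conjCLE.toContinuousLinearMap.hasFDerivAt (x := Φ p)).comp p
    (h.1.differentiable (by simp) p).hasFDerivAt
  have h2 : HasFDerivAt (fun p => conj (Φ p)) _ p := h1
  rw [h2.fderiv]
  rfl

theorem mul (h : IsCc Φ) (h' : IsCc Ψ) : IsCc fun p => Φ p * Ψ p :=
  ⟨h.1.mul h'.1, h.2.mul_right⟩

theorem integrable (h : IsCc Φ) : Integrable Φ (volume : Measure (ℝ × ℝ)) :=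
  h.1.continuous.integrable_of_hasCompactSupport h.2

/-- The restriction to the strip as an element of `L²(Ω)`. -/
def toL2 (h : IsCc Φ) (d : ℝ) : L2Strip d := (h.memLp d).toLp Φ

theorem coeFn_toL2 (h : IsCc Φ) (d : ℝ) :
    h.toL2 d =ᵐ[(volume : Measure (ℝ × ℝ)).restrict (strip d)] Φ := MemLp.coeFn_toLp _

theorem integral_fderiv_mul (h : IsCc Φ) (h' : IsCc Ψ) (v : ℝ × ℝ) :
    ∫ p, Φ p * fderiv ℝ Ψ p v = -∫ p, fderiv ℝ Φ p v * Ψ p :=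
  integral_mul_fderiv_eq_neg_fderiv_mul_of_integrable ((h.fderiv_apply v).mul h').integrable
    (h.mul (h'.fderiv_apply v)).integrable (h.mul h').integrable
    (fun p _ => h.1.differentiable (by simp) p) (fun p _ => h'.1.differentiable (by simp) p)

end IsCc

theorem IsTest.eq_zero {d : ℝ} {φ : ℝ × ℝ → ℂ} (h : IsTest d φ) {p : ℝ × ℝ} (hp : p ∉ strip d) :
    φ p = 0 := by
  by_contra hne
  exact hp (h.2.2 (subset_tsupport φ hne))

theorem IsTest.fderiv_apply {d : ℝ} {φ : ℝ × ℝ → ℂ} (h : IsTest d φ) (v : ℝ × ℝ) :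
    IsTest d fun p => fderiv ℝ φ p v :=
  ⟨(h.isCc.fderiv_apply v).1, (h.isCc.fderiv_apply v).2,
    (tsupport_fderiv_apply_subset ℝ v).trans h.2.2⟩

theorem IsTest.star {d : ℝ} {φ : ℝ × ℝ → ℂ} (h : IsTest d φ) : IsTest d fun p => conj (φ p) :=
  ⟨h.isCc.star.1, h.isCc.star.2,
    (closure_mono (Function.support_comp_subset (map_zero conj) φ)).trans h.2.2⟩

theorem setIntegral_mul_eq {d : ℝ} {u : L2Strip d} {f φ : ℝ × ℝ → ℂ}
    (hu : u =ᵐ[(volume : Measure (ℝ × ℝ)).restrict (strip d)] f)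
    (hφ : ∀ p, p ∉ strip d → φ p = 0) :
    ∫ p in strip d, u p * φ p = ∫ p, f p * φ p := by
  rw [← setIntegral_eq_integral_of_forall_compl_eq_zero (s := strip d) (f := fun p => f p * φ p)
    fun p hp => by rw [hφ p hp, mul_zero]]
  refine integral_congr_ae ?_
  filter_upwards [hu] with p hp
  rw [hp]

/-- `Φ` may be nonzero on the boundary, but the test function vanishes off the strip, so the
integrals extend to the plane and no boundary term arises. -/
theorem IsCc.hasWeakDeriv {Φ : ℝ × ℝ → ℂ} (h : IsCc Φ) (d : ℝ) (v : ℝ × ℝ) :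
    HasWeakDeriv d v (h.toL2 d) ((h.fderiv_apply v).toL2 d) := by
  intro φ hφ
  rw [setIntegral_mul_eq (h.coeFn_toL2 d) fun p hp => (hφ.fderiv_apply v).eq_zero hp,
    setIntegral_mul_eq ((h.fderiv_apply v).coeFn_toL2 d) fun p hp => hφ.eq_zero hp]
  exact h.integral_fderiv_mul hφ.isCc v

theorem IsCc.weakDeriv_toL2 {Φ : ℝ × ℝ → ℂ} (h : IsCc Φ) (d : ℝ) (v : ℝ × ℝ) :
    weakDeriv d v (h.toL2 d) = (h.fderiv_apply v).toL2 d := (h.hasWeakDeriv d v).weakDeriv_eq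

theorem IsCc.mem_W12 {Φ : ℝ × ℝ → ℂ} (h : IsCc Φ) (d : ℝ) : h.toL2 d ∈ W12 d :=
  ⟨⟨_, h.hasWeakDeriv d ex⟩, ⟨_, h.hasWeakDeriv d ey⟩⟩

theorem tendsto_toLp_iff {X : Type*} [MeasurableSpace X] {μ : Measure X} {f : ℕ → X → ℂ}
    (hf : ∀ n, MemLp (f n) 2 μ) (u : Lp ℂ 2 μ) :
    Tendsto (fun n => eLpNorm (fun p => f n p - u p) 2 μ) atTop (𝓝 0) ↔
      Tendsto (fun n => (hf n).toLp (f n)) atTop (𝓝 u) := by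
  rw [Lp.tendsto_Lp_iff_tendsto_eLpNorm']
  refine tendsto_congr fun n => eLpNorm_congr_ae ?_
  filter_upwards [(hf n).coeFn_toLp] with p hp
  rw [Pi.sub_apply, hp]

theorem tendstoW12_iff {d : ℝ} {Φ : ℕ → ℝ × ℝ → ℂ} (hΦ : ∀ n, IsCc (Φ n)) (u : L2Strip d) :
    TendstoW12 d Φ u ↔ Tendsto (fun n => (hΦ n).toL2 d) atTop (𝓝 u) ∧
      Tendsto (fun n => weakDeriv d ex ((hΦ n).toL2 d)) atTop (𝓝 (weakDeriv d ex u)) ∧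
      Tendsto (fun n => weakDeriv d ey ((hΦ n).toL2 d)) atTop (𝓝 (weakDeriv d ey u)) := by
  simp_rw [IsCc.weakDeriv_toL2]
  exact and_congr (tendsto_toLp_iff (fun n => (hΦ n).memLp d) u)
    (and_congr (tendsto_toLp_iff (fun n => ((hΦ n).fderiv_apply ex).memLp d) _)
      (tendsto_toLp_iff (fun n => ((hΦ n).fderiv_apply ey).memLp d) _))

/-! ### Density of smooth functions in `W^{1,2}(Ω)` -/

/-- Extension by zero. -/
def extendZero {d : ℝ} (u : L2Strip d) : ℝ × ℝ → ℂ := (strip d).indicator u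

theorem measurable_extendZero {d : ℝ} (u : L2Strip d) : Measurable (extendZero u) :=
  (Lp.stronglyMeasurable u).measurable.indicator (isOpen_strip d).measurableSet

theorem memLp_extendZero {d : ℝ} (u : L2Strip d) :
    MemLp (extendZero u) 2 (volume : Measure (ℝ × ℝ)) :=
  (memLp_indicator_iff_restrict (isOpen_strip d).measurableSet).2 (Lp.memLp u)

theorem locallyIntegrable_extendZero {d : ℝ} (u : L2Strip d) :
    LocallyIntegrable (extendZero u) (volume : Measure (ℝ × ℝ)) :=
  (memLp_extendZero u).locallyIntegrable (by norm_num)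

theorem integral_smul_extendZero {d : ℝ} (u : L2Strip d) (f : ℝ × ℝ → ℝ) :
    ∫ p, f p • extendZero u p = ∫ p in strip d, u p * (f p : ℂ) := by
  rw [← integral_indicator (isOpen_strip d).measurableSet]
  refine integral_congr_ae (Eventually.of_forall fun p => ?_)
  by_cases hp : p ∈ strip d
  · simp [extendZero, hp, mul_comm]
  · simp [extendZero, hp]

section Density

variable {d : ℝ} (hd : 0 < d)

/-- The translated mollifiers are test functions. -/
theorem isTest_mollifier (n : ℕ) {p : ℝ × ℝ} (hp : p ∈ strip d) :
    IsTest d fun q => ((mollifier hd n).normed volume (contraction (0, d / 2) n p - q) : ℂ) := by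
  set ρ := mollifier hd n
  have hs : tsupport (fun q => (ρ.normed volume (contraction (0, d / 2) n p - q) : ℂ)) ⊆
      Metric.closedBall (contraction (0, d / 2) n p) ρ.rOut := by
    refine closure_minimal (fun q hq => ?_) Metric.isClosed_closedBall
    by_contra hne
    refine hq ?_
    rw [Metric.mem_closedBall, dist_comm, dist_eq_norm, not_le] at hne
    have : ρ.normed volume (contraction (0, d / 2) n p - q) = 0 := by
      rw [← Function.notMem_support, ρ.support_normed_eq, mem_ball_zero_iff, not_lt]
      exact hne.le
    simp [this]
  refine ⟨?_, ?_, hs.trans fun q hq => ?_⟩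
  · exact Complex.ofRealCLM.contDiff.comp (ρ.contDiff_normed.comp (contDiff_const.sub contDiff_id))
  · exact HasCompactSupport.of_support_subset_isCompact (isCompact_closedBall _ _)
      ((subset_tsupport _).trans hs)
  · refine ⟨trivial, ?_⟩
    rw [Metric.mem_closedBall, dist_eq_norm] at hq
    have h1 := (norm_snd_le _).trans hq
    rw [Prod.snd_sub, Real.norm_eq_abs, abs_le] at h1
    have h2 : (contraction (0, d / 2) n p).2 =
        d / 2 + (1 - 1 / ((n : ℝ) + 2)) * (p.2 - d / 2) := by simp [contraction]
    -- With `l = 1 / (n + 2)`, the contracted point is at distance more than `l d / 2` from both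
    -- boundary lines, twice the radius `l d / 4` of the mollifier.
    have h3 : ρ.rOut = (1 / ((n : ℝ) + 2)) * (d / 4) := by
      simp only [ρ, mollifier]
      field_simp
    rw [h2, h3] at h1
    have h4 := (contraction_factor_mem n).2
    have h5 := (contraction_factor_mem n).1
    obtain ⟨h6, h7⟩ := hp.2
    set l : ℝ := 1 / ((n : ℝ) + 2)
    have h8 : 0 < l * d := by nlinarith
    constructor <;> nlinarith

/-- The extension by zero may jump at the boundary, but at points of the strip the contracted
mollifier is a test function and never sees the jump; the weak derivative can therefore be tested
against it. The scalar factor is the derivative of the contraction. -/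
theorem fderiv_smoothing (n : ℕ) {v : ℝ × ℝ} {u g : L2Strip d} (h : HasWeakDeriv d v u g)
    {p : ℝ × ℝ} (hp : p ∈ strip d) :
    fderiv ℝ (smoothing hd n (extendZero u)) p v =
      (1 - 1 / ((n : ℝ) + 2)) • smoothing hd n (extendZero g) p := by
  set ρ := (mollifier hd n).normed (volume : Measure (ℝ × ℝ)) with hρ
  have hρc : HasCompactSupport ρ := (mollifier hd n).hasCompactSupport_normed
  have hρd : ContDiff ℝ 1 ρ := (mollifier hd n).contDiff_normed (n := 1)
  set A := contraction (0, d / 2) n with hA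
  have hAd : HasFDerivAt A ((1 - 1 / ((n : ℝ) + 2)) • ContinuousLinearMap.id ℝ (ℝ × ℝ)) p :=
    (HasFDerivAt.const_smul (f := fun q : ℝ × ℝ => q - (0, d / 2))
      ((hasFDerivAt_id (𝕜 := ℝ) p).sub_const _) (1 - 1 / ((n : ℝ) + 2))).const_add _
  have h1 := hρc.hasFDerivAt_convolution_left (lsmul ℝ ℝ) hρd (locallyIntegrable_extendZero u)
    (A p)
  have h2 : HasFDerivAt (smoothing hd n (extendZero u)) _ p := h1.comp p hAd
  have h3 : (fderiv ℝ ρ ⋆[(lsmul ℝ ℝ).precompL (ℝ × ℝ), volume] (extendZero u)) (A p) v =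
      ∫ q, (fderiv ℝ ρ (A p - q) v) • extendZero u q := by
    have hex := (hρc.fderiv ℝ).convolutionExists_left ((lsmul ℝ ℝ : ℝ →L[ℝ] ℂ →L[ℝ] ℂ).precompL
      (ℝ × ℝ)) (hρd.continuous_fderiv (by simp)) (locallyIntegrable_extendZero u) (A p)
    rw [convolution_eq_swap, ContinuousLinearMap.integral_apply]
    · rfl
    · exact hex.integrable_swap
  -- The sign from differentiating in `q` cancels the one in the definition of the weak derivative.
  have h4 : ∀ q, fderiv ℝ (fun q => (ρ (A p - q) : ℂ)) q v = -((fderiv ℝ ρ (A p - q) v : ℝ) : ℂ) := by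
    intro q
    have e1 : HasFDerivAt (fun q => ρ (A p - q)) _ q :=
      ((hρd.differentiable (by simp)) (A p - q)).hasFDerivAt.comp q
        ((hasFDerivAt_id (𝕜 := ℝ) q).const_sub (A p))
    have e2 : HasFDerivAt (fun q => (ρ (A p - q) : ℂ)) _ q :=
      Complex.ofRealCLM.hasFDerivAt.comp q e1
    rw [e2.fderiv]
    simp
  have h5 := h _ (isTest_mollifier hd n hp)
  simp_rw [← hρ, ← hA, h4, mul_neg] at h5
  rw [integral_neg, neg_inj] at h5
  have h6 : smoothing hd n (extendZero g) p = ∫ q, ρ (A p - q) • extendZero g q :=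
    convolution_eq_swap _
  rw [h2.fderiv, h6, integral_smul_extendZero, ← h5, ← integral_smul_extendZero u
    fun q => fderiv ℝ ρ (A p - q) v, ← h3]
  simp

theorem eLpNorm_smoothing_le (n : ℕ) (u : L2Strip d) :
    eLpNorm (smoothing hd n (extendZero u)) 2 (volume : Measure (ℝ × ℝ)) ≤
      2 * eLpNorm (extendZero u) 2 (volume : Measure (ℝ × ℝ)) := by
  rw [← ENNReal.pow_le_pow_left_iff (n := 2) (by norm_num), mul_pow, eLpNorm_two_sq, eLpNorm_two_sq]
  exact (lintegral_smoothing_le hd n (measurable_extendZero u)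
    (locallyIntegrable_extendZero u)).trans (le_of_eq (by norm_num))

/-- The approximating sequence of an element of the Sobolev space. -/
def approx (u : L2Strip d) (n : ℕ) (p : ℝ × ℝ) : ℂ :=
  cutoff n p • smoothing hd n (extendZero u) p

theorem isCc_approx (u : L2Strip d) (n : ℕ) : IsCc (approx hd u n) :=
  ⟨(contDiff_cutoff n).smul (contDiff_smoothing hd n (locallyIntegrable_extendZero u)),
    (hasCompactSupport_cutoff n).smul_right⟩

theorem tendsto_approx (u : L2Strip d) :
    Tendsto (fun n => eLpNorm (fun p => approx hd u n p - u p) 2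
      ((volume : Measure (ℝ × ℝ)).restrict (strip d))) atTop (𝓝 0) := by
  refine tendsto_of_tendsto_of_tendsto_of_le_of_le tendsto_const_nhds
    (tendsto_cutoff_smoothing hd (measurable_extendZero u) (memLp_extendZero u))
    (fun _ => zero_le) fun n => ?_
  refine le_trans (le_of_eq (eLpNorm_congr_ae ?_)) (eLpNorm_restrict_le _ 2 volume (strip d))
  filter_upwards [ae_restrict_mem (isOpen_strip d).measurableSet] with p hp
  simp [extendZero, hp, approx]

/-- By the product rule the error has three parts: the `L²` error for `g`, the defect `1 / (n + 2)`
of the contraction factor, and the derivative of the cut-off. The last two are `O(1/n)` since the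
smoothings are bounded in `L²`. -/
theorem tendsto_fderiv_approx {v : ℝ × ℝ} {u g : L2Strip d} (h : HasWeakDeriv d v u g) :
    Tendsto (fun n => eLpNorm (fun p => fderiv ℝ (approx hd u n) p v - g p) 2
      ((volume : Measure (ℝ × ℝ)).restrict (strip d))) atTop (𝓝 0) := by
  set μ := (volume : Measure (ℝ × ℝ)).restrict (strip d)
  obtain ⟨C, hC0, hC⟩ := exists_fderiv_cutoff_le v
  set Nu := 2 * eLpNorm (extendZero u) 2 (volume : Measure (ℝ × ℝ))
  set Ng := 2 * eLpNorm (extendZero g) 2 (volume : Measure (ℝ × ℝ))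
  have hNu : Nu ≠ ⊤ := ENNReal.mul_ne_top (by norm_num) (memLp_extendZero u).2.ne
  have hNg : Ng ≠ ⊤ := ENNReal.mul_ne_top (by norm_num) (memLp_extendZero g).2.ne
  have hsm := fun (n : ℕ) (w : L2Strip d) =>
    (contDiff_smoothing hd n (locallyIntegrable_extendZero w))
  have hle : ∀ n (w : L2Strip d), eLpNorm (smoothing hd n (extendZero w)) 2 μ ≤
      2 * eLpNorm (extendZero w) 2 (volume : Measure (ℝ × ℝ)) := fun n w =>
    (eLpNorm_restrict_le _ 2 volume (strip d)).trans (eLpNorm_smoothing_le hd n w)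
  have ha : ∀ n (w : L2Strip d), AEStronglyMeasurable (approx hd w n) μ := fun n w =>
    (isCc_approx hd w n).1.continuous.aestronglyMeasurable
  have hdc : ∀ n, Continuous fun p => fderiv ℝ (cutoff n) p v := fun n =>
    ((contDiff_cutoff n).continuous_fderiv (by simp)).clm_apply continuous_const
  have e : ∀ n, (fun p => fderiv ℝ (approx hd u n) p v - g p) =ᵐ[μ]
      ((fun p => approx hd g n p - g p) +
        (fun p => (-(1 / ((n : ℝ) + 2))) • approx hd g n p)) +
        fun p => fderiv ℝ (cutoff n) p v • smoothing hd n (extendZero u) p := by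
    intro n
    filter_upwards [ae_restrict_mem (isOpen_strip d).measurableSet] with p hp
    have e1 : HasFDerivAt (approx hd u n) _ p :=
      (((contDiff_cutoff n).differentiable (by simp)) p).hasFDerivAt.smul
        (((hsm n u).differentiable (by simp)) p).hasFDerivAt
    rw [e1.fderiv]
    simp only [_root_.add_apply, _root_.smul_apply, fderiv_smoothing hd n h hp,
      ContinuousLinearMap.smulRight_apply, Pi.add_apply, approx, Complex.real_smul]
    push_cast
    ring
  have hbd : ∀ n, eLpNorm (fun p => fderiv ℝ (approx hd u n) p v - g p) 2 μ ≤
      (eLpNorm (fun p => approx hd g n p - g p) 2 μ + ENNReal.ofReal (1 / ((n : ℝ) + 2)) * Ng) +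
        ENNReal.ofReal (C * (1 / ((n : ℝ) + 1))) * Nu := by
    intro n
    rw [eLpNorm_congr_ae (e n)]
    have m1 : AEStronglyMeasurable (fun p => approx hd g n p - g p) μ :=
      (ha n g).sub (Lp.aestronglyMeasurable g)
    have m2 : AEStronglyMeasurable (fun p => (-(1 / ((n : ℝ) + 2))) • approx hd g n p) μ :=
      (ha n g).const_smul (-(1 / ((n : ℝ) + 2)))
    have m3 : AEStronglyMeasurable
        (fun p => fderiv ℝ (cutoff n) p v • smoothing hd n (extendZero u) p) μ :=
      ((hdc n).smul (hsm n u).continuous).aestronglyMeasurable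
    have h12 := eLpNorm_add_le m1 m2 (p := 2) (by norm_num)
    have h123 := eLpNorm_add_le (m1.add m2) m3 (p := 2) (by norm_num)
    refine h123.trans (add_le_add (h12.trans (add_le_add le_rfl ?_)) ?_)
    · refine (eLpNorm_le_mul_eLpNorm_of_ae_le_mul (c := 1 / ((n : ℝ) + 2))
        (g := smoothing hd n (extendZero g)) (Eventually.of_forall fun p => ?_) 2).trans
        (mul_le_mul_right (hle n g) _)
      rw [norm_smul, norm_neg, Real.norm_of_nonneg (by positivity), approx, norm_smul]
      refine mul_le_mul_of_nonneg_left ?_ (by positivity)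
      exact mul_le_of_le_one_left (norm_nonneg _) (abs_cutoff_le n p)
    · refine (eLpNorm_le_mul_eLpNorm_of_ae_le_mul (c := C * (1 / ((n : ℝ) + 1)))
        (g := smoothing hd n (extendZero u)) (Eventually.of_forall fun p => ?_) 2).trans
        (mul_le_mul_right (hle n u) _)
      rw [norm_smul]
      exact mul_le_mul_of_nonneg_right (hC n p) (norm_nonneg _)
  have t1 : Tendsto (fun n : ℕ => ENNReal.ofReal (1 / ((n : ℝ) + 2)) * Ng) atTop (𝓝 0) := by
    have h1 : Tendsto (fun n : ℕ => 1 / ((n : ℝ) + 2)) atTop (𝓝 0) := by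
      have := (tendsto_const_nhds (x := (1 : ℝ))).sub tendsto_contraction_factor
      simpa using this
    have h2 := ENNReal.Tendsto.mul_const (ENNReal.tendsto_ofReal h1) (Or.inr hNg)
    simpa using h2
  have t2 : Tendsto (fun n : ℕ => ENNReal.ofReal (C * (1 / ((n : ℝ) + 1))) * Nu) atTop (𝓝 0) := by
    have h1 := (tendsto_one_div_add_atTop_nhds_zero_nat (𝕜 := ℝ)).const_mul C
    have h2 := ENNReal.Tendsto.mul_const (ENNReal.tendsto_ofReal h1) (Or.inr hNu)
    simpa using h2
  refine tendsto_of_tendsto_of_tendsto_of_le_of_le tendsto_const_nhds ?_ (fun _ => zero_le) hbd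
  simpa using ((tendsto_approx hd g).add t1).add t2

/-- Restrictions of smooth functions of compact support are dense in `W^{1,2}(Ω)`. -/
theorem exists_tendstoW12 (hd : 0 < d) {u : L2Strip d} (hu : u ∈ W12 d) :
    ∃ Φ : ℕ → ℝ × ℝ → ℂ, (∀ n, IsCc (Φ n)) ∧ TendstoW12 d Φ u :=
  ⟨approx hd u, isCc_approx hd u, tendsto_approx hd u,
    tendsto_fderiv_approx hd (W12.hasWeakDeriv_ex hu),
    tendsto_fderiv_approx hd (W12.hasWeakDeriv_ey hu)⟩

end Density

/-! ### The trace inequality for smooth functions -/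

theorem ENNReal_add_sq_le (a b : ℝ≥0∞) : (a + b) ^ 2 ≤ 4 * a ^ 2 + 4 * b ^ 2 := by
  rcases le_total a b with h | h
  · refine (pow_le_pow_left₀ zero_le (add_le_add h le_rfl) 2).trans ?_
    rw [← two_mul, mul_pow]
    norm_num
  · refine (pow_le_pow_left₀ zero_le (add_le_add le_rfl h) 2).trans ?_
    rw [← two_mul, mul_pow]
    norm_num

/-- The fundamental theorem of calculus followed by Cauchy–Schwarz on the interval. -/
theorem enorm_sub_sq_le_of_hasDerivAt {f f' : ℝ → ℂ} (hf : ∀ y, HasDerivAt f (f' y) y)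
    (hf' : Continuous f') {a b s t : ℝ} (hs : s ∈ Set.Icc a b)
    (ht : t ∈ Set.Icc a b) :
    ‖f t - f s‖ₑ ^ 2 ≤ ENNReal.ofReal (b - a) * ∫⁻ y in Set.Ioo a b, ‖f' y‖ₑ ^ 2 := by
  rw [← intervalIntegral.integral_eq_sub_of_hasDerivAt (fun y _ => hf y)
    (hf'.intervalIntegrable s t)]
  have h1 : ‖∫ y in s..t, f' y‖ₑ ≤ ∫⁻ y in Set.Ioo a b, ‖f' y‖ₑ := by
    have e : ‖∫ y in s..t, f' y‖ₑ = ‖∫ y in Set.uIoc s t, f' y‖ₑ := by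
      rw [← ofReal_norm, ← ofReal_norm, intervalIntegral.norm_intervalIntegral_eq]
    rw [e]
    refine (enorm_integral_le_lintegral_enorm _).trans ?_
    rw [restrict_Ioo_eq_restrict_Icc]
    refine lintegral_mono_set fun y hy => ?_
    have := Set.uIoc_subset_uIcc hy
    exact Set.uIcc_subset_Icc hs ht this
  refine (pow_le_pow_left₀ zero_le h1 2).trans ?_
  refine (sq_lintegral_le _ hf'.measurable.enorm.aemeasurable).trans (le_of_eq ?_)
  rw [Measure.restrict_apply_univ, Real.volume_Ioo]

theorem restrict_strip_eq (d : ℝ) : (volume : Measure (ℝ × ℝ)).restrict (strip d) =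
    (volume : Measure ℝ).prod ((volume : Measure ℝ).restrict (Set.Ioo 0 d)) := by
  rw [strip, Measure.volume_eq_prod, ← Measure.prod_restrict, Measure.restrict_univ]

theorem hasDerivAt_comp_ey {Φ : ℝ × ℝ → ℂ} (h : IsCc Φ) (x y : ℝ) :
    HasDerivAt (fun y => Φ (x, y)) (fderiv ℝ Φ (x, y) ey) y :=
  (h.1.differentiable (by simp) (x, y)).hasFDerivAt.comp_hasDerivAt y
    ((hasDerivAt_const y x).prodMk (hasDerivAt_id y))

theorem hasDerivAt_comp_ex {Φ : ℝ × ℝ → ℂ} (h : IsCc Φ) (x y : ℝ) :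
    HasDerivAt (fun x => Φ (x, y)) (fderiv ℝ Φ (x, y) ex) x :=
  (h.1.differentiable (by simp) (x, y)).hasFDerivAt.comp_hasDerivAt x
    ((hasDerivAt_id x).prodMk (hasDerivAt_const x y))

/-- On each vertical segment `Φ(x, b)` is compared with `Φ(x, y)` through the `y`-derivative.
Integrating over `y` in `(0, d)` produces the factor `d` on the left and a second factor `d` on the
derivative term; then integrate in `x`. -/
theorem IsCc.lintegral_line_le {Φ : ℝ × ℝ → ℂ} (h : IsCc Φ) {d b : ℝ} (hd : 0 < d)
    (hb : b ∈ Set.Icc 0 d) :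
    ENNReal.ofReal d * ∫⁻ x, ‖Φ (x, b)‖ₑ ^ 2 ≤ 4 * (∫⁻ p in strip d, ‖Φ p‖ₑ ^ 2) +
      ENNReal.ofReal (4 * d ^ 2) * ∫⁻ p in strip d, ‖fderiv ℝ Φ p ey‖ₑ ^ 2 := by
  have hc := h.1.continuous
  have hc' := (h.fderiv_apply ey).1.continuous
  have hm : Measurable fun p : ℝ × ℝ => ‖Φ p‖ₑ ^ 2 := hc.measurable.enorm.pow_const 2
  have hm' : Measurable fun p : ℝ × ℝ => ‖fderiv ℝ Φ p ey‖ₑ ^ 2 :=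
    hc'.measurable.enorm.pow_const 2
  have hpt : ∀ x, ∀ y ∈ Set.Ioo 0 d, ‖Φ (x, b)‖ₑ ^ 2 ≤ 4 * ‖Φ (x, y)‖ₑ ^ 2 +
      4 * (ENNReal.ofReal d * ∫⁻ y in Set.Ioo 0 d, ‖fderiv ℝ Φ (x, y) ey‖ₑ ^ 2) := by
    intro x y hy
    have h1 := enorm_sub_sq_le_of_hasDerivAt (fun y => hasDerivAt_comp_ey h x y)
      (hc'.comp (by fun_prop : Continuous fun y : ℝ => (x, y)))
      (Set.Ioo_subset_Icc_self hy) hb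
    rw [sub_zero] at h1
    have h2 : ‖Φ (x, b)‖ₑ ≤ ‖Φ (x, y)‖ₑ + ‖Φ (x, b) - Φ (x, y)‖ₑ := by
      have := enorm_add_le (Φ (x, y)) (Φ (x, b) - Φ (x, y))
      rwa [add_sub_cancel] at this
    refine (pow_le_pow_left₀ zero_le h2 2).trans ((ENNReal_add_sq_le _ _).trans ?_)
    exact add_le_add le_rfl (mul_le_mul_right h1 _)
  have hint : ∀ x, ENNReal.ofReal d * ‖Φ (x, b)‖ₑ ^ 2 ≤
      4 * (∫⁻ y in Set.Ioo 0 d, ‖Φ (x, y)‖ₑ ^ 2) +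
      ENNReal.ofReal (4 * d ^ 2) * ∫⁻ y in Set.Ioo 0 d, ‖fderiv ℝ Φ (x, y) ey‖ₑ ^ 2 := by
    intro x
    have hmx : Measurable fun y : ℝ => ‖Φ (x, y)‖ₑ ^ 2 := hm.comp measurable_prodMk_left
    have h1 := setLIntegral_mono' (μ := (volume : Measure ℝ)) measurableSet_Ioo (hpt x)
    rw [setLIntegral_const, Real.volume_Ioo, sub_zero, lintegral_add_right _ measurable_const,
      setLIntegral_const, Real.volume_Ioo, sub_zero, lintegral_const_mul _ hmx,
      mul_comm] at h1
    refine h1.trans (le_of_eq ?_)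
    have : ENNReal.ofReal (4 * d ^ 2) = 4 * ENNReal.ofReal d * ENNReal.ofReal d := by
      rw [show (4 : ℝ≥0∞) = ENNReal.ofReal 4 by norm_num, ← ENNReal.ofReal_mul (by norm_num),
        ← ENNReal.ofReal_mul (by positivity)]
      ring_nf
    rw [this]
    ring
  have h1 := lintegral_mono (μ := (volume : Measure ℝ)) hint
  have hmb : Measurable fun x : ℝ => ‖Φ (x, b)‖ₑ ^ 2 := hm.comp measurable_prodMk_right
  have hi : Measurable fun x : ℝ => ∫⁻ y in Set.Ioo 0 d, ‖Φ (x, y)‖ₑ ^ 2 :=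
    hm.lintegral_prod_right'
  have hi' : Measurable fun x : ℝ => ∫⁻ y in Set.Ioo 0 d, ‖fderiv ℝ Φ (x, y) ey‖ₑ ^ 2 :=
    hm'.lintegral_prod_right'
  rw [lintegral_const_mul _ hmb, lintegral_add_left (hi.const_mul _), lintegral_const_mul _ hi,
    lintegral_const_mul _ hi'] at h1
  rw [restrict_strip_eq, lintegral_prod _ hm.aemeasurable, lintegral_prod _ hm'.aemeasurable]
  exact h1

theorem IsCc.memLp_line {Φ : ℝ × ℝ → ℂ} (h : IsCc Φ) (b : ℝ) :
    MemLp (fun x => Φ (x, b)) 2 (volume : Measure ℝ) := by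
  have hc : Continuous fun x => Φ (x, b) := h.1.continuous.comp (by fun_prop)
  refine hc.memLp_of_hasCompactSupport ?_
  have he : IsClosedEmbedding fun x : ℝ => (x, b) :=
    (Isometry.of_dist_eq fun x y => by simp [Prod.dist_eq]).isClosedEmbedding
  exact h.2.comp_isClosedEmbedding he

/-- The restriction to the line `y = b` as an element of `L²(ℝ)`. -/
def IsCc.lineL2 {Φ : ℝ × ℝ → ℂ} (h : IsCc Φ) (b : ℝ) : L2Line := (h.memLp_line b).toLp _

theorem IsCc.coeFn_lineL2 {Φ : ℝ × ℝ → ℂ} (h : IsCc Φ) (b : ℝ) :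
    h.lineL2 b =ᵐ[volume] fun x => Φ (x, b) := MemLp.coeFn_toLp _

theorem enorm_toLp_sq {X : Type*} [MeasurableSpace X] {μ : Measure X} {f : X → ℂ}
    (hf : MemLp f 2 μ) : ENNReal.ofReal (‖hf.toLp f‖ ^ 2) = ∫⁻ x, ‖f x‖ₑ ^ 2 ∂μ := by
  rw [ENNReal.ofReal_pow (norm_nonneg _), ofReal_norm, Lp.enorm_toLp, eLpNorm_two_sq]

theorem IsCc.norm_lineL2_le {Φ : ℝ × ℝ → ℂ} (h : IsCc Φ) {d b : ℝ} (hd : 0 < d)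
    (hb : b ∈ Set.Icc 0 d) :
    d * ‖h.lineL2 b‖ ^ 2 ≤ 4 * ‖h.toL2 d‖ ^ 2 + 4 * d ^ 2 * ‖weakDeriv d ey (h.toL2 d)‖ ^ 2 := by
  have h1 := h.lintegral_line_le hd hb
  rw [← enorm_toLp_sq (h.memLp_line b), ← enorm_toLp_sq (h.memLp d),
    ← enorm_toLp_sq ((h.fderiv_apply ey).memLp d), show (4 : ℝ≥0∞) = ENNReal.ofReal 4 by norm_num,
    ← ENNReal.ofReal_mul hd.le, ← ENNReal.ofReal_mul (by norm_num),
    ← ENNReal.ofReal_mul (by positivity), ← ENNReal.ofReal_add (by positivity) (by positivity),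
    ENNReal.ofReal_le_ofReal_iff (by positivity)] at h1
  rw [h.weakDeriv_toL2]
  exact h1

/-! ### Existence, uniqueness and continuity of traces -/

theorem isTrace_iff {d b : ℝ} {u : L2Strip d} {g : L2Line} :
    IsTrace d b u g ↔ u ∈ W12 d ∧ ∃ (Φ : ℕ → ℝ × ℝ → ℂ) (h : ∀ n, IsCc (Φ n)),
      TendstoW12 d Φ u ∧ Tendsto (fun n => (h n).lineL2 b) atTop (𝓝 g) := by
  refine and_congr Iff.rfl (exists_congr fun Φ => ?_)
  rw [← exists_prop]
  refine exists_congr fun h => and_congr Iff.rfl ?_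
  exact tendsto_toLp_iff (fun n => IsCc.memLp_line (h n) b) g

theorem IsCc.isTrace {Φ : ℝ × ℝ → ℂ} (h : IsCc Φ) (d b : ℝ) :
    IsTrace d b (h.toL2 d) (h.lineL2 b) :=
  isTrace_iff.2 ⟨h.mem_W12 d, fun _ => Φ, fun _ => h, (tendstoW12_iff (fun _ => h) _).2
    ⟨tendsto_const_nhds, tendsto_const_nhds, tendsto_const_nhds⟩, tendsto_const_nhds⟩

theorem IsTrace.sub {d b : ℝ} {u u' : L2Strip d} {g g' : L2Line}
    (h : IsTrace d b u g) (h' : IsTrace d b u' g') : IsTrace d b (u - u') (g - g') := by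
  simpa [sub_eq_add_neg] using h.add (h'.smul (-1))

theorem IsTrace.norm_sq_le {d b : ℝ} (hd : 0 < d) (hb : b ∈ Set.Icc 0 d) {u : L2Strip d}
    {g : L2Line} (h : IsTrace d b u g) :
    d * ‖g‖ ^ 2 ≤ 4 * ‖u‖ ^ 2 + 4 * d ^ 2 * ‖weakDeriv d ey u‖ ^ 2 := by
  obtain ⟨-, Φ, hΦ, ht, hg⟩ := isTrace_iff.1 h
  obtain ⟨t0, -, ty⟩ := (tendstoW12_iff hΦ u).1 ht
  exact le_of_tendsto_of_tendsto' ((hg.norm.pow 2).const_mul d)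
    (((t0.norm.pow 2).const_mul 4).add ((ty.norm.pow 2).const_mul (4 * d ^ 2)))
    fun n => (hΦ n).norm_lineL2_le hd hb

/-- The difference is a trace of `u - u = 0`, and the trace inequality forces it to vanish. -/
theorem IsTrace.unique {d b : ℝ} (hd : 0 < d) (hb : b ∈ Set.Icc 0 d) {u : L2Strip d}
    {g g' : L2Line} (h : IsTrace d b u g) (h' : IsTrace d b u g') : g = g' := by
  have h1 := (h.sub h').norm_sq_le hd hb
  rw [sub_self, (HasWeakDeriv.zero d ey).weakDeriv_eq, norm_zero] at h1
  have h2 : ‖g - g'‖ = 0 := by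
    have h3 := norm_nonneg (g - g')
    by_contra hne
    have h4 : 0 < ‖g - g'‖ := lt_of_le_of_ne h3 (Ne.symm hne)
    have h5 : 0 < d * ‖g - g'‖ ^ 2 := by positivity
    linarith
  exact sub_eq_zero.1 (norm_eq_zero.1 h2)

theorem W12.weakDeriv_ex_sub {d : ℝ} {u w : L2Strip d} (hu : u ∈ W12 d) (hw : w ∈ W12 d) :
    weakDeriv d ex (u - w) = weakDeriv d ex u - weakDeriv d ex w := by
  have := weakDeriv_ex_add hu (Submodule.smul_mem _ (-1 : ℂ) hw)
  rw [weakDeriv_ex_smul _ hw] at this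
  simpa [sub_eq_add_neg] using this

theorem W12.weakDeriv_ey_sub {d : ℝ} {u w : L2Strip d} (hu : u ∈ W12 d) (hw : w ∈ W12 d) :
    weakDeriv d ey (u - w) = weakDeriv d ey u - weakDeriv d ey w := by
  have := weakDeriv_ey_add hu (Submodule.smul_mem _ (-1 : ℂ) hw)
  rw [weakDeriv_ey_smul _ hw] at this
  simpa [sub_eq_add_neg] using this

/-- Applied to differences of an approximating sequence, the trace inequality makes the boundary
restrictions Cauchy. -/
theorem exists_isTrace {d b : ℝ} (hd : 0 < d) (hb : b ∈ Set.Icc 0 d) {u : L2Strip d}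
    (hu : u ∈ W12 d) : ∃ g, IsTrace d b u g := by
  obtain ⟨Φ, hΦ, ht⟩ := exists_tendstoW12 hd hu
  obtain ⟨t0, -, ty⟩ := (tendstoW12_iff hΦ u).1 ht
  have hc : CauchySeq fun n => (hΦ n).lineL2 b := by
    have c0 := cauchySeq_iff_tendsto_dist_atTop_0.1 t0.cauchySeq
    have cy := cauchySeq_iff_tendsto_dist_atTop_0.1 ty.cauchySeq
    rw [cauchySeq_iff_tendsto_dist_atTop_0]
    have h1 := ((c0.pow 2).const_mul (4 / d)).add ((cy.pow 2).const_mul (4 * d))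
    simp only [ne_eq, OfNat.ofNat_ne_zero, not_false_eq_true, zero_pow, mul_zero, add_zero] at h1
    have h2 := h1.sqrt
    rw [Real.sqrt_zero] at h2
    refine squeeze_zero (fun _ => dist_nonneg) (fun m => Real.le_sqrt_of_sq_le ?_) h2
    have h3 := (((hΦ m.1).isTrace d b).sub ((hΦ m.2).isTrace d b)).norm_sq_le hd hb
    rw [W12.weakDeriv_ey_sub ((hΦ m.1).mem_W12 d) ((hΦ m.2).mem_W12 d)] at h3
    simp only [dist_eq_norm]
    rw [← mul_le_mul_iff_right₀ hd]
    refine h3.trans (le_of_eq ?_)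
    field_simp
  obtain ⟨g, hg⟩ := cauchySeq_tendsto_of_complete hc
  exact ⟨g, isTrace_iff.2 ⟨hu, Φ, hΦ, ht, hg⟩⟩

section Trace

variable {d b : ℝ} (hd : 0 < d) (hb : b ∈ Set.Icc 0 d)
include hd hb

theorem isTrace_trace {u : L2Strip d} (hu : u ∈ W12 d) : IsTrace d b u (trace d b u) := by
  have h := exists_isTrace hd hb hu
  rw [trace, dif_pos h]
  exact h.choose_spec

theorem IsTrace.trace_eq {u : L2Strip d} {g : L2Line} (h : IsTrace d b u g) : trace d b u = g :=
  (isTrace_trace hd hb h.1).unique hd hb h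

theorem trace_add {u w : L2Strip d} (hu : u ∈ W12 d) (hw : w ∈ W12 d) :
    trace d b (u + w) = trace d b u + trace d b w :=
  ((isTrace_trace hd hb hu).add (isTrace_trace hd hb hw)).trace_eq hd hb

theorem trace_sub {u w : L2Strip d} (hu : u ∈ W12 d) (hw : w ∈ W12 d) :
    trace d b (u - w) = trace d b u - trace d b w :=
  ((isTrace_trace hd hb hu).sub (isTrace_trace hd hb hw)).trace_eq hd hb

theorem trace_smul (c : ℂ) {u : L2Strip d} (hu : u ∈ W12 d) :
    trace d b (c • u) = c • trace d b u :=
  ((isTrace_trace hd hb hu).smul c).trace_eq hd hb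

theorem norm_trace_sq_le {u : L2Strip d} (hu : u ∈ W12 d) :
    ‖trace d b u‖ ^ 2 ≤ (4 / d) * ‖u‖ ^ 2 + 4 * d * ‖weakDeriv d ey u‖ ^ 2 := by
  have h := (isTrace_trace hd hb hu).norm_sq_le hd hb
  rw [← mul_le_mul_iff_right₀ hd]
  refine h.trans (le_of_eq ?_)
  field_simp

/-- Convergence of `∂_x` is not needed, since the trace inequality involves only `u` and `∂_y u`. -/
theorem tendsto_trace {ι : Type*} {l : Filter ι} {u : ι → L2Strip d} {v : L2Strip d}
    (hu : ∀ n, u n ∈ W12 d) (hv : v ∈ W12 d) (h0 : Tendsto u l (𝓝 v))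
    (hy : Tendsto (fun n => weakDeriv d ey (u n)) l (𝓝 (weakDeriv d ey v))) :
    Tendsto (fun n => trace d b (u n)) l (𝓝 (trace d b v)) := by
  rw [tendsto_iff_norm_sub_tendsto_zero] at h0 hy ⊢
  have h1 := ((h0.pow 2).const_mul (4 / d)).add ((hy.pow 2).const_mul (4 * d))
  simp only [ne_eq, OfNat.ofNat_ne_zero, not_false_eq_true, zero_pow, mul_zero, add_zero] at h1
  have h2 := h1.sqrt
  rw [Real.sqrt_zero] at h2
  refine squeeze_zero (fun _ => norm_nonneg _) (fun n => Real.le_sqrt_of_sq_le ?_) h2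
  have h3 := norm_trace_sq_le hd hb (sub_mem (hu n) hv)
  rwa [trace_sub hd hb (hu n) hv, W12.weakDeriv_ey_sub (hu n) hv] at h3

end Trace

/-! ### Green's formulas -/

theorem IsCc.integral_strip_fderiv_ex {G : ℝ × ℝ → ℂ} (h : IsCc G) (d : ℝ) :
    ∫ p in strip d, fderiv ℝ G p ex = 0 := by
  have hi : Integrable (fun p => fderiv ℝ G p ex)
      ((volume : Measure ℝ).prod ((volume : Measure ℝ).restrict (Set.Ioo 0 d))) := by
    rw [← restrict_strip_eq]
    exact (h.fderiv_apply ex).integrable.restrict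
  rw [restrict_strip_eq, integral_prod_symm _ hi]
  refine integral_eq_zero_of_ae (Eventually.of_forall fun y => ?_)
  have he : IsClosedEmbedding fun x : ℝ => (x, y) :=
    (Isometry.of_dist_eq fun x x' => by simp [Prod.dist_eq]).isClosedEmbedding
  refine integral_eq_zero_of_hasDerivAt_of_integrable (fun x => hasDerivAt_comp_ex h x y) ?_ ?_
  · exact ((h.fderiv_apply ex).1.continuous.comp he.continuous).integrable_of_hasCompactSupport
      ((h.fderiv_apply ex).2.comp_isClosedEmbedding he)
  · exact (h.1.continuous.comp he.continuous).integrable_of_hasCompactSupport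
      (h.2.comp_isClosedEmbedding he)

theorem IsCc.integral_strip_fderiv_ey {G : ℝ × ℝ → ℂ} (h : IsCc G) {d : ℝ} (hd : 0 ≤ d) :
    ∫ p in strip d, fderiv ℝ G p ey = (∫ x, G (x, d)) - ∫ x, G (x, 0) := by
  have hi : Integrable (fun p => fderiv ℝ G p ey)
      ((volume : Measure ℝ).prod ((volume : Measure ℝ).restrict (Set.Ioo 0 d))) := by
    rw [← restrict_strip_eq]
    exact (h.fderiv_apply ey).integrable.restrict
  have hl : ∀ b : ℝ, Integrable (fun x => G (x, b)) := fun b => by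
    have he : IsClosedEmbedding fun x : ℝ => (x, b) :=
      (Isometry.of_dist_eq fun x x' => by simp [Prod.dist_eq]).isClosedEmbedding
    exact (h.1.continuous.comp he.continuous).integrable_of_hasCompactSupport
      (h.2.comp_isClosedEmbedding he)
  rw [restrict_strip_eq, integral_prod _ hi, ← integral_sub (hl d) (hl 0)]
  refine integral_congr_ae (Eventually.of_forall fun x => ?_)
  simp only
  rw [← integral_Ioc_eq_integral_Ioo, ← intervalIntegral.integral_of_le hd]
  exact intervalIntegral.integral_eq_sub_of_hasDerivAt (fun y _ => hasDerivAt_comp_ey h x y)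
    (((h.fderiv_apply ey).1.continuous.comp (by fun_prop)).intervalIntegrable _ _)

theorem IsCc.inner_toL2 {Φ Ψ : ℝ × ℝ → ℂ} (h : IsCc Φ) (h' : IsCc Ψ) (d : ℝ) :
    inner ℂ (h.toL2 d) (h'.toL2 d) = ∫ p in strip d, conj (Φ p) * Ψ p := by
  rw [L2.inner_def]
  refine integral_congr_ae ?_
  filter_upwards [h.coeFn_toL2 d, h'.coeFn_toL2 d] with p h1 h2
  rw [h1, h2, RCLike.inner_apply, mul_comm]

theorem IsCc.inner_lineL2 {Φ Ψ : ℝ × ℝ → ℂ} (h : IsCc Φ) (h' : IsCc Ψ) (b : ℝ) :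
    inner ℂ (h.lineL2 b) (h'.lineL2 b) = ∫ x, conj (Φ (x, b)) * Ψ (x, b) := by
  rw [L2.inner_def]
  refine integral_congr_ae ?_
  filter_upwards [h.coeFn_lineL2 b, h'.coeFn_lineL2 b] with p h1 h2
  rw [h1, h2, RCLike.inner_apply, mul_comm]

theorem IsCc.inner_deriv_add {Φ Ψ : ℝ × ℝ → ℂ} (h : IsCc Φ) (h' : IsCc Ψ) (d : ℝ) (v : ℝ × ℝ) :
    inner ℂ (weakDeriv d v (h.toL2 d)) (h'.toL2 d) +
      inner ℂ (h.toL2 d) (weakDeriv d v (h'.toL2 d)) =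
      ∫ p in strip d, fderiv ℝ (fun p => conj (Φ p) * Ψ p) p v := by
  rw [h.weakDeriv_toL2, h'.weakDeriv_toL2, IsCc.inner_toL2, IsCc.inner_toL2, ← integral_add]
  · refine integral_congr_ae (Eventually.of_forall fun p => ?_)
    simp only
    rw [fderiv_fun_mul (h.star.1.differentiable (by simp) p) (h'.1.differentiable (by simp) p)]
    simp only [_root_.add_apply, _root_.smul_apply, smul_eq_mul, h.fderiv_star]
    ring
  · exact ((h.fderiv_apply v).star.mul h').integrable.restrict
  · exact (h.star.mul (h'.fderiv_apply v)).integrable.restrict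

theorem green_ex {d : ℝ} (hd : 0 < d) {u w : L2Strip d} (hu : u ∈ W12 d) (hw : w ∈ W12 d) :
    inner ℂ (weakDeriv d ex u) w + inner ℂ u (weakDeriv d ex w) = 0 := by
  obtain ⟨Φ, hΦ, ht⟩ := exists_tendstoW12 hd hu
  obtain ⟨Ψ, hΨ, ht'⟩ := exists_tendstoW12 hd hw
  obtain ⟨t0, tx, ty⟩ := (tendstoW12_iff hΦ u).1 ht
  obtain ⟨t0', tx', ty'⟩ := (tendstoW12_iff hΨ w).1 ht'
  refine tendsto_nhds_unique ((tx.inner t0').add (t0.inner tx')) ?_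
  refine tendsto_const_nhds.congr fun n => ?_
  rw [(hΦ n).inner_deriv_add (hΨ n), ((hΦ n).star.mul (hΨ n)).integral_strip_fderiv_ex]

/-- For smooth functions this is the fundamental theorem of calculus in `y` for `conj(Φ)Ψ`. Both
sides are continuous in the `W^{1,2}` norm, so density finishes. -/
theorem green_ey {d : ℝ} (hd : 0 < d) {u w : L2Strip d} (hu : u ∈ W12 d) (hw : w ∈ W12 d) :
    inner ℂ (weakDeriv d ey u) w + inner ℂ u (weakDeriv d ey w) =
      inner ℂ (trace d d u) (trace d d w) - inner ℂ (trace d 0 u) (trace d 0 w) := by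
  have m0 : (0 : ℝ) ∈ Set.Icc 0 d := ⟨le_rfl, hd.le⟩
  have md : d ∈ Set.Icc 0 d := ⟨hd.le, le_rfl⟩
  obtain ⟨Φ, hΦ, ht⟩ := exists_tendstoW12 hd hu
  obtain ⟨Ψ, hΨ, ht'⟩ := exists_tendstoW12 hd hw
  obtain ⟨t0, tx, ty⟩ := (tendstoW12_iff hΦ u).1 ht
  obtain ⟨t0', tx', ty'⟩ := (tendstoW12_iff hΨ w).1 ht'
  have tr := fun b (hb : b ∈ Set.Icc 0 d) =>
    (tendsto_trace hd hb (fun n => (hΦ n).mem_W12 d) hu t0 ty).inner (𝕜 := ℂ)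
      (tendsto_trace hd hb (fun n => (hΨ n).mem_W12 d) hw t0' ty')
  refine tendsto_nhds_unique ((ty.inner t0').add (t0.inner ty')) ?_
  refine ((tr d md).sub (tr 0 m0)).congr fun n => ?_
  rw [(hΦ n).inner_deriv_add (hΨ n), ((hΦ n).star.mul (hΨ n)).integral_strip_fderiv_ey hd.le]
  rw [((hΦ n).isTrace d d).trace_eq hd md, ((hΨ n).isTrace d d).trace_eq hd md,
    ((hΦ n).isTrace d 0).trace_eq hd m0, ((hΨ n).isTrace d 0).trace_eq hd m0,
    IsCc.inner_lineL2, IsCc.inner_lineL2]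

/-! ### Functions in `W^{1,∞}(ℝ)` are Lipschitz -/

theorem ae_norm_le_of_memLp_top {X F : Type*} [MeasurableSpace X] [NormedAddCommGroup F]
    {μ : Measure X} {f : X → F} (hf : MemLp f ⊤ μ) : ∀ᵐ x ∂μ, ‖f x‖ ≤ (eLpNorm f ⊤ μ).toReal := by
  have h := ae_le_eLpNormEssSup (f := f) (μ := μ)
  rw [← eLpNorm_exponent_top] at h
  filter_upwards [h] with x hx
  rw [← toReal_enorm]
  exact ENNReal.toReal_mono hf.2.ne hx

/-- The weak derivative of `α ∈ W^{1,∞}(ℝ)` can be taken measurable and bounded everywhere. -/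
theorem MemW1Inf.exists_bounded_deriv {α : ℝ → ℝ} (hα : MemW1Inf α) :
    ∃ (β : ℝ → ℝ) (L : ℝ), 0 ≤ L ∧ Measurable β ∧ (∀ x, ‖β x‖ ≤ L) ∧
      ∀ φ : ℝ → ℝ, ContDiff ℝ ∞ φ → HasCompactSupport φ →
        ∫ x, α x * deriv φ x = -∫ x, β x * φ x := by
  obtain ⟨-, β, hβ, h⟩ := hα
  set L := (eLpNorm β ⊤ volume).toReal
  set β₁ := hβ.1.mk β
  have hm : Measurable β₁ := hβ.1.stronglyMeasurable_mk.measurable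
  have hS : MeasurableSet {x | ‖β₁ x‖ ≤ L} := measurableSet_le hm.norm measurable_const
  -- A measurable representative is set to zero on the null set where it exceeds the essential
  -- supremum.
  refine ⟨{x | ‖β₁ x‖ ≤ L}.indicator β₁, L, ENNReal.toReal_nonneg, hm.indicator hS, fun x => ?_,
    fun φ hφ hφc => ?_⟩
  · by_cases hx : x ∈ {x | ‖β₁ x‖ ≤ L}
    · rw [Set.indicator_of_mem hx]
      exact hx
    · rw [Set.indicator_of_notMem hx, norm_zero]
      exact ENNReal.toReal_nonneg
  · rw [h φ hφ hφc]
    congr 1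
    refine integral_congr_ae ?_
    filter_upwards [hβ.1.ae_eq_mk, ae_norm_le_of_memLp_top hβ] with x h1 h2
    have h3 : x ∈ {x | ‖β₁ x‖ ≤ L} := by
      change ‖hβ.1.mk β x‖ ≤ L
      rw [← h1]
      exact h2
    rw [Set.indicator_of_mem h3, h1]

theorem hasDerivAt_primitive {φ : ℝ → ℝ} (hφ : Continuous φ) (x : ℝ) :
    HasDerivAt (fun x => ∫ s in (0 : ℝ)..x, φ s) (φ x) x :=
  intervalIntegral.integral_hasDerivAt_right (hφ.intervalIntegrable _ _)
    (hφ.stronglyMeasurableAtFilter _ _) hφ.continuousAt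

theorem contDiff_primitive {φ : ℝ → ℝ} (hφ : ContDiff ℝ ∞ φ) :
    ContDiff ℝ ∞ fun x => ∫ s in (0 : ℝ)..x, φ s := by
  have hd := hasDerivAt_primitive hφ.continuous
  rw [contDiff_infty_iff_deriv]
  refine ⟨fun x => (hd x).differentiableAt, ?_⟩
  have : deriv (fun x => ∫ s in (0 : ℝ)..x, φ s) = φ := funext fun x => (hd x).deriv
  rwa [this]

theorem integrable_comp_sub_prod {φ : ℝ → ℝ} (hφ : Continuous φ) (hφi : Integrable φ) (t : ℝ) :
    Integrable (fun p : ℝ × ℝ => φ (p.1 - p.2))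
      ((volume : Measure ℝ).prod ((volume : Measure ℝ).restrict (Set.Ioc 0 t))) := by
  have hc : Continuous fun p : ℝ × ℝ => φ (p.1 - p.2) :=
    hφ.comp (continuous_fst.sub continuous_snd)
  rw [integrable_prod_iff' hc.aestronglyMeasurable]
  refine ⟨Eventually.of_forall fun s => hφi.comp_sub_right s, ?_⟩
  simp_rw [fun s => integral_sub_right_eq_self (μ := (volume : Measure ℝ)) (fun x => ‖φ x‖) s]
  exact integrable_const _

/-- For almost every `x`, `α(x + t) - α(x)` is the integral of `β(x + s)` over `s` in `(0, t)`, so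
`L` can be a bound for `β`. The null set may depend on `t`. -/
theorem MemW1Inf.exists_lipschitz {α : ℝ → ℝ} (hα : MemW1Inf α) :
    ∃ L : ℝ, 0 ≤ L ∧ ∀ t : ℝ, 0 ≤ t → ∀ᵐ x : ℝ, |α (x + t) - α x| ≤ L * t := by
  obtain ⟨β, L, hL, hβm, hβ, hw⟩ := hα.exists_bounded_deriv
  refine ⟨L, hL, fun t ht => ?_⟩
  set B : ℝ → ℝ := fun x => ∫ s in Set.Ioc 0 t, β (x + s) with hB
  have hBle : ∀ x, ‖B x‖ ≤ L * t := fun x => by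
    have := norm_setIntegral_le_of_norm_le_const (μ := (volume : Measure ℝ)) (s := Set.Ioc 0 t)
      (f := fun s => β (x + s)) measure_Ioc_lt_top fun s _ => hβ (x + s)
    rwa [Real.volume_real_Ioc_of_le ht, sub_zero] at this
  have hBm : AEStronglyMeasurable B volume := by
    have : StronglyMeasurable fun p : ℝ × ℝ => β (p.1 + p.2) :=
      (hβm.comp (measurable_fst.add measurable_snd)).stronglyMeasurable
    exact this.integral_prod_right'.aestronglyMeasurable
  have hshift : MemLp (fun x => α (x + t)) ⊤ volume :=
    hα.1.comp_measurePreserving (measurePreserving_add_right volume t)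
  have hloc : LocallyIntegrable (fun x => α (x + t) - α x - B x) volume := by
    refine ((hshift.locallyIntegrable le_top).sub (hα.1.locallyIntegrable le_top)).sub ?_
    exact (memLp_top_of_bound hBm _ (Eventually.of_forall hBle)).locallyIntegrable le_top
  have key := ae_eq_zero_of_integral_contDiff_smul_eq_zero hloc fun φ hφ hφc => by
    have hφi : Integrable φ := hφ.continuous.integrable_of_hasCompactSupport hφc
    set P : ℝ → ℝ := fun x => ∫ s in (0 : ℝ)..x, φ s with hP
    -- A primitive `P` of `φ` need not have compact support, but `P(x) - P(x - t)` does, being the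
    -- integral of `φ(x - s)` over `(0, t)`. Testing with it turns `deriv Θ` into a difference of
    -- `φ`, which moves onto `α` by translation, while Fubini turns the right side into `B`.
    set Θ : ℝ → ℝ := fun x => P x - P (x - t) with hΘ
    have hΘe : ∀ x, Θ x = ∫ s in Set.Ioc 0 t, φ (x - s) := fun x => by
      rw [← intervalIntegral.integral_of_le ht, intervalIntegral.integral_comp_sub_left, sub_zero]
      exact intervalIntegral.integral_interval_sub_left (hφ.continuous.intervalIntegrable _ _)
        (hφ.continuous.intervalIntegrable _ _)
    have hΘd : ContDiff ℝ ∞ Θ := (contDiff_primitive hφ).sub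
      ((contDiff_primitive hφ).comp (contDiff_id.sub contDiff_const))
    have hΘ' : deriv Θ = fun x => φ x - φ (x - t) := funext fun x =>
      ((hasDerivAt_primitive hφ.continuous x).sub
        ((hasDerivAt_primitive hφ.continuous (x - t)).comp_sub_const x t)).deriv
    have hΘc : HasCompactSupport Θ := by
      refine HasCompactSupport.intro ((hφc.isCompact).add (isCompact_Icc (a := 0) (b := t)))
        fun x hx => ?_
      rw [hΘe]
      refine setIntegral_eq_zero_of_forall_eq_zero fun s hs => ?_
      by_contra hne
      exact hx ⟨x - s, subset_tsupport φ hne, s, Set.Ioc_subset_Icc_self hs, by simp⟩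
    have e0 := hw Θ hΘd hΘc
    have i1 : Integrable fun x => φ x * α x :=
      hφi.mul_bdd hα.1.1 (ae_norm_le_of_memLp_top hα.1)
    have i2 : Integrable fun x => φ x * α (x + t) :=
      hφi.mul_bdd hshift.1 (ae_norm_le_of_memLp_top hshift)
    have i3 : Integrable fun x => φ x * B x :=
      hφi.mul_bdd hBm (Eventually.of_forall hBle)
    have i4 : Integrable fun x => φ (x - t) * α x := by
      simpa using i2.comp_sub_right t
    have e1 : ∫ x, α x * deriv Θ x = (∫ x, φ x * α x) - ∫ x, φ x * α (x + t) := by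
      have e3 : ∫ x, φ x * α (x + t) = ∫ x, φ (x - t) * α x := by
        rw [← integral_sub_right_eq_self (fun x => φ x * α (x + t)) t]
        simp
      rw [e3, ← integral_sub i1 i4, hΘ']
      refine integral_congr_ae (Eventually.of_forall fun x => ?_)
      simp only
      ring
    have e2 : ∫ x, β x * Θ x = ∫ x, φ x * B x := by
      have j1 : Integrable (Function.uncurry fun x s => β x * φ (x - s))
          ((volume : Measure ℝ).prod ((volume : Measure ℝ).restrict (Set.Ioc 0 t))) :=
        (integrable_comp_sub_prod hφ.continuous hφi t).bdd_mul
          (hβm.comp measurable_fst).aestronglyMeasurable (Eventually.of_forall fun p => hβ p.1)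
      have j2 : Integrable (Function.uncurry fun s x => φ x * β (x + s))
          (((volume : Measure ℝ).restrict (Set.Ioc 0 t)).prod (volume : Measure ℝ)) :=
        (hφi.comp_snd _).mul_bdd
          (hβm.comp (measurable_snd.add measurable_fst)).aestronglyMeasurable
          (Eventually.of_forall fun p => hβ (p.2 + p.1))
      simp_rw [hΘe, hB, ← integral_const_mul]
      rw [integral_integral_swap j1, ← integral_integral_swap j2]
      refine integral_congr_ae (Eventually.of_forall fun s => ?_)
      simp only
      rw [← integral_add_right_eq_self (fun x => β x * φ (x - s)) s]
      refine integral_congr_ae (Eventually.of_forall fun x => ?_)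
      simp only [add_sub_cancel_right]
      ring
    rw [e1, e2] at e0
    have e4 : ∀ x, φ x • (α (x + t) - α x - B x) = φ x * α (x + t) - φ x * α x - φ x * B x :=
      fun x => by rw [smul_eq_mul]; ring
    simp_rw [e4]
    have i5 : Integrable fun x => φ x * α (x + t) - φ x * α x := i2.sub i1
    rw [integral_sub i5 i3, integral_sub i2 i1]
    linarith
  filter_upwards [key] with x hx
  rw [sub_eq_zero.1 hx, ← Real.norm_eq_abs]
  exact hBle x

/-! ### Multiplication by a bounded function on `L²(ℝ)` -/

theorem memLp_mul_line {a : ℝ → ℝ} (ha : MemLp a ⊤ volume) (f : L2Line) :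
    MemLp (fun x => (a x : ℂ) * f x) 2 volume :=
  (Lp.memLp f).mul (p := ⊤) (q := 2) ha.ofReal

/-- Multiplication by the bounded real function `a` on `L²(ℝ)`. -/
def mulLine (a : ℝ → ℝ) (ha : MemLp a ⊤ volume) : L2Line →L[ℂ] L2Line :=
  LinearMap.mkContinuous
    { toFun := fun f => (memLp_mul_line ha f).toLp _
      map_add' := fun f g => by
        refine Lp.ext ?_
        filter_upwards [(memLp_mul_line ha (f + g)).coeFn_toLp, (memLp_mul_line ha f).coeFn_toLp,
          (memLp_mul_line ha g).coeFn_toLp, Lp.coeFn_add f g,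
          Lp.coeFn_add ((memLp_mul_line ha f).toLp _) ((memLp_mul_line ha g).toLp _)]
          with x h1 h2 h3 h4 h5
        rw [h1, h5, Pi.add_apply, h2, h3, h4, Pi.add_apply, mul_add]
      map_smul' := fun c f => by
        refine Lp.ext ?_
        filter_upwards [(memLp_mul_line ha (c • f)).coeFn_toLp, (memLp_mul_line ha f).coeFn_toLp,
          Lp.coeFn_smul c f, Lp.coeFn_smul c ((memLp_mul_line ha f).toLp _)] with x h1 h2 h3 h4
        simp only [RingHom.id_apply]
        rw [h1, h4, Pi.smul_apply, h2, h3, Pi.smul_apply, smul_eq_mul, smul_eq_mul]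
        ring }
    (eLpNorm a ⊤ volume).toReal fun f => by
      refine Lp.norm_le_mul_norm_of_ae_le_mul ?_
      filter_upwards [(memLp_mul_line ha f).coeFn_toLp, ae_norm_le_of_memLp_top ha] with x h1 h2
      refine (congrArg norm h1).le.trans ?_
      rw [norm_mul, Complex.norm_real]
      exact mul_le_mul_of_nonneg_right h2 (norm_nonneg _)

theorem coeFn_mulLine {a : ℝ → ℝ} (ha : MemLp a ⊤ volume) (f : L2Line) :
    mulLine a ha f =ᵐ[volume] fun x => (a x : ℂ) * f x := (memLp_mul_line ha f).coeFn_toLp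

theorem inner_mulLine {a : ℝ → ℝ} (ha : MemLp a ⊤ volume) (f g : L2Line) :
    inner ℂ f (mulLine a ha g) = ∫ x, (a x : ℂ) * (conj (f x) * g x) := by
  rw [L2.inner_def]
  refine integral_congr_ae ?_
  filter_upwards [coeFn_mulLine ha g] with x h1
  rw [h1, RCLike.inner_apply]
  ring

theorem integrable_mulLine {a : ℝ → ℝ} (ha : MemLp a ⊤ volume) (f g : L2Line) :
    Integrable fun x => (a x : ℂ) * (conj (f x) * g x) := by
  refine (L2.integrable_inner (𝕜 := ℂ) f (mulLine a ha g)).congr ?_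
  filter_upwards [coeFn_mulLine ha g] with x h1
  rw [h1, RCLike.inner_apply]
  ring

theorem inner_mulLine_self_nonneg {a : ℝ → ℝ} (ha : MemLp a ⊤ volume) (h0 : ∀ x, 0 ≤ a x)
    (f : L2Line) : 0 ≤ (inner ℂ f (mulLine a ha f)).re := by
  rw [inner_mulLine]
  have e : ∀ x, (a x : ℂ) * (conj (f x) * f x) = ((a x * ‖f x‖ ^ 2 : ℝ) : ℂ) := fun x => by
    rw [Complex.conj_mul']
    push_cast
    ring
  simp_rw [e]
  rw [integral_complex_ofReal, Complex.ofReal_re]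
  exact integral_nonneg fun x => mul_nonneg (h0 x) (sq_nonneg _)

/-! ### Translations along the strip -/

theorem measurePreserving_shift (d t : ℝ) :
    MeasurePreserving (fun p : ℝ × ℝ => p + (t, 0))
      ((volume : Measure (ℝ × ℝ)).restrict (strip d))
      ((volume : Measure (ℝ × ℝ)).restrict (strip d)) := by
  have h := (measurePreserving_add_right (volume : Measure (ℝ × ℝ)) (t, 0)).restrict_preimage
    (isOpen_strip d).measurableSet
  have e : (fun p : ℝ × ℝ => p + (t, 0)) ⁻¹' strip d = strip d := by
    ext p
    simp [strip]
  rwa [e] at h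

theorem measurableEmbedding_shift (t : ℝ) :
    MeasurableEmbedding fun p : ℝ × ℝ => p + (t, 0) :=
  measurableEmbedding_addRight _

/-- Translation by `t` along the strip. -/
def shift (d t : ℝ) : L2Strip d →ₗᵢ[ℂ] L2Strip d :=
  Lp.compMeasurePreservingₗᵢ ℂ _ (measurePreserving_shift d t)

/-- Translation by `t` on the line. -/
def shiftLine (t : ℝ) : L2Line →ₗᵢ[ℂ] L2Line :=
  Lp.compMeasurePreservingₗᵢ ℂ _ (measurePreserving_add_right volume t)

theorem coeFn_shift (d t : ℝ) (u : L2Strip d) :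
    shift d t u =ᵐ[(volume : Measure (ℝ × ℝ)).restrict (strip d)] fun p => u (p + (t, 0)) :=
  Lp.coeFn_compMeasurePreserving u (measurePreserving_shift d t)

theorem coeFn_shiftLine (t : ℝ) (u : L2Line) :
    shiftLine t u =ᵐ[volume] fun x => u (x + t) :=
  Lp.coeFn_compMeasurePreserving u (measurePreserving_add_right volume t)

theorem shift_shift_neg (d t : ℝ) (u : L2Strip d) : shift d t (shift d (-t) u) = u := by
  have h := Lp.compMeasurePreserving_comp_apply u (measurePreserving_shift d (-t))
    (measurePreserving_shift d t)
  refine h.symm.trans ?_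
  refine Lp.ext ?_
  filter_upwards [Lp.coeFn_compMeasurePreserving u
    ((measurePreserving_shift d (-t)).comp (measurePreserving_shift d t))] with p hp
  rw [hp]
  simp only [Function.comp]
  congr 1
  simp [add_assoc]

theorem shiftLine_shiftLine_neg (t : ℝ) (u : L2Line) : shiftLine t (shiftLine (-t) u) = u := by
  have h := Lp.compMeasurePreserving_comp_apply u (measurePreserving_add_right volume (-t))
    (measurePreserving_add_right volume t)
  refine h.symm.trans ?_
  refine Lp.ext ?_
  filter_upwards [Lp.coeFn_compMeasurePreserving u
    ((measurePreserving_add_right volume (-t)).comp (measurePreserving_add_right volume t))]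
    with p hp
  rw [hp]
  simp only [Function.comp]
  congr 1
  simp [add_assoc]

theorem inner_shift (d t : ℝ) (u w : L2Strip d) :
    inner ℂ u (shift d t w) = inner ℂ (shift d (-t) u) w := by
  rw [← (shift d t).inner_map_map (shift d (-t) u) w, shift_shift_neg]

/-- The adjoint of a translation is its inverse; this and `inner_shift` carry out the discrete
integration by parts in the difference quotient method. -/
theorem inner_shiftLine (t : ℝ) (u w : L2Line) :
    inner ℂ u (shiftLine t w) = inner ℂ (shiftLine (-t) u) w := by
  rw [← (shiftLine t).inner_map_map (shiftLine (-t) u) w, shiftLine_shiftLine_neg]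

theorem IsCc.shift {Φ : ℝ × ℝ → ℂ} (h : IsCc Φ) (t : ℝ) : IsCc fun p => Φ (p + (t, 0)) :=
  ⟨h.1.comp (contDiff_id.add contDiff_const),
    h.2.comp_homeomorph (Homeomorph.addRight ((t, 0) : ℝ × ℝ))⟩

theorem IsTest.shift {d : ℝ} {φ : ℝ × ℝ → ℂ} (h : IsTest d φ) (t : ℝ) :
    IsTest d fun p => φ (p + (t, 0)) := by
  refine ⟨(h.isCc.shift t).1, (h.isCc.shift t).2, ?_⟩
  have := tsupport_comp_eq_preimage φ (Homeomorph.addRight ((t, 0) : ℝ × ℝ))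
  intro p hp
  have h1 : p + (t, 0) ∈ tsupport φ := by
    have h2 : p ∈ tsupport (φ ∘ Homeomorph.addRight ((t, 0) : ℝ × ℝ)) := hp
    rw [this] at h2
    exact h2
  have h3 := h.2.2 h1
  simpa [strip] using h3

theorem integral_shift_mul {d : ℝ} (w : L2Strip d) (f : ℝ × ℝ → ℂ) (t : ℝ) :
    ∫ p in strip d, (shift d t w) p * f p = ∫ p in strip d, w p * f (p + (-t, 0)) := by
  refine Eq.trans ?_ ((measurePreserving_shift d t).integral_comp (measurableEmbedding_shift t)
    fun p => w p * f (p + (-t, 0)))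
  refine integral_congr_ae ?_
  filter_upwards [coeFn_shift d t w] with p hp
  rw [hp]
  congr 2
  simp [add_assoc]

theorem HasWeakDeriv.shift {d : ℝ} {v : ℝ × ℝ} {u g : L2Strip d} (h : HasWeakDeriv d v u g)
    (t : ℝ) : HasWeakDeriv d v (shift d t u) (shift d t g) := by
  intro φ hφ
  rw [integral_shift_mul, integral_shift_mul, ← h _ (hφ.shift (-t))]
  simp_rw [fderiv_comp_add_right]

theorem shift_mem_W12 {d : ℝ} {u : L2Strip d} (hu : u ∈ W12 d) (t : ℝ) : shift d t u ∈ W12 d :=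
  ⟨⟨_, (W12.hasWeakDeriv_ex hu).shift t⟩, ⟨_, (W12.hasWeakDeriv_ey hu).shift t⟩⟩

theorem weakDeriv_ex_shift {d : ℝ} {u : L2Strip d} (hu : u ∈ W12 d) (t : ℝ) :
    weakDeriv d ex (shift d t u) = shift d t (weakDeriv d ex u) :=
  ((W12.hasWeakDeriv_ex hu).shift t).weakDeriv_eq

theorem weakDeriv_ey_shift {d : ℝ} {u : L2Strip d} (hu : u ∈ W12 d) (t : ℝ) :
    weakDeriv d ey (shift d t u) = shift d t (weakDeriv d ey u) :=
  ((W12.hasWeakDeriv_ey hu).shift t).weakDeriv_eq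

theorem IsCc.toL2_shift {Φ : ℝ × ℝ → ℂ} (h : IsCc Φ) (d t : ℝ) :
    (h.shift t).toL2 d = RobinStrip.shift d t (h.toL2 d) :=
  (Lp.toLp_compMeasurePreserving (h.memLp d) (measurePreserving_shift d t)).symm

theorem IsCc.lineL2_shift {Φ : ℝ × ℝ → ℂ} (h : IsCc Φ) (b t : ℝ) :
    (h.shift t).lineL2 b = shiftLine t (h.lineL2 b) := by
  refine Eq.trans ?_
    (Lp.toLp_compMeasurePreserving (h.memLp_line b) (measurePreserving_add_right volume t)).symm
  refine MemLp.toLp_congr _ _ (Eventually.of_forall fun x => ?_)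
  simp

theorem trace_shift {d b : ℝ} (hd : 0 < d) (hb : b ∈ Set.Icc 0 d) {u : L2Strip d} (hu : u ∈ W12 d)
    (t : ℝ) : trace d b (shift d t u) = shiftLine t (trace d b u) := by
  obtain ⟨Φ, hΦ, ht⟩ := exists_tendstoW12 hd hu
  obtain ⟨t0, -, ty⟩ := (tendstoW12_iff hΦ u).1 ht
  have h1 := ((shiftLine t).continuous.tendsto _).comp
    (tendsto_trace hd hb (fun n => (hΦ n).mem_W12 d) hu t0 ty)
  have h2 := tendsto_trace hd hb (fun n => shift_mem_W12 ((hΦ n).mem_W12 d) t)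
    (shift_mem_W12 hu t) (((shift d t).continuous.tendsto _).comp t0) (by
      rw [weakDeriv_ey_shift hu]
      refine (((shift d t).continuous.tendsto _).comp ty).congr fun n => ?_
      exact (weakDeriv_ey_shift ((hΦ n).mem_W12 d) t).symm)
  refine tendsto_nhds_unique h2 (h1.congr fun n => ?_)
  simp only [Function.comp]
  rw [((hΦ n).isTrace d b).trace_eq hd hb, ← IsCc.toL2_shift,
    (((hΦ n).shift t).isTrace d b).trace_eq hd hb, IsCc.lineL2_shift]

/-- One factor `t` comes from Cauchy–Schwarz on `(0, t)`; the other comes from Fubini, since every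
translate of the derivative has the same norm on the strip. -/
theorem IsCc.norm_shift_sub_le {Φ : ℝ × ℝ → ℂ} (h : IsCc Φ) (d : ℝ) {t : ℝ} (ht : 0 ≤ t) :
    ‖RobinStrip.shift d t (h.toL2 d) - h.toL2 d‖ ≤ t * ‖weakDeriv d ex (h.toL2 d)‖ := by
  set μ := (volume : Measure (ℝ × ℝ)).restrict (strip d) with hμ
  refine le_of_sq_le_sq ?_ (by positivity)
  rw [← ENNReal.ofReal_le_ofReal_iff (by positivity), mul_pow,
    ENNReal.ofReal_mul (by positivity), h.weakDeriv_toL2, ← IsCc.toL2_shift]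
  have e1 := enorm_toLp_sq (((h.shift t).memLp d).sub (h.memLp d))
  rw [MemLp.toLp_sub] at e1
  have e2 := enorm_toLp_sq ((h.fderiv_apply ex).memLp d)
  refine e1.le.trans ?_
  refine le_trans ?_ (mul_le_mul_right e2.ge _)
  have hc' := (h.fderiv_apply ex).1.continuous
  have hpt : ∀ p : ℝ × ℝ, ‖Φ (p + (t, 0)) - Φ p‖ₑ ^ 2 ≤
      ENNReal.ofReal t * ∫⁻ s in Set.Ioo 0 t, ‖fderiv ℝ Φ (p + (s, 0)) ex‖ₑ ^ 2 := by
    intro p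
    have h1 := enorm_sub_sq_le_of_hasDerivAt (f := fun s => Φ (p + (s, 0)))
      (f' := fun s => fderiv ℝ Φ (p + (s, 0)) ex) (fun s => by
        have := (hasDerivAt_comp_ex h (p.1 + s) p.2).comp_const_add p.1 s
        simpa [Prod.add_def] using this)
      (hc'.comp (by fun_prop)) (a := 0) (b := t) (s := 0) (t := t) ⟨le_rfl, ht⟩ ⟨ht, le_rfl⟩
    have h0 : p + ((0 : ℝ), (0 : ℝ)) = p := by simp [Prod.add_def]
    simpa only [sub_zero, h0] using h1
  refine (lintegral_mono hpt).trans ?_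
  have hjm : Measurable fun q : (ℝ × ℝ) × ℝ => ‖fderiv ℝ Φ (q.1 + (q.2, 0)) ex‖ₑ ^ 2 :=
    (hc'.comp (by fun_prop : Continuous fun q : (ℝ × ℝ) × ℝ =>
      q.1 + (q.2, (0 : ℝ)))).measurable.enorm.pow_const 2
  rw [lintegral_const_mul _ hjm.lintegral_prod_right', lintegral_lintegral_swap hjm.aemeasurable]
  have : ∀ s : ℝ, ∫⁻ p, ‖fderiv ℝ Φ (p + (s, 0)) ex‖ₑ ^ 2 ∂μ =
      ∫⁻ p, ‖fderiv ℝ Φ p ex‖ₑ ^ 2 ∂μ := fun s =>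
    (measurePreserving_shift d s).lintegral_comp_emb (measurableEmbedding_shift s)
      (fun p => ‖fderiv ℝ Φ p ex‖ₑ ^ 2)
  refine (mul_le_mul_right (lintegral_mono fun s => (this s).le) _).trans (le_of_eq ?_)
  rw [setLIntegral_const, Real.volume_Ioo, sub_zero, mul_comm (lintegral _ _), ← mul_assoc,
    ← ENNReal.ofReal_mul ht, sq]

theorem norm_shift_sub_le {d : ℝ} (hd : 0 < d) {u : L2Strip d} (hu : u ∈ W12 d) {t : ℝ}
    (ht : 0 ≤ t) : ‖shift d t u - u‖ ≤ t * ‖weakDeriv d ex u‖ := by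
  obtain ⟨Φ, hΦ, hT⟩ := exists_tendstoW12 hd hu
  obtain ⟨t0, tx, -⟩ := (tendstoW12_iff hΦ u).1 hT
  exact le_of_tendsto_of_tendsto'
    (((((shift d t).continuous.tendsto _).comp t0).sub t0).norm) (tx.norm.const_mul t)
    fun n => (hΦ n).norm_shift_sub_le d ht

theorem norm_shift_neg_sub_le {d : ℝ} (hd : 0 < d) {u : L2Strip d} (hu : u ∈ W12 d) {t : ℝ}
    (ht : 0 ≤ t) : ‖shift d (-t) u - u‖ ≤ t * ‖weakDeriv d ex u‖ := by
  rw [← (shift d t).norm_map, map_sub, shift_shift_neg, norm_sub_rev]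
  exact norm_shift_sub_le hd hu ht

/-- The commutator is the translation followed by multiplication by `a(x) - a(x + t)`. This is where
the Lipschitz bound on `α` enters. -/
theorem norm_commutator_le {a : ℝ → ℝ} (ha : MemLp a ⊤ volume) {L t : ℝ}
    (hL : ∀ᵐ x : ℝ, |a (x + t) - a x| ≤ L * t) (f : L2Line) :
    ‖mulLine a ha (shiftLine t f) - shiftLine t (mulLine a ha f)‖ ≤ L * t * ‖f‖ := by
  rw [← (shiftLine t).norm_map f]
  refine Lp.norm_le_mul_norm_of_ae_le_mul ?_
  have h3 := (measurePreserving_add_right (volume : Measure ℝ) t).quasiMeasurePreserving.ae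
    (coeFn_mulLine ha f)
  filter_upwards [hL, Lp.coeFn_sub (mulLine a ha (shiftLine t f)) (shiftLine t (mulLine a ha f)),
    coeFn_mulLine ha (shiftLine t f), coeFn_shiftLine t (mulLine a ha f), coeFn_shiftLine t f, h3]
    with x h1 h2 h3 h4 h5 h6
  rw [h2, Pi.sub_apply, h3, h4, h6, h5, ← sub_mul, norm_mul, ← Complex.ofReal_sub,
    Complex.norm_real, Real.norm_eq_abs, abs_sub_comm]
  exact mul_le_mul_of_nonneg_right h1 (norm_nonneg _)

/-! ### The Robin form is closed -/

theorem left_mem_Icc_strip {d : ℝ} (hd : 0 < d) : (0 : ℝ) ∈ Set.Icc 0 d := ⟨le_rfl, hd.le⟩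

theorem right_mem_Icc_strip {d : ℝ} (hd : 0 < d) : d ∈ Set.Icc 0 d := ⟨hd.le, le_rfl⟩

/-- The Robin form in terms of inner products. -/
def innerForm (d : ℝ) {α : ℝ → ℝ} (hα : MemLp α ⊤ volume) (φ ψ : L2Strip d) : ℂ :=
  inner ℂ (weakDeriv d ex φ) (weakDeriv d ex ψ) + inner ℂ (weakDeriv d ey φ) (weakDeriv d ey ψ) +
    (inner ℂ (trace d 0 φ) (mulLine α hα (trace d 0 ψ)) +
      inner ℂ (trace d d φ) (mulLine α hα (trace d d ψ)))

theorem robinForm_eq (d : ℝ) {α : ℝ → ℝ} (hα : MemLp α ⊤ volume) (φ ψ : W12 d) :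
    robinForm d α φ ψ = innerForm d hα φ ψ := by
  have h1 : ∀ f g : L2Strip d, inner ℂ f g = ∫ p in strip d, conj (f p) * g p := fun f g => by
    rw [L2.inner_def]
    refine integral_congr_ae (Eventually.of_forall fun p => ?_)
    simp only [RCLike.inner_apply, mul_comm]
  have h2 : ∀ f g : L2Strip d, Integrable (fun p => conj (f p) * g p)
      ((volume : Measure (ℝ × ℝ)).restrict (strip d)) := fun f g => by
    refine (L2.integrable_inner (𝕜 := ℂ) f g).congr (Eventually.of_forall fun p => ?_)
    simp only [RCLike.inner_apply, mul_comm]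
  rw [robinForm, innerForm, h1, h1, inner_mulLine, inner_mulLine, ← integral_add (h2 _ _) (h2 _ _),
    ← integral_add (integrable_mulLine hα _ _) (integrable_mulLine hα _ _)]
  simp only [mul_add]

theorem continuous_setIntegral_mul {d : ℝ} {f : ℝ × ℝ → ℂ}
    (hf : MemLp f 2 ((volume : Measure (ℝ × ℝ)).restrict (strip d))) :
    Continuous fun u : L2Strip d => ∫ p in strip d, u p * f p := by
  have e : (fun u : L2Strip d => ∫ p in strip d, u p * f p) =
      fun u => inner ℂ (hf.star.toLp _) u := by
    funext u
    rw [L2.inner_def]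
    refine integral_congr_ae ?_
    filter_upwards [hf.star.coeFn_toLp] with p hp
    rw [hp, RCLike.inner_apply]
    simp
  rw [e]
  fun_prop

/-- Weak differentiation is a closed operator: for a fixed test function both sides of the identity
are continuous in `L²`. -/
theorem hasWeakDeriv_of_tendsto {d : ℝ} {v : ℝ × ℝ} {u g : ℕ → L2Strip d} {u' g' : L2Strip d}
    (h : ∀ n, HasWeakDeriv d v (u n) (g n)) (hu : Tendsto u atTop (𝓝 u'))
    (hg : Tendsto g atTop (𝓝 g')) : HasWeakDeriv d v u' g' := by
  intro φ hφ
  have h1 := ((continuous_setIntegral_mul (hφ.memLp_fderiv v)).tendsto u').comp hu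
  have h2 := (((continuous_setIntegral_mul hφ.memLp).tendsto g').comp hg).neg
  refine tendsto_nhds_unique h1 (h2.congr fun n => ?_)
  exact (h n φ hφ).symm

theorem dense_W12 (d : ℝ) : Dense (W12 d : Set (L2Strip d)) := by
  refine (Lp.dense_hasCompactSupport_contDiff (F := ℂ) (p := 2)
    (μ := (volume : Measure (ℝ × ℝ)).restrict (strip d)) (by norm_num)).mono ?_
  rintro f ⟨g, hfg, hgc, hg⟩
  have h : IsCc g := ⟨hg, hgc⟩
  have e : f = h.toL2 d := Lp.ext (hfg.trans (h.coeFn_toL2 d).symm)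
  rw [e]
  exact h.mem_W12 d

section Form

variable {d : ℝ} (hd : 0 < d) {α : ℝ → ℝ} (hα : MemLp α ⊤ volume)

include hd in
theorem innerForm_add_right (φ : L2Strip d) {ψ χ : L2Strip d} (hψ : ψ ∈ W12 d) (hχ : χ ∈ W12 d) :
    innerForm d hα φ (ψ + χ) = innerForm d hα φ ψ + innerForm d hα φ χ := by
  simp only [innerForm, W12.weakDeriv_ex_add hψ hχ, W12.weakDeriv_ey_add hψ hχ,
    trace_add hd (left_mem_Icc_strip hd) hψ hχ, trace_add hd (right_mem_Icc_strip hd) hψ hχ,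
    map_add, inner_add_right]
  ring

include hd in
theorem innerForm_smul_right (c : ℂ) (φ : L2Strip d) {ψ : L2Strip d} (hψ : ψ ∈ W12 d) :
    innerForm d hα φ (c • ψ) = c * innerForm d hα φ ψ := by
  simp only [innerForm, W12.weakDeriv_ex_smul c hψ, W12.weakDeriv_ey_smul c hψ,
    trace_smul hd (left_mem_Icc_strip hd) c hψ, trace_smul hd (right_mem_Icc_strip hd) c hψ,
    map_smul, inner_smul_right]
  ring

theorem inner_mulLine_symm (f g : L2Line) :
    inner ℂ f (mulLine α hα g) = conj (inner ℂ g (mulLine α hα f)) := by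
  rw [inner_mulLine, inner_mulLine, ← integral_conj]
  refine integral_congr_ae (Eventually.of_forall fun x => ?_)
  simp only [map_mul, Complex.conj_ofReal, Complex.conj_conj]
  ring

theorem innerForm_symm (φ ψ : L2Strip d) :
    innerForm d hα φ ψ = conj (innerForm d hα ψ φ) := by
  rw [innerForm, innerForm, map_add, map_add, map_add, inner_conj_symm, inner_conj_symm,
    ← inner_mulLine_symm, ← inner_mulLine_symm]

/-- The boundary terms are nonnegative because `α` is, and are dropped. -/
theorem norm_sq_le_innerForm_re (h0 : ∀ x, 0 ≤ α x) (ψ : L2Strip d) :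
    ‖weakDeriv d ex ψ‖ ^ 2 + ‖weakDeriv d ey ψ‖ ^ 2 ≤ (innerForm d hα ψ ψ).re := by
  have h1 : ∀ f : L2Strip d, (inner ℂ f f).re = ‖f‖ ^ 2 := fun f =>
    (norm_sq_eq_re_inner (𝕜 := ℂ) f).symm
  simp only [innerForm, Complex.add_re, h1]
  linarith [inner_mulLine_self_nonneg hα h0 (trace d 0 ψ),
    inner_mulLine_self_nonneg hα h0 (trace d d ψ)]

include hd hα in
theorem isClosedNonnegForm_robinForm (h0 : ∀ x, 0 ≤ α x) :
    IsClosedNonnegForm (W12 d) (robinForm d α) where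
  dense := dense_W12 d
  add_right φ ψ χ := by
    simp only [robinForm_eq d hα, Submodule.coe_add]
    exact innerForm_add_right hd hα φ ψ.2 χ.2
  smul_right c φ ψ := by
    rw [robinForm_eq d hα, robinForm_eq d hα, Submodule.coe_smul]
    exact innerForm_smul_right hd hα c φ ψ.2
  symm φ ψ := by
    simp only [robinForm_eq d hα]
    exact innerForm_symm hα _ _
  nonneg ψ := by
    rw [robinForm_eq d hα]
    exact (add_nonneg (sq_nonneg _) (sq_nonneg _)).trans (norm_sq_le_innerForm_re hα h0 (ψ : L2Strip d))
  closed u v huv hh := by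
    simp only [robinForm_eq d hα, Submodule.coe_sub] at hh ⊢
    have hre := (Complex.continuous_re.tendsto 0).comp hh
    rw [Complex.zero_re] at hre
    -- The form dominates the gradient, so a sequence that is Cauchy for the form has Cauchy `x`-
    -- and `y`-derivatives.
    have hcauchy : ∀ D : L2Strip d → L2Strip d,
        (∀ m n, ‖D (u m) - D (u n)‖ ^ 2 ≤ (innerForm d hα ((u m : L2Strip d) - u n)
          ((u m : L2Strip d) - u n)).re) → CauchySeq fun n => D (u n) := by
      intro D hD
      rw [cauchySeq_iff_tendsto_dist_atTop_0]
      have h2 := hre.sqrt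
      rw [Real.sqrt_zero] at h2
      refine squeeze_zero (fun _ => dist_nonneg) (fun m => Real.le_sqrt_of_sq_le ?_) h2
      rw [dist_eq_norm]
      exact hD m.1 m.2
    obtain ⟨gx, hgx⟩ := cauchySeq_tendsto_of_complete (hcauchy (weakDeriv d ex) fun m n => by
      rw [← W12.weakDeriv_ex_sub (u m).2 (u n).2]
      refine le_trans ?_ (norm_sq_le_innerForm_re hα h0 _)
      exact le_add_of_nonneg_right (sq_nonneg _))
    obtain ⟨gy, hgy⟩ := cauchySeq_tendsto_of_complete (hcauchy (weakDeriv d ey) fun m n => by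
      rw [← W12.weakDeriv_ey_sub (u m).2 (u n).2]
      refine le_trans ?_ (norm_sq_le_innerForm_re hα h0 _)
      exact le_add_of_nonneg_left (sq_nonneg _))
    have hx : HasWeakDeriv d ex v gx :=
      hasWeakDeriv_of_tendsto (fun n => W12.hasWeakDeriv_ex (u n).2) huv hgx
    have hy : HasWeakDeriv d ey v gy :=
      hasWeakDeriv_of_tendsto (fun n => W12.hasWeakDeriv_ey (u n).2) huv hgy
    have hv : v ∈ W12 d := ⟨⟨_, hx⟩, ⟨_, hy⟩⟩
    refine ⟨hv, ?_⟩
    rw [← hx.weakDeriv_eq] at hgx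
    rw [← hy.weakDeriv_eq] at hgy
    -- Convergence in `L²` together with that of `∂_y` brings the traces along, so the boundary part
    -- of the form converges too.
    have tr := fun b (hb : b ∈ Set.Icc 0 d) => tendsto_trace hd hb (fun n => (u n).2) hv huv hgy
    have sub0 : ∀ {X : Type} [NormedAddCommGroup X] {f : ℕ → X} {a : X},
        Tendsto f atTop (𝓝 a) → Tendsto (fun n => f n - a) atTop (𝓝 0) := by
      intro X _ f a h
      simpa using h.sub (tendsto_const_nhds (x := a))
    have tm : ∀ b ∈ Set.Icc 0 d, Tendsto (fun n => inner ℂ (trace d b (u n) - trace d b v)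
        (mulLine α hα (trace d b (u n) - trace d b v))) atTop (𝓝 0) := fun b hb => by
      have h1 := sub0 (tr b hb)
      have h2 := h1.inner (𝕜 := ℂ) (((mulLine α hα).continuous.tendsto 0).comp h1)
      simpa using h2
    have h1 := ((sub0 hgx).inner (𝕜 := ℂ) (sub0 hgx)).add ((sub0 hgy).inner (𝕜 := ℂ) (sub0 hgy))
    have h2 := h1.add ((tm 0 (left_mem_Icc_strip hd)).add (tm d (right_mem_Icc_strip hd)))
    simp only [inner_zero_left, add_zero] at h2
    refine h2.congr fun n => ?_
    rw [innerForm, W12.weakDeriv_ex_sub (u n).2 hv, W12.weakDeriv_ey_sub (u n).2 hv,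
      trace_sub hd (left_mem_Icc_strip hd) (u n).2 hv,
      trace_sub hd (right_mem_Icc_strip hd) (u n).2 hv]

end Form

/-! ### Difference quotients -/

theorem IsTest.inner_toL2 {d : ℝ} {φ : ℝ × ℝ → ℂ} (h : IsTest d φ) (u : L2Strip d) :
    inner ℂ (h.star.isCc.toL2 d) u = ∫ p in strip d, u p * φ p := by
  rw [L2.inner_def]
  refine integral_congr_ae ?_
  filter_upwards [h.star.isCc.coeFn_toL2 d] with p hp
  rw [hp, RCLike.inner_apply, Complex.conj_conj]

theorem IsTest.inner_weakDeriv_toL2 {d : ℝ} {φ : ℝ × ℝ → ℂ} (h : IsTest d φ) (v : ℝ × ℝ)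
    (u : L2Strip d) : inner ℂ (weakDeriv d v (h.star.isCc.toL2 d)) u =
      ∫ p in strip d, u p * fderiv ℝ φ p v := by
  rw [h.star.isCc.weakDeriv_toL2, L2.inner_def]
  refine integral_congr_ae ?_
  filter_upwards [(h.star.isCc.fderiv_apply v).coeFn_toL2 d] with p hp
  rw [hp, RCLike.inner_apply, h.isCc.fderiv_star, Complex.conj_conj]

/-- The translation moves onto the test function, whose difference quotients are bounded by its
Lipschitz constant. Steps have length at most `1`, so their supports stay in the ball of radius `R +
1`. -/
theorem tendsto_integral_differenceQuotient {d : ℝ} (g : L2Strip d) {φ : ℝ × ℝ → ℂ}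
    (hφ : IsTest d φ) :
    Tendsto (fun n : ℕ => ((n : ℂ) + 1) *
      ∫ p in strip d, (shift d (1 / ((n : ℝ) + 1)) g - g : L2Strip d) p * φ p) atTop
      (𝓝 (-∫ p in strip d, g p * fderiv ℝ φ p ex)) := by
  obtain ⟨K, hK⟩ := hφ.1.lipschitzWith_of_hasCompactSupport hφ.2.1 (by simp)
  obtain ⟨R, hR⟩ := hφ.2.1.isCompact.isBounded.subset_closedBall (0 : ℝ × ℝ)
  have hzero : ∀ p : ℝ × ℝ, R < ‖p‖ → φ p = 0 := fun p hp => by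
    by_contra hne
    have := hR (subset_tsupport φ hne)
    rw [mem_closedBall_zero_iff] at this
    linarith
  set B := Metric.closedBall (0 : ℝ × ℝ) (R + 1)
  have hn : ∀ n : ℕ, (0 : ℝ) < (n : ℝ) + 1 := fun n => by positivity
  have ht : ∀ n : ℕ, 1 / ((n : ℝ) + 1) ≤ 1 := fun n => by
    rw [div_le_one (hn n)]
    simp
  set D : ℕ → ℝ × ℝ → ℂ := fun n p =>
    ((n : ℂ) + 1) * (φ (p + (-(1 / ((n : ℝ) + 1)), 0)) - φ p) with hD
  have hDle : ∀ n p, ‖D n p‖ ≤ B.indicator (fun _ => (K : ℝ)) p := by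
    intro n p
    by_cases hp : p ∈ B
    · rw [Set.indicator_of_mem hp, hD]
      have h1 := hK.dist_le_mul (p + (-(1 / ((n : ℝ) + 1)), 0)) p
      rw [dist_eq_norm, dist_eq_norm, add_sub_cancel_left] at h1
      have h2 : ‖((-(1 / ((n : ℝ) + 1)), 0) : ℝ × ℝ)‖ = 1 / ((n : ℝ) + 1) := by
        rw [Prod.norm_mk, norm_neg, norm_zero, Real.norm_of_nonneg (by positivity),
          max_eq_left (by positivity)]
      have h3 : ‖((n : ℂ) + 1)‖ = (n : ℝ) + 1 := by
        rw [← Nat.cast_succ, Complex.norm_natCast, Nat.cast_succ]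
      rw [norm_mul, h3]
      rw [h2] at h1
      refine (mul_le_mul_of_nonneg_left h1 (hn n).le).trans (le_of_eq ?_)
      field_simp
    · rw [Set.indicator_of_notMem hp]
      rw [mem_closedBall_zero_iff, not_le] at hp
      have h1 : φ p = 0 := hzero p (by linarith)
      have h2 : φ (p + (-(1 / ((n : ℝ) + 1)), 0)) = 0 := by
        refine hzero _ ?_
        have h3 := norm_sub_norm_le p (p + (-(1 / ((n : ℝ) + 1)), 0))
        rw [sub_add_cancel_left, norm_neg] at h3
        have h4 : ‖((-(1 / ((n : ℝ) + 1)), 0) : ℝ × ℝ)‖ = 1 / ((n : ℝ) + 1) := by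
          rw [Prod.norm_mk, norm_neg, norm_zero, Real.norm_of_nonneg (by positivity),
            max_eq_left (by positivity)]
        linarith [ht n]
      simp only [hD, h1, h2, sub_zero, mul_zero, norm_zero, le_refl]
  have hDc : ∀ n, Continuous (D n) := fun n =>
    continuous_const.mul (((hφ.1.continuous).comp (by fun_prop)).sub hφ.1.continuous)
  have hBi : MemLp (B.indicator fun _ => (K : ℝ)) 2
      ((volume : Measure (ℝ × ℝ)).restrict (strip d)) :=
    memLp_indicator_const 2 Metric.isClosed_closedBall.measurableSet _
      (Or.inr (((Measure.restrict_apply_le _ _).trans_lt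
        (isCompact_closedBall _ _).measure_lt_top).ne))
  have hlim := tendsto_integral_of_dominated_convergence
    (μ := (volume : Measure (ℝ × ℝ)).restrict (strip d)) (F := fun n p => g p * D n p)
    (f := fun p => g p * -fderiv ℝ φ p ex)
    (fun p => ‖g p‖ * B.indicator (fun _ => (K : ℝ)) p)
    (fun n => (Lp.aestronglyMeasurable g).mul (hDc n).aestronglyMeasurable)
    ((Lp.memLp g).norm.integrable_mul hBi)
    (fun n => Eventually.of_forall fun p => by
      rw [norm_mul]
      exact mul_le_mul_of_nonneg_left (hDle n p) (norm_nonneg _))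
    (Eventually.of_forall fun p => by
      refine Tendsto.const_mul _ ?_
      have h1 : HasDerivAt (fun s : ℝ => φ (p + (-s, 0))) (-fderiv ℝ φ p ex) 0 := by
        have h2 := (hasDerivAt_comp_ex hφ.isCc p.1 p.2)
        have h3 : HasDerivAt (fun s : ℝ => p.1 + -s) (-1) 0 :=
          ((hasDerivAt_id (0 : ℝ)).neg).const_add p.1
        have h4 : HasDerivAt (fun x => φ (x, p.2)) (fderiv ℝ φ (p.1, p.2) ex) (p.1 + -0) := by
          simpa using h2
        have h5 := h4.scomp (0 : ℝ) h3
        simpa [Function.comp_def, Prod.add_def] using h5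
      have h2 := (hasDerivAt_iff_tendsto_slope_zero.1 h1).comp
        (tendsto_nhdsWithin_iff.2 ⟨tendsto_one_div_add_atTop_nhds_zero_nat (𝕜 := ℝ),
          Eventually.of_forall fun n => by
            simp only [Set.mem_compl_iff, Set.mem_singleton_iff]
            positivity⟩)
      refine h2.congr fun n => ?_
      have h0 : p + ((-0 : ℝ), (0 : ℝ)) = p := by simp [Prod.add_def]
      simp only [Function.comp, zero_add, hD, h0, Complex.real_smul]
      push_cast
      rw [one_div, inv_inv])
  simp only [mul_neg] at hlim
  rw [integral_neg] at hlim
  refine hlim.congr fun n => ?_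
  rw [sub_eq_add_neg (shift d _ g), ← neg_one_smul ℂ g, integral_add_mul _ _ hφ.memLp,
    integral_smul_mul, integral_shift_mul, ← integral_const_mul, ← integral_add,
    ← integral_const_mul]
  · refine integral_congr_ae (Eventually.of_forall fun p => ?_)
    simp only [hD]
    ring
  · have h := (hφ.shift (-(1 / ((n : ℝ) + 1)))).memLp
    exact integrable_mul g h
  · exact (integrable_mul g hφ.memLp).const_mul _

/-- A function whose difference quotients in the direction `x` are bounded has a weak derivative in
this direction. -/
theorem exists_hasWeakDeriv_ex_of_shift_le {d : ℝ} {g : L2Strip d} {C : ℝ}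
    (h : ∀ t : ℝ, 0 < t → t ≤ 1 → ‖shift d t g - g‖ ≤ C * t) :
    ∃ g', HasWeakDeriv d ex g g' := by
  set w : ℕ → L2Strip d := fun n => ((n : ℂ) + 1) • (shift d (1 / ((n : ℝ) + 1)) g - g) with hw
  have hn : ∀ n : ℕ, (0 : ℝ) < (n : ℝ) + 1 := fun n => by positivity
  have hwle : ∀ n, ‖w n‖ ≤ C := by
    intro n
    have h1 := h (1 / ((n : ℝ) + 1)) (by positivity) (by
      rw [div_le_one (hn n)]
      simp)
    have h3 : ‖((n : ℂ) + 1)‖ = (n : ℝ) + 1 := by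
      rw [← Nat.cast_succ, Complex.norm_natCast, Nat.cast_succ]
    rw [hw, norm_smul, h3]
    refine (mul_le_mul_of_nonneg_left h1 (hn n).le).trans (le_of_eq ?_)
    field_simp
  -- The difference quotients lie in a ball of the dual space, which is weak-* compact by
  -- Banach–Alaoglu. A limit along a free ultrafilter replaces a weakly convergent subsequence.
  obtain ⟨ℓ, -, hℓ⟩ := isCompact_iff_ultrafilter_le_nhds.1
    (WeakDual.isCompact_closedBall (0 : StrongDual ℂ (L2Strip d)) C)
    ((hyperfilter ℕ).map fun n => StrongDual.toWeakDual (InnerProductSpace.toDual ℂ _ (w n)))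
    (by
      rw [le_principal_iff, Ultrafilter.mem_coe, Ultrafilter.mem_map]
      refine Filter.univ_mem' fun n => ?_
      refine mem_closedBall_zero_iff.2 ?_
      exact ((InnerProductSpace.toDual ℂ (L2Strip d)).norm_map (w n)).le.trans (hwle n))
  have hev : ∀ f : L2Strip d, Tendsto (fun n => inner ℂ (w n) f) (hyperfilter ℕ : Filter ℕ)
      (𝓝 (ℓ f)) := fun f =>
    ((WeakDual.eval_continuous f).tendsto ℓ).comp hℓ
  set g' := (InnerProductSpace.toDual ℂ (L2Strip d)).symm (WeakDual.toStrongDual ℓ)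
  have hg' : ∀ f, inner ℂ g' f = ℓ f := fun f => InnerProductSpace.toDual_symm_apply
  refine ⟨g', fun φ hφ => ?_⟩
  have h1 := ((hev (hφ.star.isCc.toL2 d)).star)
  rw [← hg'] at h1
  simp only [RCLike.star_def, inner_conj_symm] at h1
  have h2 := (tendsto_integral_differenceQuotient g hφ).mono_left Nat.hyperfilter_le_atTop
  have h3 := tendsto_nhds_unique h1 (h2.congr fun n => by
    rw [hw, inner_smul_right, hφ.inner_toL2])
  rw [hφ.inner_toL2] at h3
  rw [h3, neg_neg]

/-! ### Regularity of the functions in the domain of the form operator -/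

section Regularity

variable {d : ℝ} (hd : 0 < d) {α : ℝ → ℝ} (hα : MemLp α ⊤ volume)

include hd in
/-- The commutator of the Robin form with a translation is a boundary term. -/
theorem innerForm_shift_sub {ψ : L2Strip d} (hψ : ψ ∈ W12 d) {η : L2Strip d} (hη : η ∈ W12 d)
    (t : ℝ) :
    innerForm d hα η (shift d t ψ - ψ) = innerForm d hα (shift d (-t) η - η) ψ +
      (inner ℂ (trace d 0 η) (mulLine α hα (shiftLine t (trace d 0 ψ)) -
          shiftLine t (mulLine α hα (trace d 0 ψ))) +
        inner ℂ (trace d d η) (mulLine α hα (shiftLine t (trace d d ψ)) -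
          shiftLine t (mulLine α hα (trace d d ψ)))) := by
  have m0 := left_mem_Icc_strip hd
  have md := right_mem_Icc_strip hd
  have hs := shift_mem_W12 hψ t
  have hs' := shift_mem_W12 hη (-t)
  rw [innerForm, innerForm, W12.weakDeriv_ex_sub hs hψ, W12.weakDeriv_ey_sub hs hψ,
    W12.weakDeriv_ex_sub hs' hη, W12.weakDeriv_ey_sub hs' hη, trace_sub hd m0 hs hψ,
    trace_sub hd md hs hψ, trace_sub hd m0 hs' hη, trace_sub hd md hs' hη,
    weakDeriv_ex_shift hψ, weakDeriv_ey_shift hψ, weakDeriv_ex_shift hη, weakDeriv_ey_shift hη,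
    trace_shift hd m0 hψ, trace_shift hd md hψ, trace_shift hd m0 hη, trace_shift hd md hη]
  simp only [map_sub, inner_sub_left, inner_sub_right, inner_shift, inner_shiftLine]
  ring

include hd in
theorem norm_trace_le {b : ℝ} (hb : b ∈ Set.Icc 0 d) {u : L2Strip d} (hu : u ∈ W12 d) :
    ‖trace d b u‖ ≤ Real.sqrt (4 / d + 4 * d) * (‖u‖ + ‖weakDeriv d ey u‖) := by
  refine le_of_sq_le_sq ?_ (by positivity)
  rw [mul_pow, Real.sq_sqrt (by positivity)]
  refine (norm_trace_sq_le hd hb hu).trans ?_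
  have h1 : 0 < 4 / d := by positivity
  have h2 := norm_nonneg u
  have h3 := norm_nonneg (weakDeriv d ey u)
  have h4 : 0 ≤ ‖u‖ * ‖weakDeriv d ey u‖ := mul_nonneg h2 h3
  nlinarith [mul_nonneg h1.le (sq_nonneg ‖weakDeriv d ey u‖), mul_nonneg h1.le h4,
    mul_nonneg hd.le (sq_nonneg ‖u‖), mul_nonneg hd.le h4]

/-- Absorption: if `N` exceeded `(P + Q + 1)t`, then `t ≤ N`, so `t²Q ≤ tNQ` and the hypothesis
would give `N ≤ (P + Q)t`. -/
theorem le_mul_of_sq_le {N t P Q : ℝ} (ht : 0 ≤ t) (hN : 0 ≤ N) (hP : 0 ≤ P) (hQ : 0 ≤ Q)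
    (h : N ^ 2 ≤ t * N * P + t ^ 2 * Q) : N ≤ (P + Q + 1) * t := by
  by_contra! hlt
  have h0 : 0 ≤ P + Q + 1 := by positivity
  have hN0 : 0 < N := lt_of_le_of_lt (mul_nonneg h0 ht) hlt
  have h1 : N * ((P + Q + 1) * t) < N * N := mul_lt_mul_of_pos_left hlt hN0
  have h2 : t ≤ N := by nlinarith [mul_nonneg (add_nonneg hP hQ) ht]
  have h3 : t * t * Q ≤ N * t * Q :=
    mul_le_mul_of_nonneg_right (mul_le_mul_of_nonneg_right h2 ht) hQ
  nlinarith [mul_nonneg hN ht]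

include hd in
/-- Nirenberg's method of difference quotients along the strip. -/
theorem exists_norm_shift_gradient_le (h0 : ∀ x, 0 ≤ α x) {L : ℝ} (hL0 : 0 ≤ L)
    (hL : ∀ t : ℝ, 0 ≤ t → ∀ᵐ x : ℝ, |α (x + t) - α x| ≤ L * t) {ψ F : L2Strip d}
    (hψ : ψ ∈ W12 d) (hF : ∀ φ ∈ W12 d, innerForm d hα φ ψ = inner ℂ φ F) :
    ∃ C : ℝ, ∀ t : ℝ, 0 < t →
      ‖shift d t (weakDeriv d ex ψ) - weakDeriv d ex ψ‖ ≤ C * t ∧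
      ‖shift d t (weakDeriv d ey ψ) - weakDeriv d ey ψ‖ ≤ C * t := by
  have m0 := left_mem_Icc_strip hd
  have md := right_mem_Icc_strip hd
  set K := Real.sqrt (4 / d + 4 * d)
  have hK : 0 ≤ K := Real.sqrt_nonneg _
  set X := ‖weakDeriv d ex ψ‖
  set S := ‖trace d 0 ψ‖ + ‖trace d d ψ‖
  have hX : 0 ≤ X := norm_nonneg _
  have hS : 0 ≤ S := by positivity
  refine ⟨(‖F‖ + L * K * S) + L * K * S * X + 1, fun t ht => ?_⟩
  have hs := shift_mem_W12 hψ t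
  set η := shift d t ψ - ψ with hη_def
  have hη : η ∈ W12 d := sub_mem hs hψ
  have hζ : shift d (-t) η - η ∈ W12 d := sub_mem (shift_mem_W12 hη _) hη
  have ex_eq : shift d t (weakDeriv d ex ψ) - weakDeriv d ex ψ = weakDeriv d ex η := by
    rw [hη_def, W12.weakDeriv_ex_sub hs hψ, weakDeriv_ex_shift hψ]
  have ey_eq : shift d t (weakDeriv d ey ψ) - weakDeriv d ey ψ = weakDeriv d ey η := by
    rw [hη_def, W12.weakDeriv_ey_sub hs hψ, weakDeriv_ey_shift hψ]
  rw [ex_eq, ey_eq]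
  set N := Real.sqrt (‖weakDeriv d ex η‖ ^ 2 + ‖weakDeriv d ey η‖ ^ 2) with hN_def
  have hN : 0 ≤ N := Real.sqrt_nonneg _
  have hNsq : N ^ 2 = ‖weakDeriv d ex η‖ ^ 2 + ‖weakDeriv d ey η‖ ^ 2 :=
    Real.sq_sqrt (by positivity)
  have hNx : ‖weakDeriv d ex η‖ ≤ N :=
    Real.le_sqrt_of_sq_le (le_add_of_nonneg_right (sq_nonneg _))
  have hNy : ‖weakDeriv d ey η‖ ≤ N :=
    Real.le_sqrt_of_sq_le (le_add_of_nonneg_left (sq_nonneg _))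
  suffices hmain : N ≤ (‖F‖ + L * K * S + L * K * S * X + 1) * t from
    ⟨hNx.trans hmain, hNy.trans hmain⟩
  have hηn : ‖η‖ ≤ t * X := norm_shift_sub_le hd hψ ht.le
  have hζn : ‖shift d (-t) η - η‖ ≤ t * N :=
    (norm_shift_neg_sub_le hd hη ht.le).trans (mul_le_mul_of_nonneg_left hNx ht.le)
  have htr : ∀ b ∈ Set.Icc 0 d, ‖trace d b η‖ ≤ K * (t * X + N) := fun b hb =>
    (norm_trace_le hd hb hη).trans (mul_le_mul_of_nonneg_left (add_le_add hηn hNy) hK)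
  have hcomm : ∀ b ∈ Set.Icc 0 d, ‖inner ℂ (trace d b η)
      (mulLine α hα (shiftLine t (trace d b ψ)) - shiftLine t (mulLine α hα (trace d b ψ)))‖ ≤
      K * (t * X + N) * (L * t * ‖trace d b ψ‖) := fun b hb =>
    (norm_inner_le_norm _ _).trans (mul_le_mul (htr b hb)
      (norm_commutator_le hα (hL t ht.le) _) (norm_nonneg _) (by positivity))
  -- Here `P = ‖F‖ + L K S` and `Q = L K S X`: the term with `F` is at most `t N ‖F‖`, and the two
  -- commutators contribute `K (t X + N) L t S`.
  refine le_mul_of_sq_le ht.le hN (by positivity) (by positivity) ?_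
  have h1 := norm_sq_le_innerForm_re hα h0 η
  rw [← hNsq] at h1
  -- One translation in `h(η, η)` is moved to the left slot, so the weak equation is tested with the
  -- second difference of `ψ`, whose norm is `O(t N)`.
  have h2 : innerForm d hα η η = _ := innerForm_shift_sub hd hα hψ hη t
  rw [hF _ hζ] at h2
  rw [h2] at h1
  have h4 : ‖inner ℂ (shift d (-t) η - η) F‖ ≤ t * N * ‖F‖ :=
    (norm_inner_le_norm _ _).trans (mul_le_mul_of_nonneg_right hζn (norm_nonneg _))
  have h5 := (norm_add_le _ _).trans (add_le_add h4 ((norm_add_le _ _).trans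
    (add_le_add (hcomm 0 m0) (hcomm d md))))
  refine (h1.trans ((Complex.re_le_norm _).trans h5)).trans (le_of_eq ?_)
  simp only [S]
  ring

theorem IsTest.fderiv_fderiv_comm {φ : ℝ × ℝ → ℂ} (h : IsTest d φ) (p v w : ℝ × ℝ) :
    fderiv ℝ (fun q => fderiv ℝ φ q v) p w = fderiv ℝ (fun q => fderiv ℝ φ q w) p v := by
  have hd : DifferentiableAt ℝ (fderiv ℝ φ) p :=
    ((h.1.fderiv_right (m := ∞) (by simp)).differentiable (by simp)) p
  have e : ∀ v w, fderiv ℝ (fun q => fderiv ℝ φ q v) p w = fderiv ℝ (fderiv ℝ φ) p w v := by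
    intro v w
    rw [fderiv_clm_apply hd (differentiableAt_const _)]
    simp
  rw [e, e]
  exact (h.1.contDiffAt.isSymmSndFDerivAt (by
    simp only [minSmoothness_of_isRCLikeNormedField]
    exact WithTop.coe_le_coe.2 (le_top : (2 : ℕ∞) ≤ ⊤))) w v

/-- Mixed weak derivatives commute. -/
theorem HasWeakDeriv.comm {v w : ℝ × ℝ} {u gv gw g : L2Strip d} (hv : HasWeakDeriv d v u gv)
    (hw : HasWeakDeriv d w u gw) (h : HasWeakDeriv d v gw g) : HasWeakDeriv d w gv g := by
  intro φ hφ
  have h1 := hv _ (hφ.fderiv_apply w)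
  have h2 := hw _ (hφ.fderiv_apply v)
  have h3 := h φ hφ
  simp_rw [hφ.fderiv_fderiv_comm _ w v] at h1
  rw [h1] at h2
  rw [← h3]
  linear_combination -h2

theorem IsTest.lineL2_eq_zero {φ : ℝ × ℝ → ℂ} (h : IsTest d φ) {b : ℝ} (hb : b ∉ Set.Ioo 0 d) :
    h.isCc.lineL2 b = 0 := by
  refine Lp.ext ?_
  filter_upwards [h.isCc.coeFn_lineL2 b, Lp.coeFn_zero ℂ 2 (volume : Measure ℝ)] with x h1 h2
  rw [h1, h2]
  exact h.eq_zero fun hp => hb hp.2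

include hd in
-- A test function vanishes on both boundary lines, so only the gradient part survives: on test
-- functions the form gives the equation in the sense of distributions.
theorem IsTest.innerForm_star {φ : ℝ × ℝ → ℂ} (h : IsTest d φ) (ψ : L2Strip d) :
    innerForm d hα (h.star.isCc.toL2 d) ψ =
      (∫ p in strip d, weakDeriv d ex ψ p * fderiv ℝ φ p ex) +
        ∫ p in strip d, weakDeriv d ey ψ p * fderiv ℝ φ p ey := by
  rw [innerForm, h.inner_weakDeriv_toL2, h.inner_weakDeriv_toL2,
    (h.star.isCc.isTrace d 0).trace_eq hd (left_mem_Icc_strip hd),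
    (h.star.isCc.isTrace d d).trace_eq hd (right_mem_Icc_strip hd),
    h.star.lineL2_eq_zero (by simp), h.star.lineL2_eq_zero (by simp), inner_zero_left,
    inner_zero_left, add_zero, add_zero]

include hd in
/-- Weak solutions of the Robin problem are in `W^{2,2}(Ω)` and solve the equation. -/
theorem mem_W22_of_innerForm_eq (h0 : ∀ x, 0 ≤ α x) {L : ℝ} (hL0 : 0 ≤ L)
    (hL : ∀ t : ℝ, 0 ≤ t → ∀ᵐ x : ℝ, |α (x + t) - α x| ≤ L * t) {ψ F : L2Strip d}
    (hψ : ψ ∈ W12 d) (hF : ∀ φ ∈ W12 d, innerForm d hα φ ψ = inner ℂ φ F) :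
    ψ ∈ W22 d ∧
      F = -(weakDeriv d ex (weakDeriv d ex ψ) + weakDeriv d ey (weakDeriv d ey ψ)) := by
  obtain ⟨C, hC⟩ := exists_norm_shift_gradient_le hd hα h0 hL0 hL hψ hF
  obtain ⟨gxx, hxx⟩ := exists_hasWeakDeriv_ex_of_shift_le fun t ht _ => (hC t ht).1
  obtain ⟨gxy, hxy⟩ := exists_hasWeakDeriv_ex_of_shift_le fun t ht _ => (hC t ht).2
  have hx := W12.hasWeakDeriv_ex hψ
  have hy := W12.hasWeakDeriv_ey hψ
  have hyx : HasWeakDeriv d ey (weakDeriv d ex ψ) gxy := hx.comm hy hxy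
  -- Translations in `y` do not preserve the strip, so this derivative is read off from the equation
  -- as `-(F + ∂_x∂_xψ)`.
  have hyy : HasWeakDeriv d ey (weakDeriv d ey ψ) ((-1 : ℂ) • (F + gxx)) := by
    intro φ hφ
    have h1 := hF _ (hφ.star.isCc.mem_W12 d)
    rw [hφ.innerForm_star hd hα, hφ.inner_toL2, hxx φ hφ] at h1
    rw [integral_smul_mul, integral_add_mul _ _ hφ.memLp]
    linear_combination h1
  refine ⟨⟨hψ, ⟨⟨_, hxx⟩, ⟨_, hyx⟩⟩, ⟨⟨_, hxy⟩, ⟨_, hyy⟩⟩⟩, ?_⟩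
  rw [hxx.weakDeriv_eq, hyy.weakDeriv_eq, neg_one_smul]
  abel

/-! ### Recovery of the boundary conditions -/

include hd in
/-- The Robin form for functions in `W^{2,2}(Ω)`. -/
theorem innerForm_eq_of_mem_W22 {φ ψ : L2Strip d} (hφ : φ ∈ W12 d) (hψ : ψ ∈ W22 d) :
    innerForm d hα φ ψ =
      inner ℂ φ (-(weakDeriv d ex (weakDeriv d ex ψ) + weakDeriv d ey (weakDeriv d ey ψ))) +
      (inner ℂ (trace d 0 φ) (-trace d 0 (weakDeriv d ey ψ) + mulLine α hα (trace d 0 ψ)) +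
        inner ℂ (trace d d φ) (trace d d (weakDeriv d ey ψ) + mulLine α hα (trace d d ψ))) := by
  have h1 := green_ex hd hφ hψ.2.1
  have h2 := green_ey hd hφ hψ.2.2
  simp only [innerForm, inner_neg_right, inner_add_right]
  linear_combination h1 + h2

/-- A function of two variables which is a product of smooth functions of one variable. -/
theorem isCc_prod {f χ : ℝ → ℝ} (hf : ContDiff ℝ ∞ f) (hfc : HasCompactSupport f)
    (hχ : ContDiff ℝ ∞ χ) (hχc : HasCompactSupport χ) :
    IsCc fun p => ((f p.1 * χ p.2 : ℝ) : ℂ) := by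
  refine ⟨Complex.ofRealCLM.contDiff.comp
    ((hf.comp contDiff_fst).mul (hχ.comp contDiff_snd)), ?_⟩
  refine HasCompactSupport.intro (hfc.isCompact.prod hχc.isCompact) fun p hp => ?_
  have : f p.1 * χ p.2 = 0 := by
    by_contra hne
    exact hp ⟨subset_tsupport f (left_ne_zero_of_mul hne),
      subset_tsupport χ (right_ne_zero_of_mul hne)⟩
  rw [this, Complex.ofReal_zero]

theorem eq_zero_of_forall_inner_eq_zero {r : L2Line}
    (h : ∀ (f : ℝ → ℝ) (hf : MemLp (fun x => (f x : ℂ)) 2 volume), ContDiff ℝ ∞ f →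
      HasCompactSupport f → inner ℂ (hf.toLp _) r = 0) : r = 0 := by
  have key := ae_eq_zero_of_integral_contDiff_smul_eq_zero (f := r) (μ := volume)
    ((Lp.memLp r).locallyIntegrable (by norm_num)) fun f hf hfc => by
      have hm : MemLp (fun x => (f x : ℂ)) 2 volume :=
        (hf.continuous.memLp_of_hasCompactSupport hfc).ofReal
      have h1 := h f hm hf hfc
      rw [L2.inner_def] at h1
      rw [← h1]
      refine integral_congr_ae ?_
      filter_upwards [hm.coeFn_toLp] with x hx
      rw [hx, RCLike.inner_apply, Complex.conj_ofReal, Complex.real_smul, mul_comm]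
  refine Lp.ext ?_
  filter_upwards [key, Lp.coeFn_zero ℂ 2 (volume : Measure ℝ)] with x h1 h2
  rw [h1, h2, Pi.zero_apply]

include hd in
/-- The traces of functions in `W^{1,2}(Ω)` are rich enough to separate boundary values. -/
theorem eq_zero_of_forall_inner_trace {r₀ r₁ : L2Line}
    (h : ∀ φ ∈ W12 d, inner ℂ (trace d 0 φ) r₀ + inner ℂ (trace d d φ) r₁ = 0) :
    r₀ = 0 ∧ r₁ = 0 := by
  -- The outer radius `d / 2` makes a bump centred on one boundary line vanish on the other, so the
  -- two boundary values can be tested separately.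
  have hb : ∀ b : ℝ, ∃ χ : ContDiffBump b, χ.rOut = d / 2 := fun b =>
    ⟨⟨d / 4, d / 2, by positivity, by linarith⟩, rfl⟩
  have tr : ∀ {f χ : ℝ → ℝ} (H : IsCc fun p => ((f p.1 * χ p.2 : ℝ) : ℂ)) {b c : ℝ}
      (_ : b ∈ Set.Icc 0 d) (_ : χ b = c) (hf : MemLp (fun x => (f x : ℂ)) 2 volume),
      trace d b (H.toL2 d) = (c : ℂ) • hf.toLp _ := by
    intro f χ H b c hb hc hf
    rw [(H.isTrace d b).trace_eq hd hb]
    refine Lp.ext ?_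
    filter_upwards [H.coeFn_lineL2 b, hf.coeFn_toLp, Lp.coeFn_smul (c : ℂ) (hf.toLp _)]
      with x h1 h2 h3
    rw [h1, h3, Pi.smul_apply, h2, hc, smul_eq_mul, Complex.ofReal_mul, mul_comm]
  constructor
  · refine eq_zero_of_forall_inner_eq_zero fun f hm hf hfc => ?_
    obtain ⟨χ, hχ⟩ := hb 0
    have H := isCc_prod hf hfc χ.contDiff χ.hasCompactSupport
    have h1 := h _ (H.mem_W12 d)
    rw [tr H (left_mem_Icc_strip hd) (c := 1)
        (χ.one_of_mem_closedBall (Metric.mem_closedBall_self χ.rIn_pos.le)) hm,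
      tr H (right_mem_Icc_strip hd) (c := 0) (χ.zero_of_le_dist (by
        rw [hχ, Real.dist_eq, sub_zero, abs_of_pos hd]
        linarith)) hm] at h1
    simpa using h1
  · refine eq_zero_of_forall_inner_eq_zero fun f hm hf hfc => ?_
    obtain ⟨χ, hχ⟩ := hb d
    have H := isCc_prod hf hfc χ.contDiff χ.hasCompactSupport
    have h1 := h _ (H.mem_W12 d)
    rw [tr H (right_mem_Icc_strip hd) (c := 1)
        (χ.one_of_mem_closedBall (Metric.mem_closedBall_self χ.rIn_pos.le)) hm,
      tr H (left_mem_Icc_strip hd) (c := 0) (χ.zero_of_le_dist (by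
        rw [hχ, Real.dist_eq, zero_sub, abs_neg, abs_of_pos hd]
        linarith)) hm] at h1
    simpa using h1

include hd in
-- Uniqueness of traces replaces the existentially quantified boundary values by `trace`, turning
-- almost everywhere identities into equations in `L²(ℝ)`.
theorem robinBC_iff {ψ : L2Strip d} (hψ : ψ ∈ W22 d) :
    RobinBC d α ψ ↔ -trace d 0 (weakDeriv d ey ψ) + mulLine α hα (trace d 0 ψ) = 0 ∧
      trace d d (weakDeriv d ey ψ) + mulLine α hα (trace d d ψ) = 0 := by
  have m0 := left_mem_Icc_strip hd
  have md := right_mem_Icc_strip hd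
  have e0 : ∀ s t : L2Line, (∀ᵐ x : ℝ, -t x + (α x : ℂ) * s x = 0) ↔
      -t + mulLine α hα s = 0 := by
    intro s t
    rw [Lp.ext_iff]
    refine eventually_congr ?_
    filter_upwards [Lp.coeFn_add (-t) (mulLine α hα s), Lp.coeFn_neg t, coeFn_mulLine hα s,
      Lp.coeFn_zero ℂ 2 (volume : Measure ℝ)] with x h1 h2 h3 h4
    rw [h1, Pi.add_apply, h2, Pi.neg_apply, h3, h4, Pi.zero_apply]
  have e1 : ∀ s t : L2Line, (∀ᵐ x : ℝ, t x + (α x : ℂ) * s x = 0) ↔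
      t + mulLine α hα s = 0 := by
    intro s t
    rw [Lp.ext_iff]
    refine eventually_congr ?_
    filter_upwards [Lp.coeFn_add t (mulLine α hα s), coeFn_mulLine hα s,
      Lp.coeFn_zero ℂ 2 (volume : Measure ℝ)] with x h1 h3 h4
    rw [h1, Pi.add_apply, h3, h4, Pi.zero_apply]
  constructor
  · rintro ⟨s₀, s₁, t₀, t₁, hs₀, hs₁, ht₀, ht₁, h₀, h₁⟩
    rw [hs₀.trace_eq hd m0, hs₁.trace_eq hd md, ht₀.trace_eq hd m0, ht₁.trace_eq hd md]
    exact ⟨(e0 _ _).1 h₀, (e1 _ _).1 h₁⟩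
  · rintro ⟨h₀, h₁⟩
    exact ⟨_, _, _, _, isTrace_trace hd m0 hψ.1, isTrace_trace hd md hψ.1,
      isTrace_trace hd m0 hψ.2.2, isTrace_trace hd md hψ.2.2, (e0 _ _).2 h₀, (e1 _ _).2 h₁⟩

include hd in
/-- The Robin Laplacian is the operator associated with the Robin form. -/
theorem isFormOperator_robinLaplacian (hα' : MemW1Inf α) (h0 : ∀ x, 0 ≤ α x) :
    IsFormOperator (W12 d) (robinForm d α) (robinLaplacian d α) := by
  obtain ⟨L, hL0, hL⟩ := hα'.exists_lipschitz
  have hα := hα'.1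
  intro ψ F
  simp only [robinForm_eq d hα]
  rw [LinearPMap.mem_graph_iff]
  constructor
  · rintro ⟨⟨ψ', hψ⟩, rfl, rfl⟩
    refine ⟨hψ.1.1, fun φ => ?_⟩
    obtain ⟨b0, b1⟩ := (robinBC_iff hd hα hψ.1).1 hψ.2
    rw [innerForm_eq_of_mem_W22 hd hα φ.2 hψ.1, b0, b1, inner_zero_right, inner_zero_right,
      add_zero, add_zero]
    rfl
  · rintro ⟨hψ, h⟩
    have hF : ∀ φ ∈ W12 d, innerForm d hα φ ψ = inner ℂ φ F := fun φ hφ => h ⟨φ, hφ⟩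
    obtain ⟨h22, rfl⟩ := mem_W22_of_innerForm_eq hd hα h0 hL0 hL hψ hF
    -- The weak equation and Green's formulas have the same interior term, so the boundary terms sum
    -- to zero for every `φ` in `W^{1,2}(Ω)`.
    have hbc := (robinBC_iff hd hα h22).2 (eq_zero_of_forall_inner_trace hd fun φ hφ => by
      have h1 := hF φ hφ
      rw [innerForm_eq_of_mem_W22 hd hα hφ h22] at h1
      linear_combination h1)
    exact ⟨⟨ψ, h22, hbc⟩, rfl, rfl⟩

end Regularity

end RobinStrip

end

theorem theorem2p2 (d : ℝ) (hd : 0 < d) (α : ℝ → ℝ) (hα : RobinStrip.MemW1Inf α)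
    (hpos : ∀ x, 0 < α x) :
    RobinStrip.IsClosedNonnegForm (RobinStrip.W12 d) (RobinStrip.robinForm d α) ∧
    RobinStrip.IsFormOperator (RobinStrip.W12 d) (RobinStrip.robinForm d α)
      (RobinStrip.robinFormOperator d α) ∧
    IsSelfAdjoint (RobinStrip.robinFormOperator d α) ∧
    RobinStrip.robinLaplacian d α = RobinStrip.robinFormOperator d α ∧
    IsSelfAdjoint (RobinStrip.robinLaplacian d α) := by
  have H := RobinStrip.isClosedNonnegForm_robinForm hd hα.1 fun x => (hpos x).le
  have hT : RobinStrip.IsFormOperator (RobinStrip.W12 d) (RobinStrip.robinForm d α)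
      (RobinStrip.robinFormOperator d α) :=
    RobinStrip.isFormOperator_formOperator H.exists_formOperator
  have hR := RobinStrip.isFormOperator_robinLaplacian hd hα fun x => (hpos x).le
  exact ⟨H, hT, hT.isSelfAdjoint H, hR.unique hT, hR.isSelfAdjoint H⟩
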